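/- Work in the Euclidean plane, with origin $o$. A planar convex body is a compact convex set with nonempty interior; it is $\mathcal C^2_+$ if its boundary is a $C^2$ submanifold of the plane with nowhere vanishing curvature. The covariogram of a planar convex body $K$ is $g_K(x)=\mathrm{area}(K\cap(K+x))$, and its difference body is $DK=\{x-y: x,y\in K\}$. Reflections are reflections in a point. A local symmetry of $K$ is a pair of closed arcs $A^+,A^-\subseteq\operatorname{bd}K$ that are reflections of each other in a point, have disjoint and nonempty relative interiors, and are not properly contained in another pair of boundary arcs of $K$ with these properties. An arc $A\subseteq\operatorname{bd}DK$ corresponds to the local symmetry $A^+,A^-$ if there is a vector $w$ with $A=2A^++w$ and $-A=2A^-+w$. Theorem. Let $K$ and $H$ be planar convex bodies and let $K$ be $\mathcal C^2_+$. Let $\{\pm A_n\}_{n\in\mathcal N}$ be the collection of all arcs of $\operatorname{bd}DK$ that correspond to local symmetries of $K$, let $x_n$ be the midpoint of the segment joining the endpoints of $A_n$, and put $X_0=\{\pm x_n: n\in\mathcal N\}$. Let $X=X_0\cup\operatorname{bd}DK$ or $X=X_0\cup\{o\}$. If $g_K(x)=g_H(x)$ for all $x$ in some neighbourhood of $X$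 (that is, in some open set containing $X$), then $H$ is a translate of $K$ or the image of $K$ under a reflection in a point. -/

import Mathlib

open MeasureTheory Set
open scoped Pointwise Topology

/-- The Euclidean plane. -/
abbrev Plane : Type := EuclideanSpace ℝ (Fin 2)

/-- The covariogram of `K`: the area of `K ∩ (K + x)`, as a function of `x`. -/
noncomputable def covariogram (K : Set Plane) (x : Plane) : ℝ :=
  volume.real (K ∩ (x +ᵥ K))

/-- The difference body `{x - y | x, y ∈ K}`. -/
def differenceBody (K : Set Plane) : Set Plane := K - K

/-- The covariograms of `K` and `H` agree at all points of some (topological) neighbourhood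
of the set `X`. -/
def CovariogramsCoincideNear (K H X : Set Plane) : Prop :=
  ∀ᶠ x in 𝓝ˢ X, covariogram K x = covariogram H x

/-- The boundary of `K` is a `C²` submanifold of the plane with nowhere vanishing curvature:
near each of its points `p` it is the zero set of a `C²` function `f` with `df(p) ≠ 0`, and
`d²f(p)(v, v) ≠ 0` for the nonzero tangent vectors `v` at `p` (the curvature of the curve
`f = 0` at `p` is, up to sign, `d²f(p)(v, v) / ‖df(p)‖` for a unit tangent vector `v`). -/
def IsC2Plus (K : Set Plane) : Prop :=
  ∀ p ∈ frontier K, ∃ (U : Set Plane) (f : Plane → ℝ),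
    IsOpen U ∧ p ∈ U ∧ ContDiffOn ℝ 2 f U ∧
    frontier K ∩ U = {x ∈ U | f x = 0} ∧
    fderiv ℝ f p ≠ 0 ∧
    ∀ v : Plane, v ≠ 0 → fderiv ℝ f p v = 0 → fderiv ℝ (fderiv ℝ f) p v v ≠ 0

/-- `A` is a closed (nondegenerate) arc with endpoints `a` and `b`. Its relative interior is
`A \ {a, b}`, which is nonempty. -/
def IsArc (A : Set Plane) (a b : Plane) : Prop :=
  ∃ γ : Path a b, Function.Injective γ ∧ range γ = A

/-- `A` and `A'` are closed boundary arcs of `K` which are reflections of each other in a point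
and whose (nonempty) relative interiors are disjoint. -/
def IsSymmetricArcPair (K A A' : Set Plane) : Prop :=
  A ⊆ frontier K ∧ A' ⊆ frontier K ∧
  (∃ c : Plane, A' = AffineEquiv.pointReflection ℝ c '' A) ∧
  ∃ a b a' b' : Plane, IsArc A a b ∧ IsArc A' a' b' ∧ Disjoint (A \ {a, b}) (A' \ {a', b'})

/-- The pair `A`, `A'` is a local symmetry of `K`: a pair as in `IsSymmetricArcPair` that is not
properly contained in another such pair. -/
def IsLocalSymmetry (K A A' : Set Plane) : Prop :=
  IsSymmetricArcPair K A A' ∧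
  ∀ B B' : Set Plane, IsSymmetricArcPair K B B' → A ⊆ B → A' ⊆ B' → A = B ∧ A' = B'

/-- `A` is a boundary arc of the difference body of `K`, with endpoints `a` and `b`, which
corresponds to a local symmetry `A₁`, `A₂` of `K`: for some translation vector `w`, the arcs
`2 A₁ + w` and `2 A₂ + w` are `A` and `-A`. -/
def IsCorrespondingArc (K A : Set Plane) (a b : Plane) : Prop :=
  IsArc A a b ∧ A ⊆ frontier (differenceBody K) ∧
  ∃ (A₁ A₂ : Set Plane) (w : Plane), IsLocalSymmetry K A₁ A₂ ∧
    A = w +ᵥ (2 : ℝ) • A₁ ∧ -A = w +ᵥ (2 : ℝ) • A₂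

/-- The set of all points `± x`, where `x` is the midpoint of the segment joining the endpoints
of an arc of the boundary of the difference body that corresponds to a local symmetry of `K`. -/
def symmetryMidpoints (K : Set Plane) : Set Plane :=
  {x | ∃ (A : Set Plane) (a b : Plane), IsCorrespondingArc K A a b ∧
    (x = midpoint ℝ a b ∨ x = -midpoint ℝ a b)}

/-! For nonzero x in the interior of DK, the boundaries of K and K + x meet at the two vertices of
the lens K ∩ (K + x). The gradient of g_K at x is, up to a quarter turn, the vector joining these
vertices (`fderiv_covariogram`). This vector is `chordGap K x`, so local equality of covariograms
means local equality of gaps (`chordGap_eq_of_covariogram_eq`). The vertices and their translates by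
-x form a parallelogram inscribed in K. Exchanging its two pairs of sides gives `chordGap_chordGap`,
so data near x and data near the gap of x are equivalent. Data near bd DK determine DK through the
positivity of g, and data near o do so through the widths. In both cases the gaps are known at all
short vectors, because the gap of a short vector is close to bd DK. `GapData` collects this
information.

Curvature: equality of gaps says that the sum of the end points of the extremal chords of K and -K
with a given vector v equals the corresponding sum for H and -H. Differentiating in v relates the
slopes of the normals at the ends of these chords (`chordSlopes_identity`). Let p₁, p₂ be the radii
of curvature of K at opposite directions. For short chords the limiting average slopes L, L' of H
and -H satisfy L + L' = p₁ + p₂ and L L' = (1 - 4k²) p₁ p₂, where k is an asymmetry of the chord. No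
second-order regularity of H is known at this stage, so limits are taken along ultrafilters. Where L
is largest, k vanishes. Hence no limit exceeds max p₁ p₂, which forces L to be p₁ or p₂, and
connectedness of the set of small intervals makes the choice uniform (`SlopesLinked.tendsto`).
Therefore H has a radius of curvature everywhere, equal to one of the two opposite radii of K
(`hasStrictDerivAt_of_gap`).

Propagation: if opposite radii of K always agree, H is a translate of K. Otherwise they differ at
some direction, and after a reflection and a translation H and K share a boundary arc around it. Let
P and Q be the support points of K and -K, let the shared arc end at β, and let [γ, β] be the
largest interval ending at β on which P - Q is constant. If P - Q stays constant beyond β, the radii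
agree there and H follows K. If not, the chords from P a to P β with a < γ are shared by K and H.
Equality of gaps then puts the ends of the opposite extremal chords on the boundaries of both -K and
-H, and since the symmetry fails to the left of γ these ends (or the ones obtained by exchanging K
and -K) sweep an arc beyond β (`exists_supportPt_eq_of_gap`). For γ = β short vectors suffice. For γ
< β the gaps are needed near P β - P γ. There [γ, β] is a local symmetry of K, and the gap at this
vector is one of the points ±x_n (`neg_chordGap_mem_symmetryMidpoints`); this is the role of X₀. -/

/-! ### Rotating frames and scalar and wedge products in coordinates. -/

/-- The unit vector in direction `θ`. -/
noncomputable def unitVec (θ : ℝ) : Plane := !₂[Real.cos θ, Real.sin θ]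

/-- The unit vector in direction `θ + π / 2`. -/
noncomputable def tangentVec (θ : ℝ) : Plane := !₂[-Real.sin θ, Real.cos θ]

/-- The scalar product of the plane, in coordinates. -/
def dot (x y : Plane) : ℝ := x 0 * y 0 + x 1 * y 1

/-- The wedge product of the plane, in coordinates. -/
def wedge (x y : Plane) : ℝ := x 0 * y 1 - x 1 * y 0

@[simp] lemma unitVec_zero (θ : ℝ) : unitVec θ 0 = Real.cos θ := by simp [unitVec]
@[simp] lemma unitVec_one (θ : ℝ) : unitVec θ 1 = Real.sin θ := by simp [unitVec]
@[simp] lemma tangentVec_zero (θ : ℝ) : tangentVec θ 0 = -Real.sin θ := by simp [tangentVec]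
@[simp] lemma tangentVec_one (θ : ℝ) : tangentVec θ 1 = Real.cos θ := by simp [tangentVec]

lemma plane_ext {x y : Plane} (h0 : x 0 = y 0) (h1 : x 1 = y 1) : x = y := by
  ext i; fin_cases i <;> simp [h0, h1]

@[simp] lemma dot_add (x y z : Plane) : dot x (y + z) = dot x y + dot x z := by
  simp [dot]; ring
@[simp] lemma dot_sub (x y z : Plane) : dot x (y - z) = dot x y - dot x z := by
  simp [dot]; ring
@[simp] lemma dot_neg (x y : Plane) : dot x (-y) = -dot x y := by simp [dot]; ring
@[simp] lemma dot_smul (x y : Plane) (c : ℝ) : dot x (c • y) = c * dot x y := by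
  simp [dot]; ring
@[simp] lemma neg_dot (x y : Plane) : dot (-x) y = -dot x y := by simp [dot]; ring
@[simp] lemma dot_zero (x : Plane) : dot x 0 = 0 := by simp [dot]
@[simp] lemma add_wedge (x y z : Plane) : wedge (x + y) z = wedge x z + wedge y z := by
  simp [wedge]; ring
@[simp] lemma sub_wedge (x y z : Plane) : wedge (x - y) z = wedge x z - wedge y z := by
  simp [wedge]; ring
@[simp] lemma neg_wedge (x y : Plane) : wedge (-x) y = -wedge x y := by simp [wedge]; ring
@[simp] lemma wedge_neg (x y : Plane) : wedge x (-y) = -wedge x y := by simp [wedge]; ring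
@[simp] lemma wedge_add (x y z : Plane) : wedge x (y + z) = wedge x y + wedge x z := by
  simp [wedge]; ring
@[simp] lemma smul_wedge (x y : Plane) (c : ℝ) : wedge (c • x) y = c * wedge x y := by
  simp [wedge]; ring
@[simp] lemma wedge_smul (x y : Plane) (c : ℝ) : wedge x (c • y) = c * wedge x y := by
  simp [wedge]; ring
@[simp] lemma wedge_self (x : Plane) : wedge x x = 0 := by simp [wedge]; ring

@[fun_prop] lemma continuous_unitVec : Continuous unitVec := by
  unfold unitVec; fun_prop
@[fun_prop] lemma continuous_tangentVec : Continuous tangentVec := by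
  unfold tangentVec; fun_prop
@[fun_prop] lemma Continuous.dot {X : Type*} [TopologicalSpace X] {f g : X → Plane}
    (hf : Continuous f) (hg : Continuous g) : Continuous fun x => dot (f x) (g x) := by
  unfold _root_.dot; fun_prop
@[fun_prop] lemma Continuous.wedge {X : Type*} [TopologicalSpace X] {f g : X → Plane}
    (hf : Continuous f) (hg : Continuous g) : Continuous fun x => wedge (f x) (g x) := by
  unfold _root_.wedge; fun_prop

lemma Filter.Tendsto.dot {X : Type*} {l : Filter X} {f g : X → Plane} {a b : Plane}
    (hf : Filter.Tendsto f l (𝓝 a)) (hg : Filter.Tendsto g l (𝓝 b)) :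
    Filter.Tendsto (fun x => dot (f x) (g x)) l (𝓝 (_root_.dot a b)) :=
  ((by fun_prop : Continuous fun p : Plane × Plane => _root_.dot p.1 p.2).tendsto (a, b)).comp
    (hf.prodMk_nhds hg)
lemma Filter.Tendsto.wedge {X : Type*} {l : Filter X} {f g : X → Plane} {a b : Plane}
    (hf : Filter.Tendsto f l (𝓝 a)) (hg : Filter.Tendsto g l (𝓝 b)) :
    Filter.Tendsto (fun x => wedge (f x) (g x)) l (𝓝 (_root_.wedge a b)) :=
  ((by fun_prop : Continuous fun p : Plane × Plane => _root_.wedge p.1 p.2).tendsto (a, b)).comp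
    (hf.prodMk_nhds hg)

lemma dot_unitVec_tangentVec (a b : ℝ) : dot (unitVec a) (tangentVec b) = Real.sin (a - b) := by
  simp [dot, Real.sin_sub]; ring
lemma dot_unitVec_unitVec (a b : ℝ) : dot (unitVec a) (unitVec b) = Real.cos (a - b) := by
  simp [dot, Real.cos_sub]
lemma dot_tangentVec_tangentVec (a b : ℝ) :
    dot (tangentVec a) (tangentVec b) = Real.cos (a - b) := by
  simp [dot, Real.cos_sub]; ring
lemma dot_tangentVec_unitVec (a b : ℝ) : dot (tangentVec a) (unitVec b) = Real.sin (b - a) := by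
  simp [dot, Real.sin_sub]; ring
lemma wedge_tangentVec (y : Plane) (θ : ℝ) : wedge y (tangentVec θ) = dot (unitVec θ) y := by
  simp [dot, wedge]; ring

lemma unitVec_add_pi (θ : ℝ) : unitVec (θ + Real.pi) = -unitVec θ := by
  apply plane_ext <;> simp
lemma tangentVec_add_pi (θ : ℝ) : tangentVec (θ + Real.pi) = -tangentVec θ := by
  apply plane_ext <;> simp
lemma unitVec_add_two_pi (θ : ℝ) : unitVec (θ + 2 * Real.pi) = unitVec θ := by
  apply plane_ext <;> simp
lemma frame_decomp (θ : ℝ) (y : Plane) :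
    y = dot (unitVec θ) y • unitVec θ + dot (tangentVec θ) y • tangentVec θ := by
  have h := Real.sin_sq_add_cos_sq θ
  apply plane_ext <;> simp [dot]
  · linear_combination (-(y 0)) * h
  · linear_combination (-(y 1)) * h

/-- For `ψ` between `a` and `b` less than π apart both coefficients are nonnegative, so inequalities
at two normals pass to the normals in between. -/
lemma dot_unitVec_combo (a b ψ : ℝ) (y : Plane) :
    Real.sin (b - a) * dot (unitVec ψ) y =
      Real.sin (b - ψ) * dot (unitVec a) y + Real.sin (ψ - a) * dot (unitVec b) y := by
  simp [dot, Real.sin_sub]; ring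

lemma sin_mul_wedge (a b : ℝ) (v y : Plane) :
    Real.sin (b - a) * wedge y v =
      dot (unitVec b) v * dot (unitVec a) y - dot (unitVec a) v * dot (unitVec b) y := by
  simp [dot, wedge, Real.sin_sub]; ring

lemma norm_sq_eq_dot (y : Plane) : ‖y‖ ^ 2 = dot y y := by
  rw [EuclideanSpace.real_norm_sq_eq]; simp [dot, sq]

lemma norm_unitVec (θ : ℝ) : ‖unitVec θ‖ = 1 := by
  have := norm_sq_eq_dot (unitVec θ)
  rw [dot_unitVec_unitVec] at this
  simp only [sub_self, Real.cos_zero] at this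
  nlinarith [norm_nonneg (unitVec θ)]
lemma norm_tangentVec (θ : ℝ) : ‖tangentVec θ‖ = 1 := by
  have := norm_sq_eq_dot (tangentVec θ)
  rw [dot_tangentVec_tangentVec] at this
  simp only [sub_self, Real.cos_zero] at this
  nlinarith [norm_nonneg (tangentVec θ)]

lemma tangentVec_ne_zero (θ : ℝ) : tangentVec θ ≠ 0 := by
  intro h; have := norm_tangentVec θ; simp [h] at this
lemma unitVec_ne_zero (θ : ℝ) : unitVec θ ≠ 0 := by
  intro h; have := norm_unitVec θ; simp [h] at this

lemma abs_dot_le (x y : Plane) : |dot x y| ≤ ‖x‖ * ‖y‖ := by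
  apply abs_le_of_sq_le_sq _ (by positivity)
  rw [mul_pow, norm_sq_eq_dot, norm_sq_eq_dot]; unfold dot
  nlinarith [sq_nonneg (x 0 * y 1 - x 1 * y 0)]

lemma dot_self_pos {y : Plane} (hy : y ≠ 0) : 0 < dot y y := by
  rw [← norm_sq_eq_dot]; positivity

lemma exists_polar (y : Plane) (θ₀ : ℝ) :
    ∃ θ ∈ Ico θ₀ (θ₀ + 2 * Real.pi), y = ‖y‖ • unitVec θ := by
  set z : ℂ := ⟨y 0, y 1⟩ with hz
  have hn : ‖z‖ = ‖y‖ := by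
    have h1 : ‖z‖ ^ 2 = ‖y‖ ^ 2 := by
      rw [norm_sq_eq_dot, ← Complex.normSq_eq_norm_sq, Complex.normSq_apply]; simp [dot, hz]
    have := abs_eq_abs.2 (sq_eq_sq_iff_eq_or_eq_neg.1 h1)
    simpa using this
  have hc := Complex.norm_mul_cos_arg z
  have hs := Complex.norm_mul_sin_arg z
  refine ⟨toIcoMod Real.two_pi_pos θ₀ z.arg, toIcoMod_mem_Ico _ _ _, ?_⟩
  have : toIcoMod Real.two_pi_pos θ₀ z.arg
      = z.arg - (toIcoDiv Real.two_pi_pos θ₀ z.arg : ℤ) * (2 * Real.pi) := by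
    rw [← zsmul_eq_mul]; rfl
  rw [this]
  apply plane_ext
  · simp only [PiLp.smul_apply, unitVec_zero, smul_eq_mul, Real.cos_sub_int_mul_two_pi, ← hn, hc]
    simp [hz]
  · simp only [PiLp.smul_apply, unitVec_one, smul_eq_mul, Real.sin_sub_int_mul_two_pi, ← hn, hs]
    simp [hz]

lemma exists_polar_tangent (y : Plane) : ∃ θ, y = ‖y‖ • tangentVec θ := by
  obtain ⟨θ, -, h⟩ := exists_polar y 0
  refine ⟨θ - Real.pi / 2, ?_⟩
  have : tangentVec (θ - Real.pi / 2) = unitVec θ := by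
    apply plane_ext <;> simp [Real.sin_sub, Real.cos_sub]
  rw [this]; exact h

lemma clm_eq_dot (f : Plane →L[ℝ] ℝ) : ∃ n : Plane, ∀ y, f y = dot n y := by
  refine ⟨!₂[f (EuclideanSpace.single 0 1), f (EuclideanSpace.single 1 1)], fun y => ?_⟩
  have : y = y 0 • EuclideanSpace.single (0 : Fin 2) (1 : ℝ)
      + y 1 • EuclideanSpace.single (1 : Fin 2) (1 : ℝ) := by
    apply plane_ext <;> simp
  conv_lhs => rw [this]
  simp [dot]; ring

/-- In a compact set a limit is identified by its cluster points. Continuity of maximizers is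
obtained this way: a limit along an ultrafilter is again a maximizer, and strict convexity makes the
maximizer unique. -/
lemma tendsto_of_ultrafilter_limit {X : Type*} {l : Filter X} {f : X → Plane} {s : Set Plane}
    {y : Plane} (hs : IsCompact s) (hf : ∀ᶠ x in l, f x ∈ s)
    (h : ∀ U : Ultrafilter X, ↑U ≤ l → ∀ y' ∈ s, Filter.Tendsto f U (𝓝 y') → y' = y) :
    Filter.Tendsto f l (𝓝 y) := by
  refine hs.tendsto_nhds_of_unique_mapClusterPt hf fun y' hy' hc => ?_
  obtain ⟨U, hU, hUt⟩ := mapClusterPt_iff_ultrafilter.1 hc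
  exact h U hU y' hy' hUt

/-! ### Strictly convex bodies and their support points. -/

/-- A compact strictly convex set with nonempty interior. -/
structure IsStrictBody (B : Set Plane) : Prop where
  isCompact : IsCompact B
  strictConvex : StrictConvex ℝ B
  nonempty_interior : (interior B).Nonempty

namespace IsStrictBody
variable {B : Set Plane}

lemma isClosed (hB : IsStrictBody B) : IsClosed B := hB.isCompact.isClosed
lemma convex (hB : IsStrictBody B) : Convex ℝ B := hB.strictConvex.convex
lemma nonempty (hB : IsStrictBody B) : B.Nonempty := hB.nonempty_interior.mono interior_subset

lemma neg (hB : IsStrictBody B) : IsStrictBody (-B) where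
  isCompact := hB.isCompact.neg
  strictConvex := hB.strictConvex.neg
  nonempty_interior := by
    obtain ⟨x, hx⟩ := hB.nonempty_interior
    have : -interior B ⊆ interior (-B) :=
      interior_maximal (Set.neg_subset_neg.2 interior_subset) isOpen_interior.neg
    exact ⟨-x, this (by simpa using hx)⟩

lemma closure_interior (hB : IsStrictBody B) : closure (interior B) = B := by
  rw [hB.convex.closure_interior_eq_closure_of_nonempty_interior hB.nonempty_interior,
    hB.isClosed.closure_eq]

lemma mem_frontier (hB : IsStrictBody B) {z : Plane} :
    z ∈ frontier B ↔ z ∈ B ∧ z ∉ interior B := by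
  rw [hB.isClosed.frontier_eq]; rfl

lemma midpoint_mem_interior (hB : IsStrictBody B) {x y : Plane} (hx : x ∈ B) (hy : y ∈ B)
    (hxy : x ≠ y) {s : ℝ} (h0 : 0 < s) (h1 : s < 1) : (1 - s) • x + s • y ∈ interior B :=
  hB.strictConvex hx hy hxy (by linarith) h0 (by ring)

end IsStrictBody

lemma eventually_add_smul_mem {s : Set Plane} (hs : IsOpen s) {z : Plane} (hz : z ∈ s)
    (n : Plane) : ∀ᶠ ε : ℝ in 𝓝[>] 0, z + ε • n ∈ s := by
  have : Filter.Tendsto (fun ε : ℝ => z + ε • n) (𝓝[>] 0) (𝓝 z) := by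
    have h : Continuous fun ε : ℝ => z + ε • n := by fun_prop
    have := (h.tendsto 0).mono_left (nhdsWithin_le_nhds (s := Ioi 0))
    simpa using this
  exact this (hs.mem_nhds hz)

lemma exists_dot_lt_of_mem_interior {B : Set Plane} {z n : Plane} (hz : z ∈ interior B)
    (hn : n ≠ 0) : ∃ w ∈ B, dot n z < dot n w := by
  obtain ⟨ε, hε, hε0⟩ := ((eventually_add_smul_mem isOpen_interior hz n).and
    self_mem_nhdsWithin).exists
  refine ⟨z + ε • n, interior_subset hε, ?_⟩
  have := dot_self_pos hn
  simp only [dot_add, dot_smul]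
  nlinarith [mul_pos (show (0:ℝ) < ε from hε0) this]

/-- The point of `B` with outer normal `unitVec θ`. -/
noncomputable def supportPt (B : Set Plane) (θ : ℝ) : Plane :=
  Classical.epsilon fun z => z ∈ B ∧ ∀ w ∈ B, dot (unitVec θ) w ≤ dot (unitVec θ) z

section support
variable {B : Set Plane} (hB : IsStrictBody B)
include hB

lemma supportPt_spec (θ : ℝ) :
    supportPt B θ ∈ B ∧ ∀ w ∈ B, dot (unitVec θ) w ≤ dot (unitVec θ) (supportPt B θ) := by
  apply Classical.epsilon_spec (p := fun z => z ∈ B ∧ ∀ w ∈ B, dot (unitVec θ) w ≤ dot (unitVec θ) z)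
  obtain ⟨z, hz, h⟩ := hB.isCompact.exists_isMaxOn hB.nonempty
    (f := fun w => dot (unitVec θ) w) (by fun_prop : Continuous _).continuousOn
  exact ⟨z, hz, fun w hw => h hw⟩

lemma supportPt_mem (θ : ℝ) : supportPt B θ ∈ B := (supportPt_spec hB θ).1
lemma dot_le_supportPt (θ : ℝ) {w : Plane} (hw : w ∈ B) :
    dot (unitVec θ) w ≤ dot (unitVec θ) (supportPt B θ) := (supportPt_spec hB θ).2 w hw

/-- The midpoint of two distinct maximizers would be interior, and an interior point can be pushed
further in direction `n`. -/
lemma eq_of_isMax_dot {n z z' : Plane} (hn : n ≠ 0) (hz : z ∈ B) (hz' : z' ∈ B)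
    (h : ∀ w ∈ B, dot n w ≤ dot n z) (h' : dot n z ≤ dot n z') : z = z' := by
  by_contra hne
  have hm := hB.midpoint_mem_interior hz hz' hne (s := 1 / 2) (by norm_num) (by norm_num)
  obtain ⟨w, hw, hlt⟩ := exists_dot_lt_of_mem_interior hm hn
  have := h w hw
  simp only [dot_add, dot_smul] at hlt
  linarith

lemma eq_supportPt {θ : ℝ} {z : Plane} (hz : z ∈ B)
    (h : dot (unitVec θ) (supportPt B θ) ≤ dot (unitVec θ) z) : z = supportPt B θ :=
  (eq_of_isMax_dot hB (unitVec_ne_zero θ) (supportPt_mem hB θ) hz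
    (fun _ hw => dot_le_supportPt hB θ hw) h).symm

lemma supportPt_mem_frontier (θ : ℝ) : supportPt B θ ∈ frontier B := by
  rw [hB.mem_frontier]
  refine ⟨supportPt_mem hB θ, fun h => ?_⟩
  obtain ⟨w, hw, hlt⟩ := exists_dot_lt_of_mem_interior h (unitVec_ne_zero θ)
  exact absurd (dot_le_supportPt hB θ hw) (not_le.2 hlt)

omit hB in
lemma supportPt_congr {a b : ℝ} (h : unitVec a = unitVec b) : supportPt B a = supportPt B b := by
  unfold supportPt; rw [h]

omit hB in
lemma supportPt_add_two_pi (θ : ℝ) : supportPt B (θ + 2 * Real.pi) = supportPt B θ :=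
  supportPt_congr (unitVec_add_two_pi θ)

lemma supportPt_neg (θ : ℝ) : supportPt (-B) θ = -supportPt B (θ + Real.pi) := by
  symm
  apply eq_supportPt hB.neg
  · simpa using supportPt_mem hB _
  · have := dot_le_supportPt hB (θ + Real.pi) (w := -supportPt (-B) θ)
      (by simpa using supportPt_mem hB.neg θ)
    rw [unitVec_add_pi] at this
    simpa using this

/-- Separating `z` from the interior gives a supporting functional, and its polar angle is the
direction sought. The starting angle of the window is left free for the callers. -/
lemma exists_eq_supportPt {z : Plane} (hz : z ∈ frontier B) (θ₀ : ℝ) :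
    ∃ θ ∈ Ico θ₀ (θ₀ + 2 * Real.pi), z = supportPt B θ := by
  obtain ⟨hzB, hzi⟩ := hB.mem_frontier.1 hz
  obtain ⟨f, hf⟩ := geometric_hahn_banach_open_point hB.convex.interior isOpen_interior hzi
  obtain ⟨n, hn⟩ := clm_eq_dot f
  have hle : ∀ w ∈ B, dot n w ≤ dot n z := by
    intro w hw
    rw [← hB.closure_interior] at hw
    have hcl : IsClosed {w | dot n w ≤ dot n z} :=
      isClosed_le (by fun_prop) continuous_const
    exact closure_minimal (fun a ha => by
      have := hf a ha; rw [hn, hn] at this; exact this.le) hcl hw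
  have hn0 : n ≠ 0 := by
    rintro rfl
    obtain ⟨a, ha⟩ := hB.nonempty_interior
    have := hf a ha
    rw [hn, hn] at this
    simp [dot] at this
  obtain ⟨θ, hθ, hnθ⟩ := exists_polar n θ₀
  refine ⟨θ, hθ, eq_supportPt hB hzB ?_⟩
  have := hle _ (supportPt_mem hB θ)
  rw [hnθ] at this
  have hpos : 0 < ‖n‖ := norm_pos_iff.2 hn0
  have e : ∀ y, dot (‖n‖ • unitVec θ) y = ‖n‖ * dot (unitVec θ) y := by
    intro y; simp [dot]; ring
  rw [e, e] at this
  exact le_of_mul_le_mul_left this hpos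

lemma continuous_supportPt : Continuous (supportPt B) := by
  rw [continuous_iff_continuousAt]
  intro θ
  refine tendsto_of_ultrafilter_limit hB.isCompact
    (Filter.Eventually.of_forall fun θ' => supportPt_mem hB θ') fun U hU y' hy' ht => ?_
  apply eq_supportPt hB hy'
  have h1 : Filter.Tendsto unitVec U (𝓝 (unitVec θ)) :=
    (continuous_unitVec.tendsto θ).mono_left hU
  exact le_of_tendsto_of_tendsto' (h1.dot tendsto_const_nhds) (h1.dot ht)
    fun θ' => dot_le_supportPt hB θ' (supportPt_mem hB θ)

lemma dot_secant_nonpos (a b : ℝ) :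
    dot (unitVec a) (supportPt B b - supportPt B a) ≤ 0 := by
  rw [dot_sub]; linarith [dot_le_supportPt hB a (supportPt_mem hB b)]

lemma dot_secant_nonneg (a b : ℝ) :
    0 ≤ dot (unitVec b) (supportPt B b - supportPt B a) := by
  rw [dot_sub]; linarith [dot_le_supportPt hB b (supportPt_mem hB a)]

/-- A mean value theorem: the component of the secant along `unitVec ψ` is nonpositive at `a` and
nonnegative at `b`, and where it vanishes the secant is tangential. -/
lemma exists_secant {a b : ℝ} (hab : a ≤ b) (hba : b < a + Real.pi) :
    ∃ δ : ℝ, 0 ≤ δ ∧ ∃ ψ ∈ Icc a b, supportPt B b - supportPt B a = δ • tangentVec ψ := by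
  set v := supportPt B b - supportPt B a with hv
  have ha : dot (unitVec a) v ≤ 0 := dot_secant_nonpos hB a b
  have hb : 0 ≤ dot (unitVec b) v := dot_secant_nonneg hB a b
  obtain ⟨ψ, hψ, h0⟩ := intermediate_value_Icc hab
    (f := fun ψ => dot (unitVec ψ) v) (by fun_prop : Continuous _).continuousOn ⟨ha, hb⟩
  have hdec : v = dot (tangentVec ψ) v • tangentVec ψ := by
    have := frame_decomp ψ v
    simp only at h0
    rw [h0] at this
    simpa using this
  refine ⟨dot (tangentVec ψ) v, ?_, ψ, hψ, hdec⟩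
  set δ := dot (tangentVec ψ) v
  rw [hdec, dot_smul, dot_unitVec_tangentVec] at ha hb
  rcases eq_or_lt_of_le hab with rfl | hab'
  · have : v = 0 := by simp [hv]
    simp [δ, this]
  · by_contra hneg
    push Not at hneg
    rcases eq_or_lt_of_le hψ.2 with h | h
    · have : Real.sin (a - ψ) < 0 := Real.sin_neg_of_neg_of_neg_pi_lt (by linarith) (by linarith)
      nlinarith
    · have : 0 < Real.sin (b - ψ) :=
        Real.sin_pos_of_pos_of_lt_pi (by linarith) (by linarith [hψ.1])
      nlinarith

end support

/-! ### Smooth bodies. -/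

/-- The body has a unique outer normal at every boundary point. -/
def IsSmoothBody (B : Set Plane) : Prop :=
  ∀ a b : ℝ, supportPt B a = supportPt B b → unitVec a = unitVec b

lemma IsSmoothBody.neg {B : Set Plane} (hB : IsStrictBody B) (hs : IsSmoothBody B) :
    IsSmoothBody (-B) := by
  intro a b h
  rw [supportPt_neg hB, supportPt_neg hB, neg_inj] at h
  have := hs _ _ h
  rwa [unitVec_add_pi, unitVec_add_pi, neg_inj] at this

lemma IsSmoothBody.supportPt_ne {B : Set Plane} (hs : IsSmoothBody B) {a b : ℝ} (hab : a < b)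
    (hba : b < a + 2 * Real.pi) : supportPt B a ≠ supportPt B b := by
  intro h
  have h1 := hs _ _ h
  have h2 := dot_unitVec_unitVec b a
  rw [h1, dot_unitVec_unitVec, sub_self, Real.cos_zero] at h2
  have := (Real.cos_eq_one_iff_of_lt_of_lt (by linarith [Real.pi_pos]) (by linarith)).1 h2.symm
  linarith

/-- The complementary boundary arc is compact and, by smoothness, misses `supportPt B θ₀`; hence a
neighbourhood of that point misses it too. -/
lemma eventually_exists_supportPt_near {B : Set Plane} (hB : IsStrictBody B)
    (hs : IsSmoothBody B) (θ₀ : ℝ) {ε : ℝ} (hε : 0 < ε) :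
    ∀ᶠ z in 𝓝 (supportPt B θ₀), z ∈ frontier B → ∃ θ, |θ - θ₀| < ε ∧ z = supportPt B θ := by
  wlog hεπ : ε ≤ Real.pi generalizing ε
  · filter_upwards [this Real.pi_pos le_rfl] with z hz hzf
    obtain ⟨θ, h1, h2⟩ := hz hzf
    exact ⟨θ, by linarith, h2⟩
  set C := supportPt B '' Icc (θ₀ + ε) (θ₀ + 2 * Real.pi - ε)
  have hC : IsCompact C := isCompact_Icc.image (continuous_supportPt hB)
  have h0 : supportPt B θ₀ ∈ Cᶜ := by
    rintro ⟨θ, hθ, h⟩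
    exact hs.supportPt_ne (a := θ₀) (b := θ) (by linarith [hθ.1]) (by linarith [hθ.2]) h.symm
  filter_upwards [hC.isClosed.isOpen_compl.mem_nhds h0] with z hzC hz
  obtain ⟨θ, hθ, rfl⟩ := exists_eq_supportPt hB hz (θ₀ - ε)
  refine ⟨θ, ?_, rfl⟩
  rw [abs_lt]
  constructor
  · rcases eq_or_lt_of_le hθ.1 with h | h
    -- The closed end `θ₀ - ε` of the half-open window belongs, after a full turn, to the excluded
    -- arc.
    · exact absurd ⟨θ + 2 * Real.pi, ⟨by linarith, by linarith⟩, supportPt_add_two_pi θ⟩ hzC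
    · linarith
  · by_contra hle
    exact hzC ⟨θ, ⟨by linarith, by linarith [hθ.2]⟩, rfl⟩

/-! ### Extremal chords, the chord gap and its involution. -/

/-- `z` is the end point of the chord `[z - v, z]` of `B` which is extremal, among all chords
that are translates of `v`, in the direction obtained by rotating `v` clockwise. -/
def IsChordTop (B : Set Plane) (v z : Plane) : Prop :=
  z ∈ B ∧ z - v ∈ B ∧ ∀ w ∈ B, w - v ∈ B → wedge w v ≤ wedge z v

/-- The end point of the extremal chord of `B` with direction vector `v`. -/
noncomputable def chordTop (B : Set Plane) (v : Plane) : Plane :=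
  Classical.epsilon (IsChordTop B v)

/-- For a body `B`, the difference of the end points of the two chords of `B` which are
translates of `v`. -/
noncomputable def chordGap (B : Set Plane) (v : Plane) : Plane :=
  chordTop B v + chordTop (-B) v - v

lemma chordGap_neg_body (B : Set Plane) (v : Plane) : chordGap (-B) v = chordGap B v := by
  simp only [chordGap, neg_neg]; abel

lemma neg_sub_neg_body (B : Set Plane) : (-B) - (-B) = B - B := by
  ext v; constructor
  · rintro ⟨x, hx, y, hy, rfl⟩; exact ⟨-y, hy, -x, hx, by simp; abel⟩
  · rintro ⟨x, hx, y, hy, rfl⟩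
    exact ⟨-y, by simpa using hy, -x, by simpa using hx, by simp; abel⟩

lemma neg_mem_sub_self {B : Set Plane} {v : Plane} (hv : v ∈ B - B) : -v ∈ B - B := by
  obtain ⟨x, hx, y, hy, rfl⟩ := hv; exact ⟨y, hy, x, hx, by simp⟩

lemma neg_mem_interior_sub_self {B : Set Plane} {v : Plane} (hv : v ∈ interior (B - B)) :
    -v ∈ interior (B - B) := by
  have h : -interior (B - B) ⊆ interior (B - B) :=
    interior_maximal (fun x hx => by
      simpa using neg_mem_sub_self (interior_subset (show -x ∈ interior (B - B) from hx)))
      isOpen_interior.neg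
  exact h (by simpa using hv)

lemma sub_mem_interior_sub_self {B : Set Plane} {x y : Plane} (hx : x ∈ interior B)
    (hy : y ∈ B) : x - y ∈ interior (B - B) := by
  have h : (fun z => z - y) '' interior B ⊆ B - B := by
    rintro _ ⟨z, hz, rfl⟩; exact ⟨z, interior_subset hz, y, hy, rfl⟩
  exact interior_maximal h ((Homeomorph.subRight y).isOpenMap _ isOpen_interior) ⟨x, hx, rfl⟩

lemma wedge_ne_zero_aux {v : Plane} (hv : v ≠ 0) :
    ∃ n : Plane, n ≠ 0 ∧ ∀ w, wedge w v = dot n w := by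
  refine ⟨!₂[v 1, -v 0], fun h => hv ?_, fun w => by simp [wedge, dot]; ring⟩
  have h0 := congrArg (fun z : Plane => z 0) h
  have h1 := congrArg (fun z : Plane => z 1) h
  simp at h0 h1
  exact plane_ext (by simpa using h1) (by simpa using h0)

section chord
variable {B : Set Plane} (hB : IsStrictBody B)
include hB

lemma zero_mem_interior_sub_self : (0 : Plane) ∈ interior (B - B) := by
  obtain ⟨x, hx⟩ := hB.nonempty_interior
  simpa using sub_mem_interior_sub_self hx (interior_subset hx)

omit hB in
-- A slightly stretched vector `(1 + ε) • v` is still a difference `y - y'`. Contracting that chord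
-- towards an interior point by the factor `1 / (1 + ε)` restores `v` and makes both ends interior.
lemma exists_interior_chord_of_convex (hBc : Convex ℝ B) (hBi : (interior B).Nonempty) {v : Plane} (hv : v ∈ interior (B - B)) :
    ∃ w ∈ interior B, w - v ∈ interior B := by
  obtain ⟨o, ho⟩ := hBi
  obtain ⟨ε, hε, hε0⟩ := ((eventually_add_smul_mem isOpen_interior hv v).and
    self_mem_nhdsWithin).exists
  have hε0 : 0 < ε := hε0
  obtain ⟨y, hy, y', hy', h⟩ := interior_subset hε
  have h1 : 0 < 1 + ε := by linarith
  have key : ∀ x ∈ B, (1 / (1 + ε)) • x + (ε / (1 + ε)) • o ∈ interior B := fun x hx =>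
    hBc.combo_self_interior_mem_interior hx ho (by positivity) (by positivity)
      (by field_simp)
  refine ⟨_, key y hy, ?_⟩
  have hv' : v = (1 / (1 + ε)) • (y - y') := by
    have : y - y' = v + ε • v := h
    rw [this, show v + ε • v = (1 + ε) • v by module, smul_smul, one_div_mul_cancel h1.ne',
      one_smul]
  have : (1 / (1 + ε)) • y + (ε / (1 + ε)) • o - v
      = (1 / (1 + ε)) • y' + (ε / (1 + ε)) • o := by
    rw [hv', smul_sub]; abel
  rw [this]
  exact key y' hy'

lemma exists_interior_chord {v : Plane} (hv : v ∈ interior (B - B)) :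
    ∃ w ∈ interior B, w - v ∈ interior B :=
  exists_interior_chord_of_convex hB.convex hB.nonempty_interior hv

lemma exists_isChordTop {v : Plane} (hv : v ∈ B - B) : ∃ z, IsChordTop B v z := by
  obtain ⟨x, hx, y, hy, rfl⟩ := hv
  have hc : IsCompact (B ∩ (fun w => w - (x - y)) ⁻¹' B) :=
    hB.isCompact.inter_right (hB.isClosed.preimage (by fun_prop))
  obtain ⟨z, hz, h⟩ := hc.exists_isMaxOn ⟨x, hx, by simpa using hy⟩
    (f := fun w => wedge w (x - y)) (by fun_prop : Continuous _).continuousOn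
  exact ⟨z, hz.1, hz.2, fun w hw hw' => h ⟨hw, hw'⟩⟩

lemma chordTop_spec {v : Plane} (hv : v ∈ B - B) : IsChordTop B v (chordTop B v) :=
  Classical.epsilon_spec (exists_isChordTop hB hv)

/-- The end not assumed interior moves a little towards a point `w` of larger height and stays in
`B` by convexity; the interior end tolerates the same small shift. -/
lemma exists_wedge_lt_of_interior {v z : Plane} (hv : v ≠ 0) (hz : z ∈ B) (hz' : z - v ∈ B)
    (h : z ∈ interior B ∨ z - v ∈ interior B) :
    ∃ w ∈ B, w - v ∈ B ∧ wedge z v < wedge w v := by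
  obtain ⟨n, hn, hw⟩ := wedge_ne_zero_aux hv
  simp only [hw]
  have aux : ∀ p q : Plane, p ∈ interior B → q ∈ B → dot n p = dot n q → ∃ w, w ∈ B ∧
      ∃ ε : ℝ, 0 < ε ∧ q + ε • (w - q) ∈ B ∧ p + ε • (w - q) ∈ B ∧ dot n q < dot n w := by
    intro p q hp hq hpq
    obtain ⟨w, hwB, hlt⟩ := exists_dot_lt_of_mem_interior hp hn
    have e1 := eventually_add_smul_mem isOpen_interior hp (w - q)
    have e2 : ∀ᶠ ε : ℝ in 𝓝[>] 0, ε < 1 := nhdsWithin_le_nhds (eventually_lt_nhds zero_lt_one)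
    obtain ⟨ε, ⟨h1, h2⟩, h3⟩ := ((e1.and e2).and self_mem_nhdsWithin).exists
    have h3 : 0 < ε := h3
    refine ⟨w, hwB, ε, h3, ?_, interior_subset h1, hpq ▸ hlt⟩
    have := hB.convex hq hwB (show 0 ≤ 1 - ε by linarith) h3.le (by ring)
    convert this using 1
    module
  have e : dot n (z - v) = dot n z := by
    rw [← hw, ← hw]; simp
  rcases h with h | h
  · obtain ⟨w, hwB, ε, hε, h1, h2, h3⟩ := aux z (z - v) h hz' e.symm
    refine ⟨z + ε • (w - (z - v)), h2, ?_, ?_⟩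
    · convert h1 using 1; abel
    · rw [dot_add, dot_smul, dot_sub]; nlinarith
  · obtain ⟨w, hwB, ε, hε, h1, h2, h3⟩ := aux (z - v) z h hz e
    refine ⟨z + ε • (w - z), h1, ?_, ?_⟩
    · convert h2 using 1; abel
    · rw [dot_add, dot_smul, dot_sub]; nlinarith

lemma IsChordTop.mem_frontier {v z : Plane} (h : IsChordTop B v z) (hv : v ≠ 0) :
    z ∈ frontier B ∧ z - v ∈ frontier B := by
  simp only [hB.mem_frontier]
  refine ⟨⟨h.1, fun hi => ?_⟩, h.2.1, fun hi => ?_⟩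
  · obtain ⟨w, h1, h2, h3⟩ := exists_wedge_lt_of_interior hB hv h.1 h.2.1 (.inl hi)
    exact absurd (h.2.2 w h1 h2) (not_le.2 h3)
  · obtain ⟨w, h1, h2, h3⟩ := exists_wedge_lt_of_interior hB hv h.1 h.2.1 (.inr hi)
    exact absurd (h.2.2 w h1 h2) (not_le.2 h3)

/-- The average of two distinct extremal chords has interior ends by strict convexity, so it is not
extremal. -/
lemma IsChordTop.unique {v z z' : Plane} (h : IsChordTop B v z) (h' : IsChordTop B v z')
    (hv : v ≠ 0) : z = z' := by
  by_contra hne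
  have e : wedge z v = wedge z' v :=
    le_antisymm (h'.2.2 z h.1 h.2.1) (h.2.2 z' h'.1 h'.2.1)
  have hm := hB.midpoint_mem_interior h.1 h'.1 hne (s := 1 / 2) (by norm_num) (by norm_num)
  have hm' := hB.midpoint_mem_interior h.2.1 h'.2.1 (by simpa using hne) (s := 1 / 2)
    (by norm_num) (by norm_num)
  have eq : (1 - 1 / 2 : ℝ) • (z - v) + (1 / 2 : ℝ) • (z' - v)
      = (1 - 1 / 2 : ℝ) • z + (1 / 2 : ℝ) • z' - v := by module
  rw [eq] at hm'
  obtain ⟨w, h1, h2, h3⟩ := exists_wedge_lt_of_interior hB hv (interior_subset hm)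
    (interior_subset hm') (.inl hm)
  have := h.2.2 w h1 h2
  simp only [add_wedge, smul_wedge] at h3
  linarith

lemma IsChordTop.eq_chordTop {v z : Plane} (h : IsChordTop B v z) (hv : v ≠ 0) :
    chordTop B v = z :=
  (chordTop_spec hB ⟨z, h.1, z - v, h.2.1, by simp⟩).unique hB h hv

/-- Any parallel chord of the same length lies below the support lines at both ends of this one.
`sin_mul_wedge` writes the wedge product as a combination of these two heights, with nonnegative
coefficients by the sign of the secant along the two normals. -/
lemma isChordTop_supportPt {a b : ℝ} (hab : a < b) (hba : b < a + Real.pi) :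
    IsChordTop B (supportPt B b - supportPt B a) (supportPt B b) := by
  refine ⟨supportPt_mem hB b, by simpa using supportPt_mem hB a, fun w hw hw' => ?_⟩
  have hs : 0 < Real.sin (b - a) := Real.sin_pos_of_pos_of_lt_pi (by linarith) (by linarith)
  set v := supportPt B b - supportPt B a with hv
  have h1 := sin_mul_wedge a b v (w - supportPt B b)
  have h2 : dot (unitVec a) (w - supportPt B b) ≤ 0 := by
    have := dot_le_supportPt hB a hw'
    rw [hv] at this; simp only [dot_sub] at this ⊢; linarith
  have h3 : dot (unitVec b) (w - supportPt B b) ≤ 0 := by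
    have := dot_le_supportPt hB b hw
    rw [dot_sub]; linarith
  have h4 : dot (unitVec a) v ≤ 0 := dot_secant_nonpos hB a b
  have h5 : 0 ≤ dot (unitVec b) v := dot_secant_nonneg hB a b
  have : Real.sin (b - a) * wedge (w - supportPt B b) v ≤ 0 := by
    rw [h1]; nlinarith [mul_nonneg h5 (neg_nonneg.2 h2), mul_nonneg (neg_nonneg.2 h4) (neg_nonneg.2 h3)]
  rw [sub_wedge] at this
  nlinarith

lemma chordTop_supportPt {a b : ℝ} (hab : a < b) (hba : b < a + Real.pi)
    (hne : supportPt B b ≠ supportPt B a) :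
    chordTop B (supportPt B b - supportPt B a) = supportPt B b :=
  (isChordTop_supportPt hB hab hba).eq_chordTop hB (sub_ne_zero.2 hne)

/-- Limits of extremal chords are extremal. -/
lemma le_wedge_of_interior_le {v z : Plane} {c : ℝ} {n : Plane}
    (hv : v ∈ interior (B - B))
    (h : ∀ w ∈ interior B, w - v ∈ interior B → dot n w ≤ c) (hz : z ∈ B) (hz' : z - v ∈ B) :
    dot n z ≤ c := by
  obtain ⟨o, ho, ho'⟩ := exists_interior_chord hB hv
  have key : ∀ᶠ ε : ℝ in 𝓝[>] 0, dot n ((1 - ε) • z + ε • o) ≤ c := by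
    have e2 : ∀ᶠ ε : ℝ in 𝓝[>] 0, ε < 1 := nhdsWithin_le_nhds (eventually_lt_nhds zero_lt_one)
    filter_upwards [self_mem_nhdsWithin, e2] with ε hε hε1
    have hε : 0 < ε := hε
    refine h _ (hB.convex.combo_self_interior_mem_interior hz ho (by linarith) hε (by ring)) ?_
    have := hB.convex.combo_self_interior_mem_interior hz' ho' (show 0 ≤ 1 - ε by linarith) hε
      (by ring)
    convert this using 1
    module
  have hc : Filter.Tendsto (fun ε : ℝ => dot n ((1 - ε) • z + ε • o)) (𝓝[>] 0) (𝓝 (dot n z)) := by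
    have h : Continuous fun ε : ℝ => dot n ((1 - ε) • z + ε • o) := by fun_prop
    simpa using (h.tendsto 0).mono_left (nhdsWithin_le_nhds (s := Ioi 0))
  exact le_of_tendsto hc key

/-- A chord with interior ends survives a small change of `v`, so a limit of extremal chords
dominates it. `le_wedge_of_interior_le` extends the bound to all chords. -/
lemma tendsto_chordTop {v : Plane} (hv0 : v ≠ 0) (hv : v ∈ interior (B - B)) :
    Filter.Tendsto (chordTop B) (𝓝 v) (𝓝 (chordTop B v)) := by
  have hD : ∀ᶠ v' in 𝓝 v, v' ∈ B - B :=
    Filter.mem_of_superset (isOpen_interior.mem_nhds hv) interior_subset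
  refine tendsto_of_ultrafilter_limit hB.isCompact
    (hD.mono fun v' h => (chordTop_spec hB h).1) fun U hU y hy ht => ?_
  have hid : Filter.Tendsto (fun v' : Plane => v') U (𝓝 v) := hU
  refine (IsChordTop.eq_chordTop hB ⟨hy, ?_, ?_⟩ hv0).symm
  · exact hB.isClosed.mem_of_tendsto (ht.sub hid)
      (hU (hD.mono fun v' h => (chordTop_spec hB h).2.1))
  · obtain ⟨n, hn, hw⟩ := wedge_ne_zero_aux hv0
    intro w hw1 hw2
    rw [hw w]
    refine le_wedge_of_interior_le hB hv (fun w' h1 h2 => ?_) hw1 hw2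
    rw [← hw w']
    have e : ∀ᶠ v' in (U : Filter Plane), w' - v' ∈ interior B :=
      (tendsto_const_nhds.sub hid) (isOpen_interior.mem_nhds h2)
    refine le_of_tendsto_of_tendsto (Filter.Tendsto.wedge tendsto_const_nhds hid)
      (ht.wedge hid) ?_
    filter_upwards [e, hU hD] with v' h3 h4
    exact (chordTop_spec hB h4).2.2 w' (interior_subset h1) (interior_subset h3)

omit hB in
lemma tendsto_smul_tangentVec (θ : ℝ) :
    Filter.Tendsto (fun x : ℝ × ℝ => x.1 • tangentVec x.2) (𝓝[>] 0 ×ˢ 𝓝 θ) (𝓝 0) := by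
  have h : Continuous fun x : ℝ × ℝ => x.1 • tangentVec x.2 := by fun_prop
  have := (h.tendsto (0, θ)).mono_left
    (show 𝓝[>] 0 ×ˢ 𝓝 θ ≤ 𝓝 ((0 : ℝ), θ) by
      rw [nhds_prod_eq]; exact Filter.prod_mono nhdsWithin_le_nhds le_rfl)
  simpa using this

/-- Wedging with `tangentVec` measures the height along the normal (`wedge_tangentVec`), so the
limit of shrinking extremal chords maximizes this height. -/
lemma tendsto_chordTop_zero (θ : ℝ) :
    Filter.Tendsto (fun x : ℝ × ℝ => chordTop B (x.1 • tangentVec x.2)) (𝓝[>] 0 ×ˢ 𝓝 θ)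
      (𝓝 (supportPt B θ)) := by
  have h0 := tendsto_smul_tangentVec θ
  have hD : ∀ᶠ x : ℝ × ℝ in 𝓝[>] 0 ×ˢ 𝓝 θ, x.1 • tangentVec x.2 ∈ B - B :=
    (h0.eventually (isOpen_interior.mem_nhds (zero_mem_interior_sub_self hB))).mono
      fun x hx => interior_subset hx
  have hpos : ∀ᶠ x : ℝ × ℝ in 𝓝[>] 0 ×ˢ 𝓝 θ, 0 < x.1 :=
    Filter.Eventually.prod_inl (p := fun x : ℝ => 0 < x) self_mem_nhdsWithin _
  refine tendsto_of_ultrafilter_limit hB.isCompact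
    (hD.mono fun v' h => (chordTop_spec hB h).1) fun U hU y hy ht => ?_
  apply eq_supportPt hB hy
  refine le_wedge_of_interior_le hB (zero_mem_interior_sub_self hB) (fun w h1 h2 => ?_)
    (supportPt_mem hB θ) (by simpa using supportPt_mem hB θ)
  have hid : Filter.Tendsto (fun x : ℝ × ℝ => x.1 • tangentVec x.2) U (𝓝 0) := h0.mono_left hU
  have e : ∀ᶠ x in (U : Filter (ℝ × ℝ)), w - x.1 • tangentVec x.2 ∈ interior B :=
    (tendsto_const_nhds.sub hid) (isOpen_interior.mem_nhds h2)
  have hu : Filter.Tendsto (fun x : ℝ × ℝ => unitVec x.2) U (𝓝 (unitVec θ)) :=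
    ((continuous_unitVec.tendsto θ).comp Filter.tendsto_snd).mono_left hU
  refine le_of_tendsto_of_tendsto (hu.dot tendsto_const_nhds) (hu.dot ht) ?_
  filter_upwards [e, hU hD, hU hpos] with x h3 h4 h5
  have := (chordTop_spec hB h4).2.2 w (interior_subset h1) (interior_subset h3)
  simp only [wedge_smul, wedge_tangentVec] at this
  exact le_of_mul_le_mul_left this h5

/-- The chord of a strictly convex body cannot have parallel chords of the same length on both
sides, if its end points are on the boundary. -/
lemma not_wedge_between {v y w w' : Plane} (hy : y ∈ frontier B)
    (hy' : y - v ∈ frontier B) (hw : w ∈ B) (hwv : w - v ∈ B) (hw' : w' ∈ B)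
    (hwv' : w' - v ∈ B) (h1 : wedge w' v < wedge y v) (h2 : wedge y v < wedge w v) : False := by
  rw [hB.mem_frontier] at hy hy'
  have hv : v ≠ 0 := by rintro rfl; simp [wedge] at h1
  have hne : w ≠ w' := by rintro rfl; linarith
  -- The weight for which the average of the two outer chords lies on the line of the chord `[y - v,
  -- y]`. The averaged chord has interior ends.
  set s := (wedge w v - wedge y v) / (wedge w v - wedge w' v) with hs
  have hs0 : 0 < s := div_pos (by linarith) (by linarith)
  have hs1 : s < 1 := (div_lt_one (by linarith)).2 (by linarith)
  have hm := hB.midpoint_mem_interior hw hw' hne hs0 hs1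
  have hm' := hB.midpoint_mem_interior hwv hwv' (by simpa using hne) hs0 hs1
  set m := (1 - s) • w + s • w' with hmdef
  have em : (1 - s) • (w - v) + s • (w' - v) = m - v := by rw [hmdef]; module
  rw [em] at hm'
  have hwm : wedge (m - y) v = 0 := by
    have : s * (wedge w v - wedge w' v) = wedge w v - wedge y v :=
      div_mul_cancel₀ _ (by linarith)
    rw [hmdef, sub_wedge, add_wedge, smul_wedge, smul_wedge]; linarith
  obtain ⟨τ, hτ⟩ : ∃ τ : ℝ, m = y + τ • v := by
    refine ⟨dot v (m - y) / dot v v, ?_⟩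
    have hp := dot_self_pos hv
    have : m - y = (dot v (m - y) / dot v v) • v := by
      set x := m - y
      simp only [wedge] at hwm
      apply plane_ext <;> simp only [PiLp.smul_apply, smul_eq_mul] <;>
        rw [div_mul_eq_mul_div, eq_div_iff hp.ne'] <;> simp only [dot]
      · linear_combination v 1 * hwm
      · linear_combination (-v 0) * hwm
    rw [← this]; abel
  -- Of two chords of equal length on one line, the one with interior ends forces an end of the
  -- other to lie between an interior point and a point of `B`, or to coincide with an interior
  -- point.
  rcases lt_trichotomy τ 0 with h | h | h
  · apply hy'.2
    have := hB.convex.combo_self_interior_mem_interior hy.1 hm' (a := -τ / (1 - τ))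
      (b := 1 / (1 - τ)) (div_nonneg (by linarith) (by linarith))
      (div_pos one_pos (by linarith)) (by rw [← add_div]; exact (div_eq_one_iff_eq (by linarith)).2 (by ring))
    convert this using 1
    rw [hτ]
    have : (1 - τ) ≠ 0 := by linarith
    apply plane_ext <;> simp <;> field_simp <;> ring
  · apply hy.2
    rw [h] at hτ; simpa [hτ] using hm
  · apply hy.2
    have := hB.convex.combo_self_interior_mem_interior hy'.1 hm (a := τ / (1 + τ))
      (b := 1 / (1 + τ)) (div_nonneg (by linarith) (by linarith))
      (div_pos one_pos (by linarith)) (by rw [← add_div]; exact (div_eq_one_iff_eq (by linarith)).2 (by ring))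
    convert this using 1
    rw [hτ]
    have : (1 + τ) ≠ 0 := by linarith
    apply plane_ext <;> simp <;> field_simp <;> ring

/-- The other chord with direction vector `v`. -/
lemma chordTop_neg_body_spec {v : Plane} (hv : v ∈ B - B) :
    v - chordTop (-B) v ∈ B ∧ v - chordTop (-B) v - v ∈ B ∧
      ∀ w ∈ B, w - v ∈ B → wedge (v - chordTop (-B) v) v ≤ wedge w v := by
  obtain ⟨h1, h2, h3⟩ := chordTop_spec hB.neg (v := v) (by rwa [neg_sub_neg_body])
  refine ⟨by simpa using h2, by simpa using h1, fun w hw hw' => ?_⟩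
  have := h3 (v - w) (by simpa using hw') (by simpa using hw)
  simp only [sub_wedge, wedge_self] at this ⊢
  linarith

lemma wedge_chordGap_pos {v : Plane} (hv0 : v ≠ 0) (hv : v ∈ interior (B - B)) :
    0 < wedge (chordGap B v) v := by
  obtain ⟨w, h1, h2⟩ := exists_interior_chord hB hv
  obtain ⟨w', h3, h4, h5⟩ := exists_wedge_lt_of_interior hB hv0 (interior_subset h1)
    (interior_subset h2) (.inl h1)
  have h6 := (chordTop_spec hB (interior_subset hv)).2.2 w' h3 h4
  have h7 := (chordTop_neg_body_spec hB (interior_subset hv)).2.2 w (interior_subset h1)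
    (interior_subset h2)
  have : chordGap B v = chordTop B v - (v - chordTop (-B) v) := by rw [chordGap]; abel
  rw [this, sub_wedge]; linarith

lemma chordTop_neg {v : Plane} (hv0 : v ≠ 0) (hv : v ∈ B - B) :
    chordTop B (-v) = -chordTop (-B) v := by
  obtain ⟨h1, h2, h3⟩ := chordTop_neg_body_spec hB hv
  refine IsChordTop.eq_chordTop hB ⟨by simpa using h2, by convert h1 using 1; abel,
    fun w hw hw' => ?_⟩ (neg_ne_zero.2 hv0)
  have := h3 (w + v) (by simpa using hw') (by simpa using hw)
  simp only [sub_wedge, wedge_self, add_wedge, neg_wedge, wedge_neg] at this ⊢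
  linarith

lemma chordGap_neg {v : Plane} (hv0 : v ≠ 0) (hv : v ∈ B - B) :
    chordGap B (-v) = -chordGap B v := by
  have h2 := chordTop_neg hB.neg hv0 (by rwa [neg_sub_neg_body])
  rw [neg_neg] at h2
  rw [chordGap, chordGap, chordTop_neg hB hv0 hv, h2]; abel

/-- The points `z`, `z'`, `z' - x`, `z - x` are the vertices of an inscribed parallelogram with
sides `x` and `z - z'`. The side from `z' - x` to `z - x` has the parallel chord `[z', z]` on one
side, so by `not_wedge_between` there is none beyond it on the other. -/
lemma chordTop_chordGap {x : Plane} (hx0 : x ≠ 0) (hx : x ∈ interior (B - B)) :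
    chordTop B (chordGap B x) = chordTop B x - x := by
  have h1 := chordTop_spec hB (interior_subset hx)
  have h2 := chordTop_neg_body_spec hB (interior_subset hx)
  have hpos := wedge_chordGap_pos hB hx0 hx
  have f1 := h1.mem_frontier hB hx0
  have f2 := (chordTop_spec hB.neg (v := x)
    (by rw [neg_sub_neg_body]; exact interior_subset hx)).mem_frontier hB.neg hx0
  set z := chordTop B x
  set z' := x - chordTop (-B) x with hz'
  have hv : chordGap B x = z - z' := by rw [chordGap, hz']; abel
  have hv0 : chordGap B x ≠ 0 := by intro h; rw [h] at hpos; simp [wedge] at hpos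
  set v := chordGap B x
  have e0 : z - x - v = z' - x := by rw [hv]; abel
  have e1 : z - v = z' := by rw [hv]; abel
  refine IsChordTop.eq_chordTop hB ⟨h1.2.1, by rw [e0]; exact h2.2.1, fun w hw hw' => ?_⟩ hv0
  by_contra hlt
  push Not at hlt
  have hfr : z' - x ∈ frontier B := by
    have : z' - x = -chordTop (-B) x := by rw [hz']; abel
    rw [this]
    have := f2.1
    rw [hB.neg.mem_frontier] at this
    rw [hB.mem_frontier]
    refine ⟨this.1, fun hi => this.2 ?_⟩
    have hsub : -interior B ⊆ interior (-B) :=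
      interior_maximal (Set.neg_subset_neg.2 interior_subset) isOpen_interior.neg
    exact hsub hi
  refine not_wedge_between hB f1.2 (by rw [e0]; exact hfr) hw hw' h1.1
    (by rw [e1]; exact h2.1) ?_ hlt
  have : wedge x v = -wedge v x := by simp [wedge]; ring
  rw [sub_wedge]; linarith

/-- The gap of the gap is the remaining side of the same parallelogram, with its orientation
reversed. -/
lemma chordGap_chordGap {x : Plane} (hx0 : x ≠ 0) (hx : x ∈ interior (B - B)) :
    chordGap B (chordGap B x) = -x := by
  have h1 := chordTop_chordGap hB hx0 hx
  have h2 := chordTop_chordGap hB.neg hx0 (by rwa [neg_sub_neg_body])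
  rw [chordGap_neg_body] at h2
  rw [chordGap.eq_1 B (chordGap B x), h1, h2, chordGap]; abel

lemma chordGap_ne_zero {x : Plane} (hx0 : x ≠ 0) (hx : x ∈ interior (B - B)) :
    chordGap B x ≠ 0 := by
  intro h
  have := wedge_chordGap_pos hB hx0 hx
  simp [h, wedge] at this

/-- Averaging two distinct chords with the same vector gives a chord with an interior end, which
leaves room to vary the vector. -/
lemma sub_mem_interior_of_two {x y x' y' : Plane} (hx : x ∈ B) (hy : y ∈ B) (hx' : x' ∈ B)
    (hy' : y' ∈ B) (h : x - y = x' - y') (hne : x ≠ x') : x - y ∈ interior (B - B) := by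
  have h1 := hB.midpoint_mem_interior hx hx' hne (s := 1 / 2) (by norm_num) (by norm_num)
  have h2 := hB.convex hy hy' (a := 1 - 1 / 2) (b := 1 / 2) (by norm_num) (by norm_num)
    (by norm_num)
  have := sub_mem_interior_sub_self h1 h2
  convert this using 1
  have : x - y = (1 - 1 / 2 : ℝ) • (x - y) + (1 / 2 : ℝ) • (x' - y') := by
    rw [← h]; module
  rw [this]; module

lemma chordGap_mem_interior {x : Plane} (hx0 : x ≠ 0) (hx : x ∈ interior (B - B)) :
    chordGap B x ∈ interior (B - B) := by
  have h1 := chordTop_spec hB (interior_subset hx)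
  have h2 := chordTop_neg_body_spec hB (interior_subset hx)
  have := sub_mem_interior_of_two hB h1.1 h2.1 h1.2.1 h2.2.1 (by abel)
    (fun h => hx0 (by simpa using (congrArg (fun z => chordTop B x - z) h).symm))
  convert this using 1
  rw [chordGap]; abel

lemma tendsto_chordGap {v : Plane} (hv0 : v ≠ 0) (hv : v ∈ interior (B - B)) :
    Filter.Tendsto (chordGap B) (𝓝 v) (𝓝 (chordGap B v)) :=
  ((tendsto_chordTop hB hv0 hv).add
    (tendsto_chordTop hB.neg hv0 (by rwa [neg_sub_neg_body]))).sub Filter.tendsto_id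

/-- The limit lies on the boundary of the difference body (`supportPt_add_mem_frontier`). Data near
that boundary therefore translate into data about short vectors. -/
lemma tendsto_chordGap_zero (θ : ℝ) :
    Filter.Tendsto (fun x : ℝ × ℝ => chordGap B (x.1 • tangentVec x.2)) (𝓝[>] 0 ×ˢ 𝓝 θ)
      (𝓝 (supportPt B θ + supportPt (-B) θ)) := by
  simpa [chordGap] using ((tendsto_chordTop_zero hB θ).add (tendsto_chordTop_zero hB.neg θ)).sub
    (tendsto_smul_tangentVec θ)

end chord

/-- Equality of the gaps at a vector transfers to the gap vector. -/
lemma chordGap_eq_of_chordGap_mem {B C U : Set Plane} (hB : IsStrictBody B)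
    (hC : IsStrictBody C) (hBC : B - B = C - C)
    (hU : ∀ x ∈ U, x ≠ 0 → x ∈ interior (B - B) → chordGap B x = chordGap C x) {v : Plane}
    (hv0 : v ≠ 0) (hv : v ∈ interior (B - B)) (hvU : -chordGap B v ∈ U) :
    chordGap B v = chordGap C v := by
  have h0 := chordGap_ne_zero hB hv0 hv
  have hi := chordGap_mem_interior hB hv0 hv
  have h1 := hU _ hvU (neg_ne_zero.2 h0) (neg_mem_interior_sub_self hi)
  rw [chordGap_neg hB h0 (interior_subset hi), chordGap_chordGap hB hv0 hv, neg_neg] at h1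
  have h2 := chordGap_chordGap hC (neg_ne_zero.2 h0) (hBC ▸ neg_mem_interior_sub_self hi)
  rw [← h1, neg_neg] at h2
  exact h2.symm

/-! ### Areas by integration over line sections. -/

/-- The linear isometry taking the standard frame to `unitVec ψ`, `tangentVec ψ`. -/
noncomputable def frameRotation (ψ : ℝ) : Plane ≃ₗᵢ[ℝ] Plane :=
  LinearIsometry.toLinearIsometryEquiv
    { toFun := fun y => y 0 • unitVec ψ + y 1 • tangentVec ψ
      map_add' := fun x y => by simp; module
      map_smul' := fun c x => by simp; module
      norm_map' := fun y => by
        have h : ‖y 0 • unitVec ψ + y 1 • tangentVec ψ‖ ^ 2 = ‖y‖ ^ 2 := by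
          have := Real.sin_sq_add_cos_sq ψ
          rw [norm_sq_eq_dot, norm_sq_eq_dot]; simp [dot]
          linear_combination (y 0 ^ 2 + y 1 ^ 2) * this
        have := abs_eq_abs.2 (sq_eq_sq_iff_eq_or_eq_neg.1 h)
        simpa using this } rfl

lemma measurePreserving_frame (ψ : ℝ) :
    MeasurePreserving (fun p : ℝ × ℝ => p.1 • unitVec ψ + p.2 • tangentVec ψ) := by
  have h1 := (volume_preserving_finTwoArrow ℝ).symm
  have h2 := (PiLp.volume_preserving_toLp (Fin 2)).comp h1
  exact (frameRotation ψ).measurePreserving.comp h2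

/-- The section of `K` by the line at signed distance `s` from the origin with normal
`unitVec ψ`. -/
def lineSection (K : Set Plane) (ψ s : ℝ) : Set ℝ := {r | s • unitVec ψ + r • tangentVec ψ ∈ K}

lemma dot_frame (ψ s r : ℝ) : dot (unitVec ψ) (s • unitVec ψ + r • tangentVec ψ) = s := by
  rw [dot_add, dot_smul, dot_smul, dot_unitVec_unitVec, dot_unitVec_tangentVec]; simp

lemma dot_tangentVec_frame (ψ s r : ℝ) :
    dot (tangentVec ψ) (s • unitVec ψ + r • tangentVec ψ) = r := by
  rw [dot_add, dot_smul, dot_smul, dot_tangentVec_unitVec, dot_tangentVec_tangentVec]; simp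

section sections
variable {K : Set Plane} (ψ : ℝ)

lemma measurableSet_frame_preimage (hK : MeasurableSet K) :
    MeasurableSet {p : ℝ × ℝ | p.1 • unitVec ψ + p.2 • tangentVec ψ ∈ K} :=
  (measurePreserving_frame ψ).measurable hK

lemma measurable_volume_lineSection (hK : MeasurableSet K) :
    Measurable fun s => volume (lineSection K ψ s) :=
  measurable_measure_prodMk_left (measurableSet_frame_preimage ψ hK)

lemma volume_eq_lintegral_lineSection (hK : MeasurableSet K) :
    volume K = ∫⁻ s, volume (lineSection K ψ s) := by
  rw [← (measurePreserving_frame ψ).measure_preimage hK.nullMeasurableSet]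
  exact Measure.prod_apply (measurableSet_frame_preimage ψ hK)

lemma lineSection_subset {R : ℝ} (hR : ∀ z ∈ K, ‖z‖ ≤ R) (s : ℝ) :
    lineSection K ψ s ⊆ Icc (-R) R := by
  intro r hr
  have h1 := hR _ hr
  have h2 := abs_dot_le (tangentVec ψ) (s • unitVec ψ + r • tangentVec ψ)
  rw [dot_tangentVec_frame, norm_tangentVec, one_mul] at h2
  exact abs_le.1 (h2.trans h1)

lemma lineSection_eq_empty {R s : ℝ} (hR : ∀ z ∈ K, ‖z‖ ≤ R) (hs : s ∉ Icc (-R) R) :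
    lineSection K ψ s = ∅ := by
  rw [eq_empty_iff_forall_notMem]
  intro r hr
  have h1 := hR _ hr
  have h2 := abs_dot_le (unitVec ψ) (s • unitVec ψ + r • tangentVec ψ)
  rw [dot_frame, norm_unitVec, one_mul] at h2
  exact hs (abs_le.1 (h2.trans h1))

lemma volume_lineSection_lt_top {R : ℝ} (hR : ∀ z ∈ K, ‖z‖ ≤ R) (s : ℝ) :
    volume (lineSection K ψ s) < ⊤ :=
  (measure_mono (lineSection_subset ψ hR s)).trans_lt (by simp)

lemma volumeReal_eq_integral_lineSection (hK : MeasurableSet K) {R : ℝ}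
    (hR : ∀ z ∈ K, ‖z‖ ≤ R) :
    volume.real K = ∫ s, volume.real (lineSection K ψ s) := by
  rw [measureReal_def, volume_eq_lintegral_lineSection ψ hK]
  exact (integral_toReal (measurable_volume_lineSection ψ hK).aemeasurable
    (Filter.Eventually.of_forall fun s => volume_lineSection_lt_top ψ hR s)).symm

lemma volumeReal_lineSection_le {R : ℝ} (hR0 : 0 ≤ R) (hR : ∀ z ∈ K, ‖z‖ ≤ R) (s : ℝ) :
    volume.real (lineSection K ψ s) ≤ (Icc (-R) R).indicator (fun _ => 2 * R) s := by
  by_cases hs : s ∈ Icc (-R) R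
  · rw [indicator_of_mem hs]
    calc volume.real (lineSection K ψ s) ≤ volume.real (Icc (-R) R) :=
          measureReal_mono (lineSection_subset ψ hR s) (by simp)
      _ = 2 * R := by rw [Real.volume_real_Icc_of_le (by linarith)]; ring
  · rw [indicator_of_notMem hs, lineSection_eq_empty ψ hR hs]; simp

lemma integrable_lineSection (hK : MeasurableSet K) {R : ℝ} (hR0 : 0 ≤ R)
    (hR : ∀ z ∈ K, ‖z‖ ≤ R) : Integrable fun s => volume.real (lineSection K ψ s) := by
  refine Integrable.mono' (g := (Icc (-R) R).indicator fun _ => 2 * R)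
    ((integrable_indicator_iff measurableSet_Icc).2 (integrableOn_const (by simp)))
    (measurable_volume_lineSection ψ hK).ennreal_toReal.aestronglyMeasurable
    (Filter.Eventually.of_forall fun s => ?_)
  rw [Real.norm_of_nonneg measureReal_nonneg]
  exact volumeReal_lineSection_le ψ hR0 hR s

lemma volumeReal_inter_halfPlane (hK : MeasurableSet K) {R : ℝ} (hR : ∀ z ∈ K, ‖z‖ ≤ R)
    (c : ℝ) : volume.real (K ∩ {y | dot (unitVec ψ) y < c})
      = ∫ s in Iio c, volume.real (lineSection K ψ s) := by
  have hm : MeasurableSet {y : Plane | dot (unitVec ψ) y < c} :=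
    measurableSet_lt (by fun_prop : Continuous _).measurable measurable_const
  rw [volumeReal_eq_integral_lineSection ψ (hK.inter hm) (R := R) (fun z hz => hR z hz.1),
    ← integral_indicator measurableSet_Iio]
  congr 1; ext s
  by_cases hs : s < c
  · rw [indicator_of_mem (show s ∈ Iio c from hs)]
    congr 1; ext r; simp [lineSection, dot_frame, -dot_add, hs]
  · rw [indicator_of_notMem (show s ∉ Iio c from hs)]
    have : lineSection (K ∩ {y | dot (unitVec ψ) y < c}) ψ s = ∅ := by
      rw [eq_empty_iff_forall_notMem]
      rintro r ⟨-, hr⟩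
      rw [mem_ofPred_eq, dot_frame] at hr
      exact hs hr
    rw [this]; simp

end sections

/-- The area of a body in the moving half plane `dot (unitVec ψ) y < c` is differentiable in `c`
with derivative the length of the chord cut off. -/
lemma hasDerivAt_volumeReal_halfPlane {K : Set Plane} (hK : IsStrictBody K) {ψ c ℓ : ℝ}
    {z : Plane} (hz : z ∈ frontier K) (hz' : z + ℓ • tangentVec ψ ∈ frontier K) (hℓ : 0 < ℓ)
    (hc : dot (unitVec ψ) z = c) :
    HasDerivAt (fun c => volume.real (K ∩ {y | dot (unitVec ψ) y < c})) ℓ c := by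
  obtain ⟨R, hR0, hR⟩ := hK.isCompact.isBounded.exists_pos_norm_le
  have hKm := hK.isClosed.measurableSet
  rw [hK.mem_frontier] at hz hz'
  set r₁ := dot (tangentVec ψ) z with hr₁
  have hzd : z = c • unitVec ψ + r₁ • tangentVec ψ := by
    rw [← hc]; exact frame_decomp ψ z
  have hne : z ≠ z + ℓ • tangentVec ψ := by
    simpa using And.intro hℓ.ne' (tangentVec_ne_zero ψ)
  have hin : ∀ r, r₁ < r → r < r₁ + ℓ → c • unitVec ψ + r • tangentVec ψ ∈ interior K := by
    intro r h1 h2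
    have := hK.midpoint_mem_interior hz.1 hz'.1 hne (s := (r - r₁) / ℓ)
      (div_pos (by linarith) hℓ) ((div_lt_one hℓ).2 (by linarith))
    convert this using 1
    rw [hzd]
    have e : r = r₁ + (r - r₁) / ℓ * ℓ := by field_simp; ring
    conv_lhs => rw [e]
    module
  have hout : ∀ r, r < r₁ ∨ r₁ + ℓ < r → c • unitVec ψ + r • tangentVec ψ ∉ K := by
    rintro r (h | h) hr
    · apply hz.2
      have hd : 0 < r₁ + ℓ - r := by linarith
      have := hK.midpoint_mem_interior hr hz'.1 (fun e => by
        have := congrArg (dot (tangentVec ψ)) e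
        rw [dot_tangentVec_frame, dot_add, dot_smul, dot_tangentVec_tangentVec, sub_self,
          Real.cos_zero] at this
        linarith) (s := (r₁ - r) / (r₁ + ℓ - r))
        (div_pos (by linarith) hd) ((div_lt_one hd).2 (by linarith))
      convert this using 1
      rw [hzd]
      have e : r₁ = (1 - (r₁ - r) / (r₁ + ℓ - r)) * r + (r₁ - r) / (r₁ + ℓ - r) * (r₁ + ℓ) := by
        field_simp; ring
      set σ := (r₁ - r) / (r₁ + ℓ - r)
      conv_lhs => rw [e]
      module
    · apply hz'.2
      have hd : 0 < r - r₁ := by linarith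
      have := hK.midpoint_mem_interior hz.1 hr (fun e => by
        have := congrArg (dot (tangentVec ψ)) e
        rw [dot_tangentVec_frame] at this
        linarith) (s := ℓ / (r - r₁))
        (div_pos (by linarith) hd) ((div_lt_one hd).2 (by linarith))
      convert this using 1
      rw [hzd]
      have e : ℓ = ℓ / (r - r₁) * (r - r₁) := by field_simp
      set σ := ℓ / (r - r₁)
      conv_lhs => rw [e]
      module
  have hsec : volume.real (lineSection K ψ c) = ℓ := by
    have : lineSection K ψ c = Icc r₁ (r₁ + ℓ) := by
      ext r
      constructor
      · intro hr
        by_contra hn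
        rw [mem_Icc, not_and_or, not_le, not_le] at hn
        exact hout r hn hr
      · intro hr
        rcases eq_or_lt_of_le hr.1 with rfl | h1
        · change c • unitVec ψ + r₁ • tangentVec ψ ∈ K; rw [← hzd]; exact hz.1
        rcases eq_or_lt_of_le hr.2 with rfl | h2
        · change c • unitVec ψ + (r₁ + ℓ) • tangentVec ψ ∈ K
          have := hz'.1
          rw [hzd] at this
          convert this using 1; module
        exact interior_subset (s := K) (hin r h1 h2)
    rw [this, Real.volume_real_Icc_of_le (by linarith)]; ring
  -- Points of the line other than the two ends of the section are interior to `K` or outside it, so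
  -- the indicators of nearby sections converge at almost every `r`.
  have hcont : ContinuousAt (fun s => volume.real (lineSection K ψ s)) c := by
    have hms : ∀ s, MeasurableSet (lineSection K ψ s) := fun s =>
      measurable_prodMk_left (measurableSet_frame_preimage ψ hKm)
    have := tendsto_measure_of_ae_tendsto_indicator (μ := volume) (𝓝 c) (hms c) hms
      (measurableSet_Icc (a := -R) (b := R)) (by simp)
      (Filter.Eventually.of_forall fun s => lineSection_subset ψ hR s) ?_
    · exact (ENNReal.tendsto_toReal (volume_lineSection_lt_top ψ hR c).ne).comp this
    · have hnull : ∀ᵐ r : ℝ, r ≠ r₁ ∧ r ≠ r₁ + ℓ :=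
        (Measure.ae_ne volume r₁).and (Measure.ae_ne volume (r₁ + ℓ))
      filter_upwards [hnull] with r hr
      have hco : Continuous fun s : ℝ => s • unitVec ψ + r • tangentVec ψ := by fun_prop
      by_cases h : r₁ < r ∧ r < r₁ + ℓ
      · have hi := hin r h.1 h.2
        filter_upwards [hco.continuousAt (isOpen_interior.mem_nhds hi)] with s hs
        exact ⟨fun _ => interior_subset (s := K) hi, fun _ => interior_subset (s := K) hs⟩
      · have ho : c • unitVec ψ + r • tangentVec ψ ∉ K := by
          apply hout
          by_contra hn
          push Not at hn
          exact h ⟨lt_of_le_of_ne hn.1 hr.1.symm, lt_of_le_of_ne hn.2 hr.2⟩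
        filter_upwards [hco.continuousAt (hK.isClosed.isOpen_compl.mem_nhds ho)] with s hs
        exact ⟨fun h' => absurd h' hs, fun h' => absurd h' ho⟩
  have hint := integrable_lineSection ψ hKm hR0.le hR
  have hF := intervalIntegral.integral_hasDerivAt_right (a := c) (b := c)
    hint.intervalIntegrable
    ((measurable_volume_lineSection ψ hKm).ennreal_toReal.stronglyMeasurable.stronglyMeasurableAtFilter)
    hcont
  rw [hsec] at hF
  have heq : (fun c => volume.real (K ∩ {y | dot (unitVec ψ) y < c})) = fun b =>
      (∫ s in c..b, volume.real (lineSection K ψ s))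
        + ∫ s in Iic c, volume.real (lineSection K ψ s) := by
    ext b
    rw [volumeReal_inter_halfPlane ψ hKm hR b, ← integral_Iic_eq_integral_Iio,
      ← intervalIntegral.integral_Iic_sub_Iic hint.integrableOn hint.integrableOn]
    ring
  rw [heq]
  exact hF.add_const _

lemma volume_Icc_diff_translate {I : Set ℝ} (hI : IsCompact I) (hI' : I.OrdConnected) {t : ℝ}
    (ht : 0 ≤ t) : volume.real {r | r ∈ I ∧ r - t ∉ I} = min (volume.real I) t := by
  rcases I.eq_empty_or_nonempty with rfl | hne
  · simp [ht]
  have hc := eq_Icc_of_connected_compact ⟨hne, hI'.isPreconnected⟩ hI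
  set a := sInf I
  set b := sSup I
  have hab : a ≤ b := by
    rw [hc] at hne; exact nonempty_Icc.1 hne
  rw [hc, Real.volume_real_Icc_of_le hab]
  apply le_antisymm
  · have : {r | r ∈ Icc a b ∧ r - t ∉ Icc a b} ⊆ Icc a (a + min (b - a) t) := by
      rintro r ⟨hr, hr'⟩
      refine ⟨hr.1, ?_⟩
      rw [mem_Icc, not_and_or] at hr'
      rw [← sub_le_iff_le_add']
      refine le_min (by linarith [hr.2]) ?_
      rcases hr' with h | h
      · linarith [not_le.1 h]
      · exact absurd (by linarith [hr.2]) h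
    calc _ ≤ volume.real (Icc a (a + min (b - a) t)) := measureReal_mono this (by simp)
      _ = _ := by rw [Real.volume_real_Icc_of_le]; · ring
                  · simp [ht, hab]
  · have : Ico a (a + min (b - a) t) ⊆ {r | r ∈ Icc a b ∧ r - t ∉ Icc a b} := by
      rintro r ⟨hr, hr'⟩
      rw [← sub_lt_iff_lt_add', lt_min_iff] at hr'
      exact ⟨⟨hr, by linarith⟩, fun h => by linarith [h.1]⟩
    calc min (b - a) t = volume.real (Ico a (a + min (b - a) t)) := by
          rw [Real.volume_real_Ico_of_le]; · ring
          · simp [ht, hab]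
      _ ≤ _ := measureReal_mono this (ne_top_of_le_ne_top (b := volume (Icc a b)) (by simp)
          (measure_mono fun r hr => hr.1))

lemma mem_vadd_iff_sub_mem {K : Set Plane} {x y : Plane} : y ∈ x +ᵥ K ↔ y - x ∈ K := by
  rw [Set.mem_vadd_set_iff_neg_vadd_mem, vadd_eq_add, neg_add_eq_sub]

lemma vadd_eq_preimage (x : Plane) (K : Set Plane) : x +ᵥ K = (fun y => y - x) ⁻¹' K := by
  ext y; exact mem_vadd_iff_sub_mem

lemma measurableSet_vadd {K : Set Plane} (hK : MeasurableSet K) (x : Plane) :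
    MeasurableSet (x +ᵥ K) := by
  rw [vadd_eq_preimage]; exact (by fun_prop : Measurable fun y : Plane => y - x) hK

lemma volume_vadd (K : Set Plane) (x : Plane) : volume (x +ᵥ K) = volume K := by
  rw [vadd_eq_preimage]; simp only [sub_eq_add_neg]; exact measure_preimage_add_right volume (-x) K

/-- On each line parallel to the translation, the part of the section not covered by its translate
is an initial piece of length at most `t`. -/
lemma volumeReal_diff_vadd {K : Set Plane} (hK : IsCompact K) (hKc : Convex ℝ K) (ψ : ℝ) {t : ℝ}
    (ht : 0 ≤ t) : volume.real (K \ (t • tangentVec ψ +ᵥ K))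
      = ∫ s, min (volume.real (lineSection K ψ s)) t := by
  obtain ⟨R, hR0, hR⟩ := hK.isBounded.exists_pos_norm_le
  rw [volumeReal_eq_integral_lineSection ψ (hK.measurableSet.diff
    (measurableSet_vadd hK.measurableSet _)) (R := R) (fun z hz => hR z hz.1)]
  congr 1; ext s
  have hcont : Continuous fun r : ℝ => s • unitVec ψ + r • tangentVec ψ := by fun_prop
  rw [← volume_Icc_diff_translate (t := t) (I := lineSection K ψ s) _ _ ht]
  · congr 1; ext r
    simp only [lineSection, mem_sdiff, mem_ofPred_eq, mem_vadd_iff_sub_mem, add_sub_assoc, sub_smul]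
  · exact (isCompact_Icc (a := -R) (b := R)).of_isClosed_subset (hK.isClosed.preimage hcont)
      (lineSection_subset ψ hR s)
  · refine Convex.ordConnected ?_
    intro r hr r' hr' a b ha hb hab
    have := hKc hr hr' ha hb hab
    change s • unitVec ψ + (a • r + b • r') • tangentVec ψ ∈ K
    convert this using 1
    have : s = a * s + b * s := by rw [← add_mul, hab, one_mul]
    conv_lhs => rw [this]
    simp only [smul_eq_mul]; module

lemma volume_ne_top_of_compact {K : Set Plane} (hK : IsCompact K) : volume K ≠ ⊤ :=
  hK.measure_lt_top.ne

lemma exists_lipschitz_diff_vadd {K : Set Plane} (hK : IsCompact K) (hKc : Convex ℝ K) :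
    ∃ C : ℝ, 0 ≤ C ∧ ∀ w : Plane, volume.real (K \ (w +ᵥ K)) ≤ C * ‖w‖ := by
  obtain ⟨R, hR0, hR⟩ := hK.isBounded.exists_pos_norm_le
  refine ⟨2 * R, by positivity, fun w => ?_⟩
  obtain ⟨ψ, hψ⟩ := exists_polar_tangent w
  have h := volumeReal_diff_vadd hK hKc ψ (norm_nonneg w)
  rw [← hψ] at h
  rw [h]
  have hint := integrable_lineSection ψ hK.measurableSet hR0.le hR
  calc ∫ s, min (volume.real (lineSection K ψ s)) ‖w‖
      ≤ ∫ s, (Icc (-R) R).indicator (fun _ => ‖w‖) s := by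
        refine integral_mono_of_nonneg (Filter.Eventually.of_forall fun s => ?_)
          ((integrable_indicator_iff measurableSet_Icc).2 (integrableOn_const (by simp)))
          (Filter.Eventually.of_forall fun s => ?_)
        · simp
        · by_cases hs : s ∈ Icc (-R) R
          · simp [indicator_of_mem hs]
          · simp [indicator_of_notMem hs, lineSection_eq_empty ψ hR hs]
    _ = 2 * R * ‖w‖ := by
        rw [integral_indicator measurableSet_Icc]
        rw [setIntegral_const, Real.volume_real_Icc_of_le (show -R ≤ R by linarith), smul_eq_mul]
        ring

/-- Replacing `y` by `x` adds at most a translate of `K \ ((y - x) +ᵥ K)` to the intersection. The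
Lipschitz bound makes Rademacher's theorem applicable. -/
lemma exists_lipschitz_covariogram {K : Set Plane} (hK : IsCompact K) (hKc : Convex ℝ K) :
    ∃ C, LipschitzWith C (covariogram K) := by
  obtain ⟨C, hC0, hC⟩ := exists_lipschitz_diff_vadd hK hKc
  have key : ∀ x y, covariogram K x ≤ covariogram K y + C * ‖x - y‖ := by
    intro x y
    have hsub : K ∩ (x +ᵥ K) ⊆ (K ∩ (y +ᵥ K)) ∪ (x +ᵥ (K \ ((y - x) +ᵥ K))) := by
      rintro z ⟨h1, h2⟩
      by_cases h : z ∈ y +ᵥ K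
      · exact .inl ⟨h1, h⟩
      · right
        rw [mem_vadd_iff_sub_mem] at h h2 ⊢
        refine ⟨h2, ?_⟩
        rw [mem_vadd_iff_sub_mem]
        convert h using 1; abel_nf
    have ht : volume (K ∩ (y +ᵥ K) ∪ (x +ᵥ (K \ ((y - x) +ᵥ K)))) ≠ ⊤ := by
      refine ne_top_of_le_ne_top ?_ (measure_union_le _ _)
      refine ENNReal.add_ne_top.2 ⟨?_, ?_⟩
      · exact ne_top_of_le_ne_top (volume_ne_top_of_compact hK) (measure_mono inter_subset_left)
      · rw [volume_vadd]
        exact ne_top_of_le_ne_top (volume_ne_top_of_compact hK) (measure_mono sdiff_subset)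
    have hv : volume.real (x +ᵥ (K \ ((y - x) +ᵥ K))) = volume.real (K \ ((y - x) +ᵥ K)) := by
      rw [measureReal_def, volume_vadd, ← measureReal_def]
    calc covariogram K x ≤ volume.real (K ∩ (y +ᵥ K) ∪ (x +ᵥ (K \ ((y - x) +ᵥ K)))) :=
          measureReal_mono hsub ht
      _ ≤ _ := measureReal_union_le _ _
      _ ≤ covariogram K y + C * ‖x - y‖ := by
          rw [hv, norm_sub_rev]; exact add_le_add le_rfl (hC _)
  lift C to NNReal using hC0
  refine ⟨C, LipschitzWith.of_dist_le_mul fun x y => ?_⟩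
  rw [Real.dist_eq, dist_eq_norm, abs_le]
  have h1 := key x y
  have h2 := key y x
  rw [norm_sub_rev y x] at h2
  exact ⟨by linarith, by linarith⟩

/-! ### The gradient of the covariogram. -/

section lens
variable {B : Set Plane} (hB : IsStrictBody B)
include hB

lemma mem_frontier_neg {z : Plane} (h : z ∈ frontier (-B)) : -z ∈ frontier B := by
  obtain ⟨θ, -, rfl⟩ := exists_eq_supportPt hB.neg h 0
  rw [supportPt_neg hB, neg_neg]
  exact supportPt_mem_frontier hB _

lemma chordTop_neg_body_frontier {x : Plane} (hx0 : x ≠ 0) (hx : x ∈ B - B) :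
    x - chordTop (-B) x ∈ frontier B ∧ -chordTop (-B) x ∈ frontier B := by
  obtain ⟨h1, h2⟩ := (chordTop_spec hB.neg (v := x)
    (by rwa [neg_sub_neg_body])).mem_frontier hB.neg hx0
  exact ⟨by simpa using mem_frontier_neg hB h2, mem_frontier_neg hB h1⟩

/-- The line through the vertices of the lens `B ∩ (B + x)` separates the arc of `B` from the
arc of `B + x`. -/
lemma sub_mem_of_dot_ge {x y : Plane} (hx0 : x ≠ 0) (hx : x ∈ interior (B - B))
    {ψ ℓ : ℝ} (hℓ : 0 < ℓ) (hd : chordGap B x = -(ℓ • tangentVec ψ)) (hy : y ∈ B)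
    (hyc : dot (unitVec ψ) (chordTop B x) ≤ dot (unitVec ψ) y) : y - x ∈ B := by
  have h1 := chordTop_spec hB (interior_subset hx)
  have h2 := chordTop_neg_body_spec hB (interior_subset hx)
  have f1 := h1.mem_frontier hB hx0
  have f2 := chordTop_neg_body_frontier hB hx0 (interior_subset hx)
  have hpos := wedge_chordGap_pos hB hx0 hx
  have hg : chordGap B x = chordTop B x - (x - chordTop (-B) x) := by rw [chordGap]; abel
  generalize chordTop B x = z at *
  generalize x - chordTop (-B) x = z' at *
  have hv : z = z' - ℓ • tangentVec ψ := by
    rw [sub_eq_add_neg, ← hd, hg]; abel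
  have hux : 0 < dot (unitVec ψ) x := by
    have : wedge (-(ℓ • tangentVec ψ)) x = ℓ * wedge x (tangentVec ψ) := by
      simp [wedge]; ring
    rw [hd, this, wedge_tangentVec] at hpos
    exact (mul_pos_iff_of_pos_left hℓ).1 hpos
  have hcz : dot (unitVec ψ) z' = dot (unitVec ψ) z := by
    rw [hv, dot_sub, dot_smul, dot_unitVec_tangentVec]; simp
  have hh : wedge z x = wedge z' x + wedge (chordGap B x) x := by
    rw [hg, sub_wedge]; ring
  -- points of `B` on the separating line
  have hline : ∀ m, dot (unitVec ψ) m = dot (unitVec ψ) z →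
      ∃ σ : ℝ, m = z' - (σ * ℓ) • tangentVec ψ ∧
        wedge m x = wedge z' x + σ * wedge (chordGap B x) x := by
    intro m hm
    have hm' := frame_decomp ψ (m - z')
    rw [dot_sub, hm, hcz, sub_self, zero_smul, zero_add] at hm'
    have e : m = z' - ((-dot (tangentVec ψ) (m - z') / ℓ) * ℓ) • tangentVec ψ := by
      rw [div_mul_cancel₀ _ hℓ.ne', neg_smul, sub_neg_eq_add, ← hm']; abel
    refine ⟨_, e, ?_⟩
    set σ := -dot (tangentVec ψ) (m - z') / ℓ
    rw [hd, e]; simp; ring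
  -- The line through the vertices meets `B` only between them: a point of `B` beyond a vertex would
  -- make that boundary point interior.
  have hout : ∀ m ∈ B, ∀ σ : ℝ, m = z' - (σ * ℓ) • tangentVec ψ → 0 ≤ σ ∧ σ ≤ 1 := by
    intro m hm σ hσ
    by_contra hcon
    rw [not_and_or, not_le, not_le] at hcon
    have hinj : ∀ τ₁ τ₂ : ℝ, τ₁ ≠ τ₂ →
        z' - (τ₁ * ℓ) • tangentVec ψ ≠ z' - (τ₂ * ℓ) • tangentVec ψ := by
      intro τ₁ τ₂ hne he
      have := congrArg (dot (tangentVec ψ)) he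
      simp only [dot_sub, dot_smul, dot_tangentVec_tangentVec, sub_self, Real.cos_zero] at this
      exact hne (mul_right_cancel₀ hℓ.ne' (by linarith))
    rcases hcon with h | h
    · apply (hB.mem_frontier.1 f2.1).2
      have hp : 0 < 1 - σ := by linarith
      have := hB.midpoint_mem_interior hm h1.1 (by
        rw [hσ, hv]; simpa using hinj σ 1 (by linarith)) (s := -σ / (1 - σ))
        (div_pos (by linarith) hp) ((div_lt_one hp).2 (by linarith))
      convert this using 1
      have e : (0 : ℝ) = (1 - -σ / (1 - σ)) * σ + -σ / (1 - σ) := by field_simp; ring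
      set s := -σ / (1 - σ)
      rw [hσ, hv]
      have : z' = z' - (0 * ℓ) • tangentVec ψ := by simp
      conv_lhs => rw [this, e]
      module
    · apply (hB.mem_frontier.1 f1.1).2
      have hp : 0 < σ := by linarith
      have := hB.midpoint_mem_interior h2.1 hm (by
        rw [hσ]; simpa using hinj 0 σ (by linarith)) (s := 1 / σ)
        (div_pos (by linarith) hp) ((div_lt_one hp).2 (by linarith))
      convert this using 1
      have e : (1 : ℝ) = 1 / σ * σ := by field_simp
      set s := 1 / σ
      rw [hσ, hv]
      have : z' - ℓ • tangentVec ψ = z' - (1 * ℓ) • tangentVec ψ := by simp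
      conv_lhs => rw [this, e]
      module
  -- the point where the segment from `p` to `y` meets the line
  have hcross : ∀ p ∈ B, dot (unitVec ψ) p < dot (unitVec ψ) z → ∃ s : ℝ, 0 < s ∧ s ≤ 1 ∧
      ∃ m ∈ B, m = (1 - s) • p + s • y ∧ dot (unitVec ψ) m = dot (unitVec ψ) z := by
    intro p hp hpc
    have hden : 0 < dot (unitVec ψ) y - dot (unitVec ψ) p := by linarith
    set s := (dot (unitVec ψ) z - dot (unitVec ψ) p) / (dot (unitVec ψ) y - dot (unitVec ψ) p)
      with hs
    have hs0 : 0 < s := div_pos (by linarith) hden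
    have hs1 : s ≤ 1 := (div_le_one hden).2 (by linarith)
    refine ⟨s, hs0, hs1, _, hB.convex hp hy (by linarith) hs0.le (by ring), rfl, ?_⟩
    have : s * (dot (unitVec ψ) y - dot (unitVec ψ) p) = dot (unitVec ψ) z - dot (unitVec ψ) p :=
      div_mul_cancel₀ _ hden.ne'
    simp only [dot_add, dot_smul]; linarith
  -- If `y` lies outside the strip between the two extremal chords, the segment to `y` from the end
  -- `z - x` or `z' - x` crosses the separating line beyond a vertex, which `hout` forbids.
  by_cases hhi : wedge z x < wedge y x
  · exfalso
    obtain ⟨s, hs0, hs1, m, hm, hms, hmc⟩ := hcross _ h1.2.1 (by rw [dot_sub]; linarith)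
    obtain ⟨σ, hσ, hσw⟩ := hline m hmc
    have hσ1 := (hout m hm σ hσ).2
    have : wedge m x = wedge z x + s * (wedge y x - wedge z x) := by
      rw [hms]; simp; ring
    nlinarith
  by_cases hlo : wedge y x < wedge z' x
  · exfalso
    obtain ⟨s, hs0, hs1, m, hm, hms, hmc⟩ := hcross _ h2.2.1 (by rw [dot_sub]; linarith)
    obtain ⟨σ, hσ, hσw⟩ := hline m hmc
    have hσ0 := (hout m hm σ hσ).1
    have : wedge m x = wedge z' x + s * (wedge y x - wedge z' x) := by
      rw [hms]; simp; ring
    nlinarith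
  push Not at hhi hlo
  -- `w` is the point of the segment `[z', z]` on the line through `y` parallel to `x`. Then `y = w
  -- + τ • x` with `τ ≥ 0`, so `y - x` lies between `w - x` and `y`.
  set s := (wedge y x - wedge z' x) / wedge (chordGap B x) x with hs
  have hs0 : 0 ≤ s := div_nonneg (by linarith) hpos.le
  have hs1 : s ≤ 1 := (div_le_one hpos).2 (by linarith)
  have hsw : s * wedge (chordGap B x) x = wedge y x - wedge z' x := div_mul_cancel₀ _ hpos.ne'
  set w := (1 - s) • z' + s • z with hw
  have hwx : w - x ∈ B := by
    have := hB.convex h2.2.1 h1.2.1 (show 0 ≤ 1 - s by linarith) hs0 (by ring)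
    convert this using 1
    rw [hw]; module
  have hyw : wedge (y - w) x = 0 := by
    rw [hw, sub_wedge, add_wedge, smul_wedge, smul_wedge]
    linear_combination (-1 : ℝ) * hsw - s * hh
  obtain ⟨τ, hτ⟩ : ∃ τ : ℝ, y = w + τ • x := by
    refine ⟨dot x (y - w) / dot x x, ?_⟩
    have hp := dot_self_pos hx0
    have : y - w = (dot x (y - w) / dot x x) • x := by
      set q := y - w
      simp only [wedge] at hyw
      apply plane_ext <;> simp only [PiLp.smul_apply, smul_eq_mul] <;>
        rw [div_mul_eq_mul_div, eq_div_iff hp.ne'] <;> simp only [dot]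
      · linear_combination x 1 * hyw
      · linear_combination (-x 0) * hyw
    rw [← this]; abel
  have hτ0 : 0 ≤ τ := by
    have : dot (unitVec ψ) w = dot (unitVec ψ) z := by
      rw [hw, dot_add, dot_smul, dot_smul, hcz]; ring
    rw [hτ, dot_add, dot_smul, this] at hyc
    by_contra hneg
    push Not at hneg
    nlinarith
  have := hB.convex hwx hy (a := 1 / (1 + τ)) (b := τ / (1 + τ)) (by positivity) (by positivity)
    (by rw [← add_div]; exact div_self (by linarith))
  convert this using 1
  have h1τ : 1 + τ ≠ 0 := by linarith
  rw [hτ]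
  apply plane_ext <;> simp <;> field_simp <;> ring

/-- The reflection `y ↦ x - y` turns this into `sub_mem_of_dot_ge` for `-B`. -/
lemma mem_of_dot_le {x y : Plane} (hx0 : x ≠ 0) (hx : x ∈ interior (B - B))
    {ψ ℓ : ℝ} (hℓ : 0 < ℓ) (hd : chordGap B x = -(ℓ • tangentVec ψ)) (hy : y - x ∈ B)
    (hyc : dot (unitVec ψ) y ≤ dot (unitVec ψ) (chordTop B x)) : y ∈ B := by
  have hgap : chordTop (-B) x = x - chordTop B x + chordGap B x := by rw [chordGap]; abel
  have := sub_mem_of_dot_ge hB.neg hx0 (by rwa [neg_sub_neg_body]) hℓ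
    (by rwa [chordGap_neg_body]) (y := x - y) (by simpa using hy) ?_
  · simpa using this
  · rw [hgap, hd]
    simp only [dot_add, dot_sub, dot_neg, dot_smul, dot_unitVec_tangentVec, sub_self, Real.sin_zero]
    linarith

/-- The gradient of the covariogram at points of differentiability. -/
lemma fderiv_covariogram {x : Plane} (hx0 : x ≠ 0) (hx : x ∈ interior (B - B))
    (hdiff : DifferentiableAt ℝ (covariogram B) x) (w : Plane) :
    fderiv ℝ (covariogram B) x w = wedge w (chordGap B x) := by
  obtain ⟨ψ, hψ⟩ := exists_polar_tangent (-chordGap B x)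
  have hne := chordGap_ne_zero hB hx0 hx
  set ℓ := ‖-chordGap B x‖
  have hℓ : 0 < ℓ := norm_pos_iff.2 (neg_ne_zero.2 hne)
  have hd : chordGap B x = -(ℓ • tangentVec ψ) := by rw [← hψ, neg_neg]
  set c := dot (unitVec ψ) (chordTop B x) with hc
  have hBm := hB.isClosed.measurableSet
  have hfin := volume_ne_top_of_compact hB.isCompact
  set A := fun c => volume.real (B ∩ {y | dot (unitVec ψ) y < c}) with hA
  -- Cutting along the fixed line through the vertices at `x` bounds the covariogram above by `F`,
  -- with equality at `x`. Thus `F - covariogram B` is minimal at `x` and the two derivatives agree;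
  -- that of `F` is the length of the cut times the normal.
  set F := fun x' => volume.real (B ∩ {y | c ≤ dot (unitVec ψ) y}) + A (c - dot (unitVec ψ) x')
  have htr : ∀ x', volume.real ((x' +ᵥ B) ∩ {y | dot (unitVec ψ) y < c})
      = A (c - dot (unitVec ψ) x') := by
    intro x'
    have : (x' +ᵥ B) ∩ {y | dot (unitVec ψ) y < c}
        = x' +ᵥ (B ∩ {y | dot (unitVec ψ) y < c - dot (unitVec ψ) x'}) := by
      ext y
      simp only [mem_inter_iff, mem_vadd_iff_sub_mem, mem_ofPred_eq, dot_sub, sub_lt_sub_iff_right]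
    rw [hA, this, measureReal_def, volume_vadd, ← measureReal_def]
  have hle : ∀ x', covariogram B x' ≤ F x' := by
    intro x'
    have hsub : B ∩ (x' +ᵥ B) ⊆ (B ∩ {y | c ≤ dot (unitVec ψ) y}) ∪
        ((x' +ᵥ B) ∩ {y | dot (unitVec ψ) y < c}) := by
      rintro y ⟨h1, h2⟩
      rcases le_or_gt c (dot (unitVec ψ) y) with h | h
      · exact .inl ⟨h1, h⟩
      · exact .inr ⟨h2, h⟩
    refine (measureReal_mono hsub ?_).trans ((measureReal_union_le _ _).trans (by rw [htr]))
    refine ne_top_of_le_ne_top ?_ (measure_union_le _ _)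
    refine ENNReal.add_ne_top.2 ⟨ne_top_of_le_ne_top hfin (measure_mono inter_subset_left), ?_⟩
    exact ne_top_of_le_ne_top (by rwa [volume_vadd]) (measure_mono inter_subset_left)
  have heq : covariogram B x = F x := by
    have hmeas : MeasurableSet {y : Plane | dot (unitVec ψ) y < c} :=
      measurableSet_lt (by fun_prop : Continuous _).measurable measurable_const
    have h1 : B ∩ {y | c ≤ dot (unitVec ψ) y} =
        (B ∩ (x +ᵥ B)) \ {y | dot (unitVec ψ) y < c} := by
      ext y
      simp only [mem_inter_iff, mem_sdiff, mem_ofPred_eq, not_lt, mem_vadd_iff_sub_mem]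
      exact ⟨fun h => ⟨⟨h.1, sub_mem_of_dot_ge hB hx0 hx hℓ hd h.1 h.2⟩, h.2⟩,
        fun h => ⟨h.1.1, h.2⟩⟩
    have h2 : (x +ᵥ B) ∩ {y | dot (unitVec ψ) y < c} =
        (B ∩ (x +ᵥ B)) ∩ {y | dot (unitVec ψ) y < c} := by
      ext y
      simp only [mem_inter_iff, mem_ofPred_eq, mem_vadd_iff_sub_mem]
      exact ⟨fun h => ⟨⟨mem_of_dot_le hB hx0 hx hℓ hd h.1 h.2.le, h.1⟩, h.2⟩,
        fun h => ⟨h.1.2, h.2⟩⟩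
    have h3 := measureReal_inter_add_sdiff (μ := volume) (s := B ∩ (x +ᵥ B)) hmeas
      (ne_top_of_le_ne_top hfin (measure_mono inter_subset_left))
    simp only [F]
    rw [← htr, h1, h2, covariogram]
    linarith
  have hAd : HasDerivAt A ℓ (c - dot (unitVec ψ) x) := by
    have f1 := (chordTop_spec hB (interior_subset hx)).mem_frontier hB hx0
    have f2 := chordTop_neg_body_frontier hB hx0 (interior_subset hx)
    refine hasDerivAt_volumeReal_halfPlane hB f1.2 ?_ hℓ (by rw [dot_sub])
    convert f2.2 using 1
    have : ℓ • tangentVec ψ = -chordGap B x := by rw [hd, neg_neg]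
    rw [this, chordGap]; abel
  obtain ⟨L, hL⟩ : ∃ L : Plane →L[ℝ] ℝ, ∀ y, L y = dot (unitVec ψ) y := by
    refine ⟨⟨⟨⟨fun y => dot (unitVec ψ) y, fun y z => dot_add _ y z⟩,
      fun r y => by simp⟩, by fun_prop⟩, fun y => rfl⟩
  have hFd : HasFDerivAt F (ℓ • -L) x := by
    have h1 : HasFDerivAt (fun x' => c - dot (unitVec ψ) x') (-L) x := by
      have := (L.hasFDerivAt (x := x)).const_sub c
      simpa [hL] using this
    exact (hAd.comp_hasFDerivAt x h1).const_add _
  have hmin : IsLocalMin (F - covariogram B) x := by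
    refine Filter.Eventually.of_forall fun x' => ?_
    simp only [Pi.sub_apply, heq, sub_self]
    linarith [hle x']
  have h0 := hmin.hasFDerivAt_eq_zero (hFd.sub hdiff.hasFDerivAt)
  have h1 : fderiv ℝ (covariogram B) x = ℓ • -L := (sub_eq_zero.1 h0).symm
  rw [h1, hd]
  simp only [_root_.smul_apply, _root_.neg_apply, hL, smul_eq_mul,
    wedge_neg, wedge_smul, wedge_tangentVec]
  ring

end lens

lemma eq_of_forall_wedge_eq {a b : Plane} (h : ∀ w, wedge w a = wedge w b) : a = b := by
  have h0 := h !₂[1, 0]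
  have h1 := h !₂[0, 1]
  simp [wedge] at h0 h1
  exact plane_ext h1 h0

/-- The covariogram determines the gaps of parallel chords. -/
lemma chordGap_eq_of_covariogram_eq {B C U : Set Plane} (hB : IsStrictBody B)
    (hC : IsStrictBody C) (hBC : B - B = C - C) (hU : IsOpen U)
    (h : ∀ x ∈ U, covariogram B x = covariogram C x) {x : Plane} (hxU : x ∈ U) (hx0 : x ≠ 0)
    (hx : x ∈ interior (B - B)) : chordGap B x = chordGap C x := by
  set V := (U ∩ interior (B - B)) \ {0} with hV
  have hVo : IsOpen V := (hU.inter isOpen_interior).sdiff isClosed_singleton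
  obtain ⟨CB, hCB⟩ := exists_lipschitz_covariogram hB.isCompact hB.convex
  -- By Rademacher's theorem the gradients exist almost everywhere. Continuity of the gaps then
  -- removes the exceptional null set.
  have hae : ∀ᵐ y : Plane, y ∈ V → chordGap B y = chordGap C y := by
    filter_upwards [hCB.ae_differentiableAt (μ := volume)] with y hy hyV
    have hev : covariogram B =ᶠ[𝓝 y] covariogram C := by
      filter_upwards [hU.mem_nhds hyV.1.1] with y' hy' using h y' hy'
    have hy' : DifferentiableAt ℝ (covariogram C) y := hy.congr_of_eventuallyEq hev.symm
    refine eq_of_forall_wedge_eq fun w => ?_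
    rw [← fderiv_covariogram hB hyV.2 hyV.1.2 hy, ← fderiv_covariogram hC hyV.2
      (hBC ▸ hyV.1.2) hy', hev.fderiv_eq]
  have hxV : x ∈ V := ⟨⟨hxU, hx⟩, hx0⟩
  by_contra hne
  have hcont : ∀ᶠ y in 𝓝 x, chordGap B y ≠ chordGap C y :=
    (((tendsto_chordGap hB hx0 hx).sub (tendsto_chordGap hC hx0 (hBC ▸ hx))).eventually_ne
      (sub_ne_zero.2 hne)).mono fun y hy => sub_ne_zero.1 hy
  obtain ⟨W, hWs, hWo, hxW⟩ := eventually_nhds_iff.1 (hcont.and (hVo.mem_nhds hxV))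
  have hpos : 0 < volume W := hWo.measure_pos volume ⟨x, hxW⟩
  have hzero : volume W = 0 := by
    refine measure_mono_null (fun y hy => ?_) (ae_iff.1 hae)
    exact fun hcon => (hWs y hy).1 (hcon (hWs y hy).2)
  exact hpos.ne' hzero

/-! ### The covariogram determines the difference body. -/

lemma isCompact_sub {K H : Set Plane} (hK : IsCompact K) (hH : IsCompact H) :
    IsCompact (K - H) := by
  rw [sub_eq_add_neg]; exact hK.add hH.neg

lemma covariogram_pos {H : Set Plane} (hc : IsCompact H) (hH : Convex ℝ H)
    (hi : (interior H).Nonempty) {x : Plane} (hx : x ∈ interior (H - H)) :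
    0 < covariogram H x := by
  obtain ⟨w, h1, h2⟩ := exists_interior_chord_of_convex hH hi hx
  have ho : IsOpen (interior H ∩ (fun y => y - x) ⁻¹' interior H) :=
    isOpen_interior.inter (isOpen_interior.preimage (by fun_prop))
  have hpos := ho.measure_pos volume ⟨w, h1, h2⟩
  have hsub : interior H ∩ (fun y => y - x) ⁻¹' interior H ⊆ H ∩ (x +ᵥ H) := fun y hy =>
    ⟨interior_subset hy.1, mem_vadd_iff_sub_mem.2 (interior_subset (s := H) hy.2)⟩
  exact ENNReal.toReal_pos (hpos.trans_le (measure_mono hsub)).ne'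
    (ne_top_of_le_ne_top (volume_ne_top_of_compact hc) (measure_mono inter_subset_left))

lemma mem_sub_of_covariogram_pos {H : Set Plane} {x : Plane} (h : 0 < covariogram H x) :
    x ∈ H - H := by
  by_contra hx
  have : H ∩ (x +ᵥ H) = ∅ := by
    rw [eq_empty_iff_forall_notMem]
    rintro y ⟨h1, h2⟩
    exact hx ⟨y, h1, y - x, mem_vadd_iff_sub_mem.1 h2, by simp⟩
  rw [covariogram, this] at h
  simp at h

lemma zero_mem_interior_sub_of_nonempty {H : Set Plane} (hi : (interior H).Nonempty) :
    (0 : Plane) ∈ interior (H - H) := by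
  obtain ⟨x, hx⟩ := hi
  simpa using sub_mem_interior_sub_self hx (interior_subset hx)

lemma smul_mem_interior_of_zero_mem {D : Set Plane} (hD : Convex ℝ D)
    (h0 : (0 : Plane) ∈ interior D) {y : Plane} (hy : y ∈ D) {s : ℝ} (hs0 : 0 ≤ s) (hs1 : s < 1) :
    s • y ∈ interior D := by
  have := hD.combo_self_interior_mem_interior hy h0 hs0 (show 0 < 1 - s by linarith) (by ring)
  simpa using this

lemma exists_smul_mem_frontier {D : Set Plane} {y : Plane} {a b : ℝ} (hab : a ≤ b)
    (ha : a • y ∈ D) (hb : b • y ∉ D) : ∃ s ∈ Icc a b, s • y ∈ frontier D := by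
  have hc : IsPreconnected ((fun s : ℝ => s • y) '' Icc a b) :=
    isPreconnected_Icc.image _ (by fun_prop : Continuous fun s : ℝ => s • y).continuousOn
  by_contra hcon
  push Not at hcon
  have hint : ∀ s ∈ Icc a b, s • y ∈ closure D → s • y ∈ interior D := fun s hs h => by
    by_contra hi
    exact hcon s hs ⟨h, hi⟩
  obtain ⟨z, -, h1, h2⟩ := hc (interior D) (closure D)ᶜ isOpen_interior isClosed_closure.isOpen_compl
    (by
      rintro _ ⟨s, hs, rfl⟩
      by_cases h : s • y ∈ closure D
      · exact .inl (hint s hs h)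
      · exact .inr h)
    ⟨a • y, ⟨a, left_mem_Icc.2 hab, rfl⟩, hint a (left_mem_Icc.2 hab) (subset_closure ha)⟩
    ⟨b • y, ⟨b, right_mem_Icc.2 hab, rfl⟩,
      fun h => hb (interior_subset (hint b (right_mem_Icc.2 hab) h))⟩
  exact h2 (subset_closure (interior_subset h1))

/-- A radial argument from the common interior point 0. A ray through a point of `D` leaves `D` at a
point of `E`. A ray to a point of `E \ D` crosses `frontier D` at an interior point of `E`, which is
impossible. -/
lemma eq_of_frontier_subset_frontier {D E : Set Plane} (hD : IsCompact D)
    (hD0 : (0 : Plane) ∈ interior D) (hE : IsCompact E) (hEc : Convex ℝ E)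
    (hE0 : (0 : Plane) ∈ interior E) (h : frontier D ⊆ frontier E) : D = E := by
  have hfr : ∀ {C : Set Plane}, IsCompact C → ∀ {x}, x ∈ frontier C → x ∈ C ∧ x ∉ interior C := by
    intro C hC x hx; rwa [hC.isClosed.frontier_eq] at hx
  apply Subset.antisymm
  · intro y hy
    have hy0 : y ≠ 0 ∨ y = 0 := ne_or_eq y 0
    rcases hy0 with hy0 | rfl
    swap
    · exact interior_subset hE0
    obtain ⟨R, hR0, hR⟩ := hD.isBounded.exists_pos_norm_le
    have hny : 0 < ‖y‖ := norm_pos_iff.2 hy0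
    have hout : (R / ‖y‖ + 1) • y ∉ D := by
      intro hcon
      have := hR _ hcon
      rw [norm_smul, Real.norm_of_nonneg (by positivity), add_mul, div_mul_cancel₀ _ hny.ne'] at this
      linarith
    have h1 : 1 ≤ R / ‖y‖ + 1 := by
      have : 0 ≤ R / ‖y‖ := by positivity
      linarith
    obtain ⟨s, hs, hsf⟩ := exists_smul_mem_frontier h1 (by simpa using hy) hout
    have hsE := (hfr hE (h hsf)).1
    have hs0 : 0 < s := by linarith [hs.1]
    have := hEc hsE (interior_subset hE0) (a := 1 / s) (b := 1 - 1 / s) (by positivity)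
      (by rw [sub_nonneg]; exact (div_le_one hs0).2 hs.1) (by ring)
    rwa [smul_smul, one_div_mul_cancel hs0.ne', one_smul, smul_zero, add_zero] at this
  · intro y hy
    by_contra hyD
    obtain ⟨s, hs, hsf⟩ := exists_smul_mem_frontier (y := y) zero_le_one
      (by simpa using interior_subset hD0) (by simpa using hyD)
    have hs1 : s < 1 := by
      refine lt_of_le_of_ne hs.2 fun h => ?_
      rw [h, one_smul] at hsf
      exact hyD (hfr hD hsf).1
    exact (hfr hE (h hsf)).2 (smul_mem_interior_of_zero_mem hEc hE0 hy hs.1 hs1)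

/-- The covariogram is positive inside the difference body and vanishes outside it. Testing at `(1 -
ε) • x` and `(1 + ε) • x` shows that a boundary point `x` for `K` is one for `H`. -/
lemma differenceBody_eq_of_coincide_frontier {K H : Set Plane} (hK : IsCompact K)
    (hKc : Convex ℝ K) (hKi : (interior K).Nonempty) (hH : IsCompact H) (hHc : Convex ℝ H)
    (hHi : (interior H).Nonempty)
    (h : ∀ x ∈ frontier (K - K), ∀ᶠ y in 𝓝 x, covariogram K y = covariogram H y) :
    K - K = H - H := by
  have hD : IsCompact (K - K) := isCompact_sub hK hK
  have hE : IsCompact (H - H) := isCompact_sub hH hH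
  have hD0 := zero_mem_interior_sub_of_nonempty hKi
  have hE0 := zero_mem_interior_sub_of_nonempty hHi
  refine eq_of_frontier_subset_frontier hD hD0 hE (hHc.sub hHc) hE0 fun x hx => ?_
  have hx' := hx
  rw [hD.isClosed.frontier_eq] at hx'
  have h1 := eventually_nhds_iff.1 (h x hx)
  obtain ⟨U, hU, hUo, hxU⟩ := h1
  rw [hE.isClosed.frontier_eq]
  constructor
  · have ht : Filter.Tendsto (fun ε : ℝ => x + ε • (-x)) (𝓝[>] 0) (𝓝 x) := by
      have h : Continuous fun ε : ℝ => x + ε • (-x) := by fun_prop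
      simpa using (h.tendsto 0).mono_left (nhdsWithin_le_nhds (s := Ioi 0))
    refine hE.isClosed.mem_of_tendsto ht ?_
    have e2 : ∀ᶠ ε : ℝ in 𝓝[>] 0, ε < 1 := nhdsWithin_le_nhds (eventually_lt_nhds zero_lt_one)
    filter_upwards [eventually_add_smul_mem hUo hxU (-x), e2, self_mem_nhdsWithin] with ε h1 h2 h3
    have h3 : 0 < ε := h3
    have : x + ε • (-x) = (1 - ε) • x := by module
    rw [this] at h1 ⊢
    have hi := smul_mem_interior_of_zero_mem (hKc.sub hKc) hD0 hx'.1
      (show 0 ≤ 1 - ε by linarith) (by linarith)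
    apply mem_sub_of_covariogram_pos
    rw [← hU _ h1]
    exact covariogram_pos hK hKc hKi hi
  · intro hcon
    obtain ⟨ε, ⟨h1, h2⟩, h3⟩ := (((eventually_add_smul_mem hUo hxU x).and
      (eventually_add_smul_mem isOpen_interior hcon x)).and self_mem_nhdsWithin).exists
    have h3 : 0 < ε := h3
    have hpos := covariogram_pos hH hHc hHi h2
    rw [← hU _ h1] at hpos
    have hm := mem_sub_of_covariogram_pos hpos
    have := smul_mem_interior_of_zero_mem (hKc.sub hKc) hD0 hm (s := 1 / (1 + ε))
      (by positivity) ((div_lt_one (by linarith)).2 (by linarith))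
    apply hx'.2
    convert this using 1
    rw [show x + ε • x = (1 + ε) • x by module, smul_smul, one_div_mul_cancel (by linarith), one_smul]

lemma covariogram_zero_sub {K : Set Plane} (hK : IsCompact K) (x : Plane) :
    covariogram K 0 - covariogram K x = volume.real (K \ (x +ᵥ K)) := by
  have := measureReal_inter_add_sdiff (μ := volume) (s := K)
    (measurableSet_vadd hK.measurableSet x) (volume_ne_top_of_compact hK)
  have h0 : covariogram K 0 = volume.real K := by simp [covariogram]
  rw [h0, covariogram]; linarith

/-- The one-sided derivative of the covariogram at the origin is minus the width. -/
lemma tendsto_covariogram_slope {K : Set Plane} (hK : IsCompact K) (hKc : Convex ℝ K)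
    (hKi : (interior K).Nonempty) {ψ : ℝ} {p q : Plane} (hp : p ∈ K) (hq : q ∈ K)
    (hpm : ∀ w ∈ K, dot (unitVec ψ) w ≤ dot (unitVec ψ) p)
    (hqm : ∀ w ∈ K, dot (unitVec ψ) q ≤ dot (unitVec ψ) w) :
    Filter.Tendsto (fun t : ℝ => (covariogram K 0 - covariogram K (t • tangentVec ψ)) / t)
      (𝓝[>] 0) (𝓝 (dot (unitVec ψ) p - dot (unitVec ψ) q)) := by
  obtain ⟨R, hR0, hR⟩ := hK.isBounded.exists_pos_norm_le
  set M := dot (unitVec ψ) p with hM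
  set m := dot (unitVec ψ) q with hm
  have hmM : m ≤ M := hpm q hq
  -- The difference quotient is the integral of `min ℓ t / t`, where `ℓ` is the length of the
  -- section. The integrand tends to 1 on lines meeting the interior and to 0 on lines missing `K`.
  have hlim : Filter.Tendsto
      (fun t : ℝ => ∫ s, min (volume.real (lineSection K ψ s)) t / t) (𝓝[>] 0)
      (𝓝 (∫ s, (Ioo m M).indicator (fun _ => (1 : ℝ)) s)) := by
    refine tendsto_integral_filter_of_dominated_convergence
      ((Icc (-R) R).indicator fun _ => 1) ?_ ?_
      ((integrable_indicator_iff measurableSet_Icc).2 (integrableOn_const (by simp))) ?_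
    · refine Filter.Eventually.of_forall fun t => ?_
      exact (((measurable_volume_lineSection ψ hK.measurableSet).ennreal_toReal.min
        measurable_const).div_const t).aestronglyMeasurable
    · filter_upwards [self_mem_nhdsWithin] with t ht
      have ht : 0 < t := ht
      refine Filter.Eventually.of_forall fun s => ?_
      rw [Real.norm_of_nonneg (div_nonneg (le_min measureReal_nonneg ht.le) ht.le)]
      by_cases hs : s ∈ Icc (-R) R
      · rw [indicator_of_mem hs]
        exact (div_le_one ht).2 (min_le_right _ _)
      · rw [lineSection_eq_empty ψ hR hs]; simp [ht.le, indicator_of_notMem hs]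
    · have hnull : ∀ᵐ s : ℝ, s ≠ m ∧ s ≠ M :=
        (Measure.ae_ne volume m).and (Measure.ae_ne volume M)
      filter_upwards [hnull] with s hs
      by_cases h : s ∈ Ioo m M
      · rw [indicator_of_mem h]
        have hpos : 0 < volume.real (lineSection K ψ s) := by
          have hcl : closure (interior K) = K := by
            rw [hKc.closure_interior_eq_closure_of_nonempty_interior hKi, hK.isClosed.closure_eq]
          have hcd : Continuous fun y => dot (unitVec ψ) y := by fun_prop
          obtain ⟨a, ha, hai⟩ := mem_closure_iff.1 (hcl.symm ▸ hp) {y | s < dot (unitVec ψ) y}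
            (isOpen_lt continuous_const hcd) h.2
          obtain ⟨b, hb, hbi⟩ := mem_closure_iff.1 (hcl.symm ▸ hq) {y | dot (unitVec ψ) y < s}
            (isOpen_lt hcd continuous_const) h.1
          obtain ⟨y, hy, hys⟩ := hKc.interior.isPreconnected.intermediate_value hbi hai
            hcd.continuousOn ⟨le_of_lt hb, le_of_lt ha⟩
          have hyd := frame_decomp ψ y
          simp only at hys
          rw [hys] at hyd
          have hco : Continuous fun r : ℝ => s • unitVec ψ + r • tangentVec ψ := by fun_prop
          have hop : IsOpen ((fun r : ℝ => s • unitVec ψ + r • tangentVec ψ) ⁻¹' interior K) :=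
            isOpen_interior.preimage hco
          have := hop.measure_pos volume ⟨dot (tangentVec ψ) y, by
            change s • unitVec ψ + _ ∈ interior K; rw [← hyd]; exact hy⟩
          exact ENNReal.toReal_pos (this.trans_le (measure_mono fun r hr =>
            interior_subset (s := K) hr)).ne' (volume_lineSection_lt_top ψ hR s).ne
        refine tendsto_const_nhds.congr' ?_
        filter_upwards [self_mem_nhdsWithin, nhdsWithin_le_nhds (eventually_lt_nhds hpos)]
          with t ht1 ht2
        rw [min_eq_right ht2.le, div_self (ne_of_gt ht1)]
      · rw [indicator_of_notMem h]
        have : lineSection K ψ s = ∅ := by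
          rw [eq_empty_iff_forall_notMem]
          intro r hr
          have h1 := hpm _ hr
          have h2 := hqm _ hr
          rw [dot_frame] at h1 h2
          exact h ⟨lt_of_le_of_ne h2 hs.1.symm, lt_of_le_of_ne h1 hs.2⟩
        rw [this]
        refine tendsto_const_nhds.congr' ?_
        filter_upwards [self_mem_nhdsWithin] with t ht
        have ht : 0 < t := ht
        simp [ht.le]
  rw [integral_indicator measurableSet_Ioo, setIntegral_const,
    Real.volume_real_Ioo_of_le hmM, smul_eq_mul, mul_one] at hlim
  refine hlim.congr' ?_
  filter_upwards [self_mem_nhdsWithin] with t ht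
  rw [covariogram_zero_sub hK, volumeReal_diff_vadd hK hKc ψ (le_of_lt ht), integral_div]

/-- The width is the support function of the difference body, so a point of `H - H` outside `K - K`
would be separated by a direction in which the widths differ. -/
lemma sub_subset_sub_of_width_le {K H : Set Plane} (hK : IsCompact K) (hKc : Convex ℝ K)
    (hKn : K.Nonempty) (hH : IsCompact H) (hHn : H.Nonempty)
    (h : ∀ ψ, ∀ p ∈ K, ∀ q ∈ K, ∀ p' ∈ H, ∀ q' ∈ H,
      (∀ w ∈ K, dot (unitVec ψ) w ≤ dot (unitVec ψ) p) →
      (∀ w ∈ K, dot (unitVec ψ) q ≤ dot (unitVec ψ) w) →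
      (∀ w ∈ H, dot (unitVec ψ) w ≤ dot (unitVec ψ) p') →
      (∀ w ∈ H, dot (unitVec ψ) q' ≤ dot (unitVec ψ) w) →
      dot (unitVec ψ) p' - dot (unitVec ψ) q' = dot (unitVec ψ) p - dot (unitVec ψ) q) :
    H - H ⊆ K - K := by
  rintro y ⟨a, ha, b, hb, hab⟩
  by_contra hy
  obtain ⟨f, u, hf, hu⟩ := geometric_hahn_banach_closed_point (hKc.sub hKc)
    (isCompact_sub hK hK).isClosed hy
  obtain ⟨n, hn⟩ := clm_eq_dot f
  obtain ⟨ψ, -, hψ⟩ := exists_polar n 0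
  have hc : Continuous fun w => dot (unitVec ψ) w := by fun_prop
  obtain ⟨p, hp, hpm⟩ := hK.exists_isMaxOn hKn hc.continuousOn
  obtain ⟨q, hq, hqm⟩ := hK.exists_isMinOn hKn hc.continuousOn
  obtain ⟨p', hp', hpm'⟩ := hH.exists_isMaxOn hHn hc.continuousOn
  obtain ⟨q', hq', hqm'⟩ := hH.exists_isMinOn hHn hc.continuousOn
  have e := h ψ p hp q hq p' hp' q' hq' (fun w hw => hpm hw) (fun w hw => hqm hw)
    (fun w hw => hpm' hw) (fun w hw => hqm' hw)
  have h1 := hf _ ⟨p, hp, q, hq, rfl⟩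
  have h2 : f y ≤ f (p - q) := by
    rw [hn, hn, hψ]
    have e' : ∀ y, dot (‖n‖ • unitVec ψ) y = ‖n‖ * dot (unitVec ψ) y := by
      intro y; simp [dot]; ring
    rw [e', e']
    refine mul_le_mul_of_nonneg_left ?_ (norm_nonneg _)
    have h3 := hpm' ha
    have h4 := hqm' hb
    simp only [mem_ofPred_eq] at h3 h4
    rw [← hab, dot_sub, dot_sub]; linarith
  simp only at h1
  linarith

lemma differenceBody_eq_of_coincide_zero {K H : Set Plane} (hK : IsCompact K)
    (hKc : Convex ℝ K) (hKi : (interior K).Nonempty) (hH : IsCompact H) (hHc : Convex ℝ H)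
    (hHi : (interior H).Nonempty)
    (h : ∀ᶠ y in 𝓝 0, covariogram K y = covariogram H y) : K - K = H - H := by
  have key : ∀ ψ, ∀ p ∈ K, ∀ q ∈ K, ∀ p' ∈ H, ∀ q' ∈ H,
      (∀ w ∈ K, dot (unitVec ψ) w ≤ dot (unitVec ψ) p) →
      (∀ w ∈ K, dot (unitVec ψ) q ≤ dot (unitVec ψ) w) →
      (∀ w ∈ H, dot (unitVec ψ) w ≤ dot (unitVec ψ) p') →
      (∀ w ∈ H, dot (unitVec ψ) q' ≤ dot (unitVec ψ) w) →
      dot (unitVec ψ) p' - dot (unitVec ψ) q' = dot (unitVec ψ) p - dot (unitVec ψ) q := by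
    intro ψ p hp q hq p' hp' q' hq' h1 h2 h3 h4
    refine tendsto_nhds_unique (tendsto_covariogram_slope hH hHc hHi hp' hq' h3 h4) ?_
    refine (tendsto_covariogram_slope hK hKc hKi hp hq h1 h2).congr' ?_
    have ht : Filter.Tendsto (fun t : ℝ => t • tangentVec ψ) (𝓝[>] 0) (𝓝 0) := by
      have h : Continuous fun t : ℝ => t • tangentVec ψ := by fun_prop
      simpa using (h.tendsto 0).mono_left (nhdsWithin_le_nhds (s := Ioi 0))
    filter_upwards [ht.eventually h] with t ht
    rw [ht, h.self_of_nhds]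
  have hKn := hKi.mono interior_subset
  have hHn := hHi.mono interior_subset
  exact Subset.antisymm
    (sub_subset_sub_of_width_le hH hHc hHn hK hKn fun ψ p hp q hq p' hp' q' hq' h1 h2 h3 h4 =>
      (key ψ p' hp' q' hq' p hp q hq h3 h4 h1 h2).symm)
    (sub_subset_sub_of_width_le hK hKc hKn hH hHn key)

/-- If the boundary of `H` contained distinct `x`, `y` on one support line with normal `n`, then for
a minimizer `q` of `dot n` both `x - q` and `y - q` would maximize `dot n` on `K - K`. By strict
convexity of `K` such a maximizer is unique. -/
lemma isStrictBody_of_sub_eq {K H : Set Plane} (hK : IsStrictBody K) (hH : IsCompact H)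
    (hHc : Convex ℝ H) (hHi : (interior H).Nonempty) (h : K - K = H - H) : IsStrictBody H := by
  refine ⟨hH, fun x hx y hy hne a b ha hb hab => ?_, hHi⟩
  by_contra hz
  set z := a • x + b • y with hzdef
  obtain ⟨f, hf⟩ := geometric_hahn_banach_open_point hHc.interior isOpen_interior hz
  obtain ⟨n, hn⟩ := clm_eq_dot f
  have hle : ∀ w ∈ H, dot n w ≤ dot n z := by
    intro w hw
    have hcl : closure (interior H) = H := by
      rw [hHc.closure_interior_eq_closure_of_nonempty_interior hHi, hH.isClosed.closure_eq]
    rw [← hcl] at hw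
    exact closure_minimal (fun a ha => by
      have := hf a ha; rw [hn, hn] at this; exact this.le)
      (isClosed_le (by fun_prop) continuous_const : IsClosed {w | dot n w ≤ dot n z}) hw
  have hn0 : n ≠ 0 := by
    rintro rfl
    obtain ⟨a, ha⟩ := hHi
    have := hf a ha
    rw [hn, hn] at this
    simp [dot] at this
  have hzx : dot n z = a * dot n x + b * dot n y := by rw [hzdef]; simp
  have hx' := hle x hx
  have hy' := hle y hy
  have hxe : dot n x = dot n z := by
    by_contra hcon
    have h1 : a * dot n x < a * dot n z := mul_lt_mul_of_pos_left (lt_of_le_of_ne hx' hcon) ha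
    have h2 : b * dot n y ≤ b * dot n z := mul_le_mul_of_nonneg_left hy' hb.le
    have h3 : a * dot n z + b * dot n z = dot n z := by rw [← add_mul, hab, one_mul]
    linarith
  have hye : dot n y = dot n z := by
    by_contra hcon
    have h1 : b * dot n y < b * dot n z := mul_lt_mul_of_pos_left (lt_of_le_of_ne hy' hcon) hb
    have h3 : a * dot n z + b * dot n z = dot n z := by rw [← add_mul, hab, one_mul]
    rw [hxe] at hzx
    linarith
  obtain ⟨q, hq, hqm⟩ := hH.exists_isMinOn ⟨x, hx⟩
    (by fun_prop : Continuous fun w => dot n w).continuousOn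
  have hmaxD : ∀ v ∈ K - K, dot n v ≤ dot n z - dot n q := by
    intro v hv
    rw [h] at hv
    obtain ⟨c, hc, d, hd, rfl⟩ := hv
    have h1 := hle c hc
    have h2 := hqm hd
    simp only [mem_ofPred_eq] at h2
    rw [dot_sub]; linarith
  obtain ⟨k₁, hk₁, k₂, hk₂, e⟩ : x - q ∈ K - K := h ▸ ⟨x, hx, q, hq, rfl⟩
  obtain ⟨k₁', hk₁', k₂', hk₂', e'⟩ : y - q ∈ K - K := h ▸ ⟨y, hy, q, hq, rfl⟩
  simp only at e e'
  have d1 := congrArg (dot n) e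
  have d2 := congrArg (dot n) e'
  simp only [dot_sub] at d1 d2
  have m1 := hmaxD _ ⟨k₁', hk₁', k₂, hk₂, rfl⟩
  have m2 := hmaxD _ ⟨k₁, hk₁, k₂', hk₂', rfl⟩
  simp only [dot_sub] at m1 m2
  have e1 : k₁ = k₁' := eq_of_isMax_dot hK hn0 hk₁ hk₁' (fun w hw => by
    have := hmaxD _ ⟨w, hw, k₂, hk₂, rfl⟩
    simp only [dot_sub] at this; linarith) (by linarith)
  have e2 : k₂ = k₂' := eq_of_isMax_dot hK (neg_ne_zero.2 hn0) hk₂ hk₂' (fun w hw => by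
    have := hmaxD _ ⟨k₁, hk₁, w, hw, rfl⟩
    simp only [dot_sub, neg_dot] at this ⊢; linarith) (by simp only [neg_dot]; linarith)
  apply hne
  have : x - q = y - q := by rw [← e, ← e', e1, e2]
  simpa using this

/-- Both sums are the support point of the common difference body. Hence equality of support points
of `K` and `H` at `θ` is equivalent to equality for `-K` and `-H`. -/
lemma supportPt_add_neg_eq {K H : Set Plane} (hK : IsStrictBody K) (hH : IsStrictBody H)
    (h : K - K = H - H) (θ : ℝ) :
    supportPt H θ + supportPt (-H) θ = supportPt K θ + supportPt (-K) θ := by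
  have key : ∀ {A B : Set Plane}, IsStrictBody A → IsStrictBody B → A - A = B - B →
      dot (unitVec θ) (supportPt A θ) + dot (unitVec θ) (supportPt (-A) θ) ≤
        dot (unitVec θ) (supportPt B θ) + dot (unitVec θ) (supportPt (-B) θ) := by
    intro A B hA hB hAB
    obtain ⟨c, hc, d, hd, e⟩ : supportPt A θ - -supportPt (-A) θ ∈ B - B :=
      hAB ▸ ⟨_, supportPt_mem hA θ, _, supportPt_mem hA.neg θ, rfl⟩
    have e := congrArg (dot (unitVec θ)) e
    simp only [dot_sub, dot_neg] at e
    have h1 := dot_le_supportPt hB θ hc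
    have h2 := dot_le_supportPt hB.neg θ (w := -d) (by simpa using hd)
    rw [dot_neg] at h2
    linarith
  have heq := le_antisymm (key hK hH h) (key hH hK h.symm)
  obtain ⟨c, hc, d, hd, e⟩ : supportPt K θ - -supportPt (-K) θ ∈ H - H :=
    h ▸ ⟨_, supportPt_mem hK θ, _, supportPt_mem hK.neg θ, rfl⟩
  simp only at e
  have ed := congrArg (dot (unitVec θ)) e
  simp only [dot_sub, dot_neg] at ed
  have h1 := dot_le_supportPt hH θ hc
  have h2 := dot_le_supportPt hH.neg θ (w := -d) (by simpa using hd)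
  rw [dot_neg] at h2
  have e1 : c = supportPt H θ := eq_supportPt hH hc (by linarith)
  have e2 : -d = supportPt (-H) θ := eq_supportPt hH.neg (by simpa using hd)
    (by rw [dot_neg]; linarith)
  rw [← e1, ← e2, ← sub_eq_add_neg, e, sub_neg_eq_add]

lemma supportPt_add_mem_frontier {K : Set Plane} (hK : IsStrictBody K) (θ : ℝ) :
    supportPt K θ + supportPt (-K) θ ∈ frontier (K - K) := by
  rw [(isCompact_sub hK.isCompact hK.isCompact).isClosed.frontier_eq]
  refine ⟨⟨_, supportPt_mem hK θ, _, supportPt_mem hK.neg θ, by simp⟩, fun hi => ?_⟩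
  obtain ⟨w, ⟨c, hc, d, hd, e⟩, hlt⟩ := exists_dot_lt_of_mem_interior hi (unitVec_ne_zero θ)
  have h1 := dot_le_supportPt hK θ hc
  have h2 := dot_le_supportPt hK.neg θ (w := -d) (by simpa using hd)
  simp only at e
  rw [← e, dot_add, dot_sub] at hlt
  rw [dot_neg] at h2
  linarith

/-! ### From covariograms to gaps. -/

/-- The information on `H` extracted from the covariogram data. -/
structure GapData (K H : Set Plane) : Prop where
  body_left : IsStrictBody K
  body_right : IsStrictBody H
  sub_eq : K - K = H - H
  small : ∀ θ, ∀ᶠ x : ℝ × ℝ in 𝓝[>] 0 ×ˢ 𝓝 θ,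
    chordGap K (x.1 • tangentVec x.2) = chordGap H (x.1 • tangentVec x.2)
  midpoints : ∀ v : Plane, v ≠ 0 → v ∈ interior (K - K) →
    -chordGap K v ∈ symmetryMidpoints K → ∀ᶠ v' in 𝓝 v, chordGap K v' = chordGap H v'

lemma gapData_of_coincide {K H : Set Plane} (hK : IsStrictBody K) (hH : IsCompact H)
    (hHc : Convex ℝ H) (hHi : (interior H).Nonempty)
    (hKH : CovariogramsCoincideNear K H
          (symmetryMidpoints K ∪ frontier (differenceBody K)) ∨
        CovariogramsCoincideNear K H (symmetryMidpoints K ∪ {0})) : GapData K H := by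
  have hsym : ∀ x ∈ symmetryMidpoints K, ∀ᶠ y in 𝓝 x, covariogram K y = covariogram H y := by
    intro x hx
    rcases hKH with h | h
    · exact (eventually_nhdsSet_iff_forall.1 h) x (.inl hx)
    · exact (eventually_nhdsSet_iff_forall.1 h) x (.inl hx)
  have hsub : K - K = H - H := by
    rcases hKH with h | h
    · exact differenceBody_eq_of_coincide_frontier hK.isCompact hK.convex hK.nonempty_interior
        hH hHc hHi fun x hx => (eventually_nhdsSet_iff_forall.1 h) x (.inr hx)
    · exact differenceBody_eq_of_coincide_zero hK.isCompact hK.convex hK.nonempty_interior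
        hH hHc hHi ((eventually_nhdsSet_iff_forall.1 h) 0 (.inr rfl))
  have hHs := isStrictBody_of_sub_eq hK hH hHc hHi hsub
  have htrans : ∀ x, (∀ᶠ y in 𝓝 x, covariogram K y = covariogram H y) →
      ∀ᶠ y in 𝓝 x, y ≠ 0 → y ∈ interior (K - K) → chordGap K y = chordGap H y := by
    intro x hx
    obtain ⟨U, hU, hUo, hxU⟩ := eventually_nhds_iff.1 hx
    filter_upwards [hUo.mem_nhds hxU] with y hy hy0 hyi
    exact chordGap_eq_of_covariogram_eq hK hHs hsub hUo hU hy hy0 hyi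
  -- By the involution, equality of gaps at `-chordGap K v` gives equality at `v`.
  have hback : ∀ v, v ≠ 0 → v ∈ interior (K - K) →
      (-chordGap K v ≠ 0 → -chordGap K v ∈ interior (K - K) →
        chordGap K (-chordGap K v) = chordGap H (-chordGap K v)) →
      chordGap K v = chordGap H v := by
    intro v hv0 hv h
    refine chordGap_eq_of_chordGap_mem hK hHs hsub (U := {-chordGap K v}) ?_ hv0 hv rfl
    rintro x rfl h1 h2
    exact h h1 h2
  have hint0 := zero_mem_interior_sub_self hK
  refine ⟨hK, hHs, hsub, fun θ => ?_, fun v hv0 hv hm => ?_⟩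
  · have ht := tendsto_smul_tangentVec θ
    have hne : ∀ᶠ x : ℝ × ℝ in 𝓝[>] 0 ×ˢ 𝓝 θ, x.1 • tangentVec x.2 ≠ 0 := by
      have : ∀ᶠ x : ℝ × ℝ in 𝓝[>] 0 ×ˢ 𝓝 θ, 0 < x.1 :=
        Filter.Eventually.prod_inl (p := fun x : ℝ => 0 < x) self_mem_nhdsWithin _
      filter_upwards [this] with x hx
      exact smul_ne_zero hx.ne' (tangentVec_ne_zero _)
    have hi := ht.eventually (isOpen_interior.mem_nhds hint0)
    rcases hKH with h | h
    -- Short vectors have gaps close to the boundary of the difference body, where the covariograms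
    -- are known to agree; `hback` carries the equality back.
    · have hfr := supportPt_add_mem_frontier hK (θ + Real.pi)
      have hg : Filter.Tendsto (fun x : ℝ × ℝ => -chordGap K (x.1 • tangentVec x.2))
          (𝓝[>] 0 ×ˢ 𝓝 θ) (𝓝 (supportPt K (θ + Real.pi) + supportPt (-K) (θ + Real.pi))) := by
        have e : supportPt K (θ + Real.pi) + supportPt (-K) (θ + Real.pi)
            = -(supportPt K θ + supportPt (-K) θ) := by
          have h2 := supportPt_neg hK.neg θ
          rw [neg_neg] at h2
          rw [h2, supportPt_neg hK θ]; abel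
        rw [e]
        exact (tendsto_chordGap_zero hK θ).neg
      filter_upwards [hne, hi, hg.eventually (htrans _
        ((eventually_nhdsSet_iff_forall.1 h) _ (.inr hfr)))] with x h1 h2 h3
      exact hback _ h1 h2 h3
    · filter_upwards [hne, hi, ht.eventually (htrans 0
        ((eventually_nhdsSet_iff_forall.1 h) 0 (.inr rfl)))] with x h1 h2 h3
      exact h3 h1 h2
  · have hg := (tendsto_chordGap hK hv0 hv).neg
    filter_upwards [hg.eventually (htrans _ (hsym _ hm)),
      isOpen_ne.mem_nhds hv0, isOpen_interior.mem_nhds hv] with v' h1 h2 h3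
    exact hback _ h2 h3 h1

/-! ### Boundary regularity of a C²₊ body. -/

/-- The continuous linear functional `dot n`. -/
noncomputable def dotL (n : Plane) : Plane →L[ℝ] ℝ :=
  ⟨⟨⟨fun y => dot n y, fun y z => dot_add _ y z⟩, fun r y => by simp⟩, by fun_prop⟩

@[simp] lemma dotL_apply (n y : Plane) : dotL n y = dot n y := rfl

lemma contDiffAt_deriv {ψ : ℝ → ℝ} {x : ℝ} (h : ContDiffAt ℝ 2 ψ x) :
    ContDiffAt ℝ 1 (deriv ψ) x := by
  have h1 := (h.fderiv_right (m := 1) (by norm_num)).clm_apply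
    (contDiffAt_const (c := (1 : ℝ)))
  exact h1.congr_of_eventuallyEq (Filter.Eventually.of_forall fun y => 
    fderiv_apply_one_eq_deriv.symm)

/-- Near a boundary point, the level curve of a function with nonzero differential is tangent to
the supporting line of a convex set of which it is the boundary. -/
lemma fderiv_tangent_eq_zero {K U : Set Plane} {f : Plane → ℝ} {p : Plane} {θ : ℝ}
    (hK : IsClosed K) (hU : IsOpen U) (hpU : p ∈ U) (hf : ContDiffOn ℝ 2 f U)
    (hfr : frontier K ∩ U = {x ∈ U | f x = 0}) (hp : p ∈ frontier K)
    (hsupp : ∀ w ∈ K, dot (unitVec θ) w ≤ dot (unitVec θ) p) :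
    fderiv ℝ f p (tangentVec θ) = 0 := by
  by_contra ha
  set a := fderiv ℝ f p (tangentVec θ) with hadef
  set b := fderiv ℝ f p (unitVec θ) with hbdef
  have hfp : f p = 0 := by
    have : p ∈ {x ∈ U | f x = 0} := hfr ▸ ⟨hp, hpU⟩
    exact this.2
  have hd : DifferentiableAt ℝ f p :=
    (hf.contDiffAt (hU.mem_nhds hpU)).differentiableAt (by norm_num)
  -- With this slope `f` increases along `unitVec θ + M • tangentVec θ` and decreases along `unitVec
  -- θ - M • tangentVec θ`. Between two such small displacements `f` has a zero, a boundary point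
  -- strictly above the support line.
  set M := (|b| + 1) / a
  have hMa : M * a = |b| + 1 := div_mul_cancel₀ _ ha
  have hder : ∀ h : Plane, HasDerivAt (fun ε : ℝ => f (p + ε • h)) (fderiv ℝ f p h) 0 := by
    intro h
    have h1 : HasDerivAt (fun ε : ℝ => p + ε • h) h 0 := by
      simpa using ((hasDerivAt_id (0 : ℝ)).smul_const h).const_add p
    have h2 : HasFDerivAt f (fderiv ℝ f p) (p + (0 : ℝ) • h) := by simpa using hd.hasFDerivAt
    exact h2.comp_hasDerivAt 0 h1
  have hsign : ∀ h : Plane, 0 < fderiv ℝ f p h → ∀ᶠ ε : ℝ in 𝓝[>] 0, 0 < f (p + ε • h) := by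
    intro h hh
    have := (hasDerivAt_iff_tendsto_slope.1 (hder h)).eventually (eventually_gt_nhds hh)
    have := this.filter_mono (nhdsWithin_mono 0 (fun x (hx : 0 < x) => ne_of_gt hx))
    filter_upwards [this, self_mem_nhdsWithin] with ε h1 h2
    have h2 : 0 < ε := h2
    simp only [slope, vsub_eq_sub, sub_zero, zero_smul, add_zero, hfp, smul_eq_mul] at h1
    exact (mul_pos_iff_of_pos_left (inv_pos.2 h2)).1 h1
  have hsign' : ∀ h : Plane, fderiv ℝ f p h < 0 → ∀ᶠ ε : ℝ in 𝓝[>] 0, f (p + ε • h) < 0 := by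
    intro h hh
    have := (hasDerivAt_iff_tendsto_slope.1 (hder h)).eventually (eventually_lt_nhds hh)
    have := this.filter_mono (nhdsWithin_mono 0 (fun x (hx : 0 < x) => ne_of_gt hx))
    filter_upwards [this, self_mem_nhdsWithin] with ε h1 h2
    have h2 : 0 < ε := h2
    simp only [slope, vsub_eq_sub, sub_zero, zero_smul, add_zero, hfp, smul_eq_mul] at h1
    by_contra hcon
    exact absurd h1 (not_lt.2 (mul_nonneg (inv_pos.2 h2).le (not_lt.1 hcon)))
  have e1 := hsign (unitVec θ + M • tangentVec θ) (by
    rw [map_add, map_smul, smul_eq_mul, ← hadef, ← hbdef, hMa]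
    linarith [neg_abs_le b])
  have e2 := hsign' (unitVec θ - M • tangentVec θ) (by
    rw [map_sub, map_smul, smul_eq_mul, ← hadef, ← hbdef, hMa]
    linarith [le_abs_self b])
  obtain ⟨r, hr, hball⟩ := Metric.isOpen_iff.1 hU p hpU
  have e3 : ∀ h : Plane, ∀ᶠ ε : ℝ in 𝓝[>] 0, p + ε • h ∈ Metric.ball p r := fun h =>
    eventually_add_smul_mem Metric.isOpen_ball (Metric.mem_ball_self hr) h
  obtain ⟨ε, ⟨⟨⟨h1, h2⟩, h3⟩, h4⟩, h5⟩ := ((((e1.and e2).and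
    (e3 (unitVec θ + M • tangentVec θ))).and (e3 (unitVec θ - M • tangentVec θ))).and
      self_mem_nhdsWithin).exists
  have h5 : 0 < ε := h5
  have hseg := (convex_ball p r).segment_subset h4 h3
  obtain ⟨z, hz, hfz⟩ := (convex_segment _ _).isPreconnected.intermediate_value
    (left_mem_segment ℝ _ _) (right_mem_segment ℝ _ _)
    (hf.continuousOn.mono (hseg.trans hball)) ⟨h2.le, h1.le⟩
  have hzK : z ∈ frontier K := by
    have : z ∈ frontier K ∩ U := hfr ▸ ⟨hball (hseg hz), hfz⟩
    exact this.1
  obtain ⟨c, d, hc, hd, hcd, rfl⟩ := hz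
  have := hsupp _ (hK.frontier_subset hzK)
  simp only [dot_add, dot_sub, dot_smul, dot_unitVec_unitVec, dot_unitVec_tangentVec, sub_self,
    Real.sin_zero, Real.cos_zero, mul_zero, mul_one, sub_zero, add_zero] at this
  have e : c * (dot (unitVec θ) p + ε) + d * (dot (unitVec θ) p + ε)
      = dot (unitVec θ) p + ε := by rw [← add_mul, hcd, one_mul]
  linarith

/-- The boundary of a `C²₊` convex set is locally the graph of a `C²` function with positive second
derivative over its supporting line. -/
lemma exists_graph_of_isC2Plus {K : Set Plane} (hK : IsClosed K) (hC : IsC2Plus K) {p : Plane}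
    {θ : ℝ} (hp : p ∈ frontier K) (hsupp : ∀ w ∈ K, dot (unitVec θ) w ≤ dot (unitVec θ) p) :
    ∃ ψ : ℝ → ℝ, ContDiffAt ℝ 2 ψ 0 ∧ ψ 0 = 0 ∧ deriv ψ 0 = 0 ∧ 0 < deriv (deriv ψ) 0 ∧
      (∀ᶠ z in 𝓝 p, z ∈ frontier K →
        dot (unitVec θ) (z - p) = -ψ (dot (tangentVec θ) (z - p))) ∧
      (∀ᶠ s in 𝓝 (0 : ℝ), p + s • tangentVec θ - ψ s • unitVec θ ∈ frontier K) := by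
  obtain ⟨U, f, hU, hpU, hf, hfr, hdf, hd2⟩ := hC p hp
  have ht0 := fderiv_tangent_eq_zero hK hU hpU hf hfr hp hsupp
  have hfp : f p = 0 := by
    have : p ∈ {x ∈ U | f x = 0} := hfr ▸ ⟨hp, hpU⟩
    exact this.2
  set κ := fderiv ℝ f p (unitVec θ) with hκ
  have hdfe : ∀ y, fderiv ℝ f p y = κ * dot (unitVec θ) y := by
    intro y
    conv_lhs => rw [frame_decomp θ y]
    rw [map_add, map_smul, map_smul, ht0, smul_zero, add_zero, smul_eq_mul, mul_comm]
  have hκ0 : κ ≠ 0 := by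
    intro h
    apply hdf
    ext y
    rw [hdfe, h]; simp
  have hfc : ContDiffAt ℝ 2 f p := hf.contDiffAt (hU.mem_nhds hpU)
  -- Straightening coordinates: the tangential coordinate together with `f`. The local inverse on
  -- the line where the second coordinate is 0 parametrizes the boundary.
  let Φ : Plane → ℝ × ℝ := fun y => (dotL (tangentVec θ) (y - p), f y)
  have hΦc : ContDiffAt ℝ 2 Φ p := by
    refine ContDiffAt.prodMk ?_ hfc
    exact ((dotL (tangentVec θ)).contDiff.comp (contDiff_id.sub contDiff_const)).contDiffAt
  let L : Plane ≃L[ℝ] ℝ × ℝ := ContinuousLinearEquiv.equivOfInverse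
    ((dotL (tangentVec θ)).prod (κ • dotL (unitVec θ)))
    ((ContinuousLinearMap.fst ℝ ℝ ℝ).smulRight (tangentVec θ)
      + (ContinuousLinearMap.snd ℝ ℝ ℝ).smulRight (κ⁻¹ • unitVec θ))
    (fun y => by
      have := frame_decomp θ y
      simp only [ContinuousLinearMap.prod_apply, _root_.smul_apply, dotL_apply,
        _root_.add_apply, ContinuousLinearMap.smulRight_apply,
        ContinuousLinearMap.coe_fst', ContinuousLinearMap.coe_snd', smul_eq_mul, smul_smul]
      conv_rhs => rw [this]
      rw [show κ * dot (unitVec θ) y * κ⁻¹ = dot (unitVec θ) y by field_simp]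
      abel)
    (fun q => by
      ext
      · simp [dot_tangentVec_tangentVec, dot_tangentVec_unitVec]
      · simp [dot_unitVec_tangentVec, dot_unitVec_unitVec]; field_simp)
  have hΦd : HasFDerivAt Φ (L : Plane →L[ℝ] ℝ × ℝ) p := by
    have h1 : HasFDerivAt (fun y => dotL (tangentVec θ) (y - p)) (dotL (tangentVec θ)) p :=
      (dotL (tangentVec θ)).hasFDerivAt.comp p ((hasFDerivAt_id p).sub_const p)
    have h2 : HasFDerivAt f (κ • dotL (unitVec θ)) p := by
      have h3 := (hfc.differentiableAt (n := 2) (by norm_num)).hasFDerivAt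
      have h4 : fderiv ℝ f p = κ • dotL (unitVec θ) := by
        refine ContinuousLinearMap.ext fun y => ?_
        rw [hdfe]; rfl
      rwa [h4] at h3
    exact h1.prodMk h2
  have hn : (2 : WithTop ℕ∞) ≠ 0 := by norm_num
  set e := hΦc.toOpenPartialHomeomorph Φ hΦd hn with he
  have hpe : p ∈ e.source := hΦc.mem_toOpenPartialHomeomorph_source hΦd hn
  have hcoe : (e : Plane → ℝ × ℝ) = Φ := hΦc.toOpenPartialHomeomorph_coe hΦd hn
  have hΦp : Φ p = (0, 0) := by simp [Φ, hfp]
  have hginv : ContDiffAt ℝ 2 e.symm (0, 0) := by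
    have := hΦc.to_localInverse hΦd hn
    rw [hΦp] at this
    exact this
  have hg0 : e.symm (0, 0) = p := by
    rw [← hΦp, ← hcoe]; exact e.left_inv hpe
  have htar : ((0 : ℝ), (0 : ℝ)) ∈ e.target := by
    rw [← hΦp, ← hcoe]; exact e.map_source hpe
  let c : ℝ → Plane := fun s => e.symm (s, 0)
  have hcc : ContDiffAt ℝ 2 c 0 := by
    have h1 : ContDiffAt ℝ 2 (fun s : ℝ => (s, (0 : ℝ))) 0 :=
      contDiffAt_id.prodMk contDiffAt_const
    exact ContDiffAt.comp (0 : ℝ) (by exact hginv) h1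
  have hc0 : c 0 = p := hg0
  have hcs : ∀ᶠ s in 𝓝 (0 : ℝ), c s ∈ U ∧ Φ (c s) = (s, 0) := by
    have h1 : ∀ᶠ s in 𝓝 (0 : ℝ), c s ∈ U :=
      hcc.continuousAt.eventually (hU.mem_nhds (by rw [hc0]; exact hpU))
    have h2 : ∀ᶠ s in 𝓝 (0 : ℝ), ((s, 0) : ℝ × ℝ) ∈ e.target :=
      (by fun_prop : Continuous fun s : ℝ => ((s, 0) : ℝ × ℝ)).continuousAt.eventually
        (e.open_target.mem_nhds htar)
    filter_upwards [h1, h2] with s h1 h2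
    refine ⟨h1, ?_⟩
    rw [← hcoe]; exact e.right_inv h2
  set ψ : ℝ → ℝ := fun s => -dotL (unitVec θ) (c s - p) with hψdef
  have hψc : ContDiffAt ℝ 2 ψ 0 :=
    ((dotL (unitVec θ)).contDiff.contDiffAt.comp 0 (hcc.sub contDiffAt_const)).neg
  have hψ0 : ψ 0 = 0 := by simp [hψdef, hc0]
  have hceq : ∀ᶠ s in 𝓝 (0 : ℝ), c s = p + s • tangentVec θ - ψ s • unitVec θ := by
    filter_upwards [hcs] with s hs
    have h1 : dot (tangentVec θ) (c s - p) = s := congrArg Prod.fst hs.2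
    have := frame_decomp θ (c s - p)
    rw [h1] at this
    have e : ψ s = -dot (unitVec θ) (c s - p) := rfl
    rw [e, neg_smul, sub_neg_eq_add, add_assoc, add_comm (s • tangentVec θ), ← this]; abel
  have hcfr : ∀ᶠ s in 𝓝 (0 : ℝ), c s ∈ frontier K := by
    filter_upwards [hcs] with s hs
    have : c s ∈ frontier K ∩ U := hfr ▸ ⟨hs.1, congrArg Prod.snd hs.2⟩
    exact this.1
  have hψnn : ∀ᶠ s in 𝓝 (0 : ℝ), 0 ≤ ψ s := by
    filter_upwards [hcfr] with s hs
    have := hsupp _ (hK.frontier_subset hs)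
    simp only [hψdef, dotL_apply, dot_sub]; linarith
  have hψmin : IsLocalMin ψ 0 := by
    filter_upwards [hψnn] with s hs; rwa [hψ0]
  have hψd0 : deriv ψ 0 = 0 := hψmin.deriv_eq_zero
  have hψd1 : ContDiffAt ℝ 1 (deriv ψ) 0 := contDiffAt_deriv hψc
  have hψdiff : ∀ᶠ s in 𝓝 (0 : ℝ), DifferentiableAt ℝ ψ s := by
    filter_upwards [hψc.eventually (by norm_num)] with s hs
    exact hs.differentiableAt (by norm_num)
  have hψ2 : HasDerivAt (deriv ψ) (deriv (deriv ψ) 0) 0 :=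
    (hψd1.differentiableAt (by norm_num)).hasDerivAt
  -- Differentiating `f (c s) = 0` twice at 0 expresses `d²f(t, t)`, for the tangent vector `t`, as
  -- a multiple of the second derivative of `ψ`; the former is nonzero by the curvature hypothesis.
  have hne : deriv (deriv ψ) 0 ≠ 0 := by
    have hcd : ∀ᶠ s in 𝓝 (0 : ℝ), HasDerivAt c (tangentVec θ - deriv ψ s • unitVec θ) s := by
      filter_upwards [hceq.eventually_nhds, hψdiff] with s h1 h2
      have h3 : HasDerivAt (fun s => p + s • tangentVec θ - ψ s • unitVec θ)
          ((1 : ℝ) • tangentVec θ - deriv ψ s • unitVec θ) s :=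
        (((hasDerivAt_id s).smul_const _).const_add p).sub (h2.hasDerivAt.smul_const _)
      rw [one_smul] at h3
      exact h3.congr_of_eventuallyEq h1
    have hzero : ∀ᶠ s in 𝓝 (0 : ℝ),
        fderiv ℝ f (c s) (tangentVec θ - deriv ψ s • unitVec θ) = 0 := by
      have hz : ∀ᶠ s in 𝓝 (0 : ℝ), f (c s) = 0 := by
        filter_upwards [hcs] with s hs; exact congrArg Prod.snd hs.2
      filter_upwards [hz.eventually_nhds, hcd, hcs] with s h1 h2 h3
      have h4 : HasFDerivAt f (fderiv ℝ f (c s)) (c s) :=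
        ((hf.contDiffAt (hU.mem_nhds h3.1)).differentiableAt (by norm_num)).hasFDerivAt
      have h5 := h4.comp_hasDerivAt s h2
      have h6 : HasDerivAt (f ∘ c) 0 s :=
        (hasDerivAt_const s (0 : ℝ)).congr_of_eventuallyEq h1
      exact h5.unique h6
    have hcd0 : HasDerivAt c (tangentVec θ) 0 := by
      have := hcd.self_of_nhds
      rwa [hψd0, zero_smul, sub_zero] at this
    have hf2 : HasFDerivAt (fderiv ℝ f) (fderiv ℝ (fderiv ℝ f) p) (c 0) := by
      rw [hc0]
      exact ((hfc.fderiv_right (m := 1) (by norm_num)).differentiableAt (by norm_num)).hasFDerivAt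
    have h1 : HasDerivAt (fun s => fderiv ℝ f (c s)) (fderiv ℝ (fderiv ℝ f) p (tangentVec θ)) 0 :=
      hf2.comp_hasDerivAt 0 hcd0
    have h2 : HasDerivAt (fun s => tangentVec θ - deriv ψ s • unitVec θ)
        (-(deriv (deriv ψ) 0 • unitVec θ)) 0 := (hψ2.smul_const _).const_sub _
    have h3 := h1.clm_apply h2
    have h4 := h3.unique ((hasDerivAt_const (0 : ℝ) (0 : ℝ)).congr_of_eventuallyEq hzero)
    simp only [hψd0, zero_smul, sub_zero, hc0] at h4
    intro hcon
    rw [hcon, zero_smul, neg_zero, map_zero, add_zero] at h4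
    exact hd2 _ (tangentVec_ne_zero θ) ht0 h4
  refine ⟨ψ, hψc, hψ0, hψd0, ?_, ?_, ?_⟩
  -- A negative second derivative would make 0 a local maximum besides a local minimum, so `ψ` would
  -- vanish near 0.
  · by_contra hcon
    have hneg : deriv (deriv ψ) 0 < 0 := lt_of_le_of_ne (not_lt.1 hcon) hne
    have hmax := isLocalMax_of_deriv_deriv_neg hneg hψd0 hψc.continuousAt
    have hz : ψ =ᶠ[𝓝 0] fun _ => 0 := by
      filter_upwards [hmax, hψnn] with s h1 h2
      exact le_antisymm (by rwa [hψ0] at h1) h2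
    have := hz.deriv.deriv_eq
    simp only [deriv_const'] at this
    exact hne (by rw [this])
  · filter_upwards [hU.mem_nhds hpU, e.open_source.mem_nhds hpe] with z h1 h2 h3
    have hfz : f z = 0 := by
      have : z ∈ {x ∈ U | f x = 0} := hfr ▸ ⟨h3, h1⟩
      exact this.2
    have h4 : Φ z = (dot (tangentVec θ) (z - p), 0) := by
      simp only [Φ, hfz]; rfl
    have h5 : c (dot (tangentVec θ) (z - p)) = z := by
      change e.symm _ = z
      rw [← h4, ← hcoe]; exact e.left_inv h2
    simp only [hψdef, h5, dotL_apply, neg_neg]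
  · filter_upwards [hceq, hcfr] with s h1 h2
    rwa [← h1]

/-- A segment in the boundary lies on a support line, so the graph function over that line vanishes
near an inner point of the segment, against its positive second derivative. -/
lemma isStrictBody_of_isC2Plus {K : Set Plane} (hK : IsCompact K) (hKc : Convex ℝ K)
    (hKi : (interior K).Nonempty) (hC : IsC2Plus K) : IsStrictBody K := by
  refine ⟨hK, fun x hx y hy hne a b ha hb hab => ?_, hKi⟩
  by_contra hz
  set z := a • x + b • y with hzdef
  have hzK : z ∈ K := hKc hx hy ha.le hb.le hab
  obtain ⟨f, hf⟩ := geometric_hahn_banach_open_point hKc.interior isOpen_interior hz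
  obtain ⟨n, hn⟩ := clm_eq_dot f
  obtain ⟨θ, -, hnθ⟩ := exists_polar n 0
  have hn0 : n ≠ 0 := by
    rintro rfl
    obtain ⟨a, ha⟩ := hKi
    have := hf a ha
    rw [hn, hn] at this
    simp [dot] at this
  have e' : ∀ y, dot n y = ‖n‖ * dot (unitVec θ) y := by
    intro y; conv_lhs => rw [hnθ]
    simp [dot]; ring
  have hle : ∀ w ∈ K, dot (unitVec θ) w ≤ dot (unitVec θ) z := by
    intro w hw
    have hcl : closure (interior K) = K := by
      rw [hKc.closure_interior_eq_closure_of_nonempty_interior hKi, hK.isClosed.closure_eq]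
    rw [← hcl] at hw
    exact closure_minimal (fun a ha => by
      have := hf a ha; rw [hn, hn, e', e'] at this
      exact (lt_of_mul_lt_mul_left this (norm_nonneg _)).le)
      (isClosed_le (by fun_prop) continuous_const :
        IsClosed {w | dot (unitVec θ) w ≤ dot (unitVec θ) z}) hw
  have hfrz : ∀ w ∈ K, dot (unitVec θ) w = dot (unitVec θ) z → w ∈ frontier K := by
    intro w hw he
    rw [hK.isClosed.frontier_eq]
    refine ⟨hw, fun hi => ?_⟩
    obtain ⟨w', hw', hlt⟩ := exists_dot_lt_of_mem_interior hi (unitVec_ne_zero θ)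
    linarith [hle w' hw']
  obtain ⟨ψ, hψc, hψ0, hψd0, hpos, hgr, -⟩ :=
    exists_graph_of_isC2Plus hK.isClosed hC (hfrz z hzK rfl) hle
  have hzx : dot (unitVec θ) z = a * dot (unitVec θ) x + b * dot (unitVec θ) y := by
    rw [hzdef]; simp
  have hx' := hle x hx
  have hy' := hle y hy
  have h3 : a * dot (unitVec θ) z + b * dot (unitVec θ) z = dot (unitVec θ) z := by
    rw [← add_mul, hab, one_mul]
  have hxe : dot (unitVec θ) x = dot (unitVec θ) z := by
    by_contra hcon
    have h1 := mul_lt_mul_of_pos_left (lt_of_le_of_ne hx' hcon) ha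
    have h2 := mul_le_mul_of_nonneg_left hy' hb.le
    linarith
  have hye : dot (unitVec θ) y = dot (unitVec θ) z := by
    by_contra hcon
    have h1 := mul_lt_mul_of_pos_left (lt_of_le_of_ne hy' hcon) hb
    have h2 := mul_le_mul_of_nonneg_left hx' ha.le
    linarith
  set μ := dot (tangentVec θ) (x - y) with hμ
  have hxy : x - y = μ • tangentVec θ := by
    have := frame_decomp θ (x - y)
    rw [dot_sub, hxe, hye, sub_self, zero_smul, zero_add] at this
    exact this
  have hμ0 : μ ≠ 0 := by
    intro h; rw [h, zero_smul] at hxy; exact hne (sub_eq_zero.1 hxy)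
  have hzero : ψ =ᶠ[𝓝 0] fun _ => 0 := by
    have ht : Filter.Tendsto (fun s : ℝ => z + (s / μ) • (x - y)) (𝓝 0) (𝓝 z) := by
      have : Continuous fun s : ℝ => z + (s / μ) • (x - y) := by fun_prop
      simpa using this.tendsto 0
    have hsm : ∀ᶠ s in 𝓝 (0 : ℝ), |s / μ| < min a b := by
      have : Continuous fun s : ℝ => |s / μ| := by fun_prop
      exact this.continuousAt.eventually (eventually_lt_nhds (by simp [ha, hb]))
    filter_upwards [ht.eventually hgr, hsm] with s h1 h2
    rw [abs_lt, lt_min_iff] at h2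
    have h4 := min_le_left a b
    have h5 := min_le_right a b
    have hmem : z + (s / μ) • (x - y) ∈ K := by
      have := hKc hx hy (a := a + s / μ) (b := b - s / μ) (by linarith) (by linarith)
        (by linarith)
      convert this using 1
      rw [hzdef]; module
    have h6 := h1 (hfrz _ hmem (by simp [hxe, hye]))
    rw [add_sub_cancel_left, hxy, smul_smul, div_mul_cancel₀ _ hμ0, dot_smul, dot_smul,
      dot_unitVec_tangentVec, dot_tangentVec_tangentVec] at h6
    simp only [sub_self, Real.sin_zero, Real.cos_zero, mul_zero, mul_one] at h6
    linarith
  have := hzero.deriv.deriv_eq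
  simp only [deriv_const'] at this
  linarith

/-- `supportPt` is strictly differentiable with nonvanishing derivative. -/
lemma hasStrictDerivAt_supportPt {K : Set Plane} (hK : IsStrictBody K) (hC : IsC2Plus K)
    (θ : ℝ) : ∃ r : ℝ, 0 < r ∧ HasStrictDerivAt (supportPt K) (r • tangentVec θ) θ := by
  set p := supportPt K θ with hp
  obtain ⟨ψ, hψc, hψ0, hψd0, hpos, hgr, hgr'⟩ := exists_graph_of_isC2Plus hK.isClosed hC
    (supportPt_mem_frontier hK θ) (fun w hw => dot_le_supportPt hK θ hw)
  set m := deriv (deriv ψ) 0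
  have hcont := continuous_supportPt hK
  set s : ℝ → ℝ := fun α => dot (tangentVec θ) (supportPt K α - p) with hs
  have hsc : Continuous s := by fun_prop
  have hs0 : s θ = 0 := by simp [hs, hp]
  have hrep : ∀ᶠ α in 𝓝 θ,
      supportPt K α = p + s α • tangentVec θ - ψ (s α) • unitVec θ := by
    filter_upwards [hcont.continuousAt.eventually hgr] with α hα
    have h1 := hα (supportPt_mem_frontier hK α)
    have h2 := frame_decomp θ (supportPt K α - p)
    rw [← hp] at h1
    rw [h1, neg_smul] at h2
    have : supportPt K α = p + (supportPt K α - p) := by abel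
    rw [this]
    conv_lhs => rw [h2]
    simp only [hs]
    abel
  have hψdiff : ∀ᶠ x in 𝓝 (0 : ℝ), DifferentiableAt ℝ ψ x := by
    filter_upwards [hψc.eventually (by norm_num)] with x hx
    exact hx.differentiableAt (by norm_num)
  have hst : Filter.Tendsto s (𝓝 θ) (𝓝 0) := hs0 ▸ hsc.tendsto θ
  -- Maximality of the support point at `α` makes the derivative of `ψ` at `s α` equal to `tan (α -
  -- θ)`. So `s` is a local inverse of `θ + arctan ∘ deriv ψ`, and its strict derivative is the
  -- radius of curvature `m⁻¹`.
  have htan : ∀ᶠ α in 𝓝 θ, θ + Real.arctan (deriv ψ (s α)) = α := by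
    have hnear : ∀ᶠ α in 𝓝 θ, α ∈ Ioo (θ - Real.pi / 2) (θ + Real.pi / 2) :=
      Ioo_mem_nhds (by linarith [Real.pi_pos]) (by linarith [Real.pi_pos])
    filter_upwards [hrep, hst.eventually hψdiff, hst.eventually hgr'.eventually_nhds, hnear]
      with α h1 h2 h3 h4
    have hmax : IsLocalMax (fun x => Real.sin (α - θ) * x - Real.cos (α - θ) * ψ x) (s α) := by
      filter_upwards [h3] with x hx
      have := dot_le_supportPt hK α (hK.isClosed.frontier_subset hx)
      rw [h1] at this
      simp only [dot_add, dot_sub, dot_smul, dot_unitVec_unitVec, dot_unitVec_tangentVec,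
        ← hp] at this
      linarith
    have hd : HasDerivAt (fun x => Real.sin (α - θ) * x - Real.cos (α - θ) * ψ x)
        (Real.sin (α - θ) * 1 - Real.cos (α - θ) * deriv ψ (s α)) (s α) :=
      ((hasDerivAt_id _).const_mul _).sub (h2.hasDerivAt.const_mul _)
    have h0 := hmax.hasDerivAt_eq_zero hd
    have hcos : 0 < Real.cos (α - θ) :=
      Real.cos_pos_of_mem_Ioo ⟨by linarith [h4.1], by linarith [h4.2]⟩
    have : deriv ψ (s α) = Real.tan (α - θ) := by
      rw [Real.tan_eq_sin_div_cos, eq_div_iff hcos.ne']; linarith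
    rw [this, Real.arctan_tan (by linarith [h4.1]) (by linarith [h4.2])]; ring
  have hψ1 : ContDiffAt ℝ 1 (deriv ψ) 0 := contDiffAt_deriv hψc
  have hψ2 : HasStrictDerivAt (deriv ψ) m (s θ) := by
    rw [hs0]; exact hψ1.hasStrictDerivAt (by norm_num)
  have harc : HasStrictDerivAt (fun x => θ + Real.arctan (deriv ψ x)) m (s θ) := by
    have h1 := (Real.hasStrictDerivAt_arctan (deriv ψ (s θ))).comp (s θ) hψ2
    have h2 : 1 / (1 + deriv ψ (s θ) ^ 2) * m = m := by rw [hs0, hψd0]; norm_num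
    rw [h2] at h1
    exact h1.const_add θ
  have hsd : HasStrictDerivAt s m⁻¹ θ :=
    HasStrictDerivAt.of_local_left_inverse hsc.continuousAt harc hpos.ne' htan
  have hψs : HasStrictDerivAt (fun α => ψ (s α)) 0 θ := by
    have h1 : HasStrictDerivAt ψ 0 (s θ) := by
      have := hψc.hasStrictDerivAt (by norm_num)
      rw [hψd0] at this
      rwa [hs0]
    have h2 := h1.comp θ hsd
    rwa [zero_mul] at h2
  refine ⟨m⁻¹, inv_pos.2 hpos, ?_⟩
  have h1 : HasStrictDerivAt (fun α => p + s α • tangentVec θ - ψ (s α) • unitVec θ)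
      (m⁻¹ • tangentVec θ - (0 : ℝ) • unitVec θ) θ :=
    ((hsd.smul_const _).const_add p).sub (hψs.smul_const _)
  rw [zero_smul, sub_zero] at h1
  exact h1.congr_of_eventuallyEq (hrep.mono fun α h => h.symm)

lemma supportPt_eq_of_between {B : Set Plane} (hB : IsStrictBody B) {a b θ : ℝ}
    (hθ : θ ∈ Icc a b) (hba : b < a + Real.pi) (hab : a < b)
    (h : supportPt B a = supportPt B b) : supportPt B θ = supportPt B a := by
  symm
  apply eq_supportPt hB (supportPt_mem hB a)
  have hs : 0 < Real.sin (b - a) := Real.sin_pos_of_pos_of_lt_pi (by linarith) (by linarith)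
  have h1 : 0 ≤ Real.sin (b - θ) :=
    Real.sin_nonneg_of_nonneg_of_le_pi (by linarith [hθ.2]) (by linarith [hθ.1])
  have h2 : 0 ≤ Real.sin (θ - a) :=
    Real.sin_nonneg_of_nonneg_of_le_pi (by linarith [hθ.1]) (by linarith [hθ.2])
  have e1 := dot_unitVec_combo a b θ (supportPt B θ)
  have e2 := dot_unitVec_combo a b θ (supportPt B a)
  have i1 := mul_le_mul_of_nonneg_left (dot_le_supportPt hB a (supportPt_mem hB θ)) h1
  have i2 := mul_le_mul_of_nonneg_left (dot_le_supportPt hB b (supportPt_mem hB θ)) h2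
  rw [← h] at i2
  exact le_of_mul_le_mul_left (by linarith) hs

/-- Opposite normals never share a support point because the interior is nonempty, and normals more
than π apart are less than π apart the other way round. -/
lemma isSmoothBody_of_ne {B : Set Plane} (hB : IsStrictBody B)
    (h : ∀ a b, a < b → b < a + Real.pi → supportPt B a ≠ supportPt B b) : IsSmoothBody B := by
  intro a b hab
  set b' := toIcoMod Real.two_pi_pos a b with hb'
  have hmem := toIcoMod_mem_Ico Real.two_pi_pos a b
  rw [← hb'] at hmem
  have hu : unitVec b' = unitVec b := by
    have : b' = b - (toIcoDiv Real.two_pi_pos a b : ℤ) * (2 * Real.pi) := by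
      rw [← zsmul_eq_mul]; rfl
    rw [this]
    apply plane_ext
    · exact Real.cos_sub_int_mul_two_pi _ _
    · exact Real.sin_sub_int_mul_two_pi _ _
  rw [supportPt_congr hu.symm] at hab
  rw [← hu]
  rcases eq_or_lt_of_le hmem.1 with h0 | h0
  · rw [h0]
  exfalso
  rcases lt_trichotomy b' (a + Real.pi) with h1 | h1 | h1
  · exact h a b' h0 h1 hab
  · obtain ⟨o, ho⟩ := hB.nonempty_interior
    obtain ⟨w, hw, hlt⟩ := exists_dot_lt_of_mem_interior ho (unitVec_ne_zero a)
    have h2 := dot_le_supportPt hB a hw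
    have h3 := dot_le_supportPt hB b' (interior_subset ho)
    rw [h1, unitVec_add_pi, neg_dot, neg_dot, ← h1, ← hab] at h3
    linarith
  · exact h b' (a + 2 * Real.pi) hmem.2 (by linarith) (by rw [supportPt_add_two_pi, hab])

/-- A common support point at `a` and `b` would be the support point on all of `[a, b]`, and the
derivative would vanish there. -/
lemma isSmoothBody_of_deriv {B : Set Plane} (hB : IsStrictBody B)
    (h : ∀ θ, ∃ r : ℝ, 0 < r ∧ HasStrictDerivAt (supportPt B) (r • tangentVec θ) θ) :
    IsSmoothBody B := by
  refine isSmoothBody_of_ne hB fun a b hab hba he => ?_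
  set c := (a + b) / 2
  obtain ⟨r, hr, hd⟩ := h c
  have hz : supportPt B =ᶠ[𝓝 c] fun _ => supportPt B a := by
    filter_upwards [Ioo_mem_nhds (show a < c by simp only [c]; linarith)
      (show c < b by simp only [c]; linarith)] with x hx
    exact supportPt_eq_of_between hB ⟨hx.1.le, hx.2.le⟩ hba hab he
  have := hd.hasDerivAt.unique ((hasDerivAt_const c (supportPt B a)).congr_of_eventuallyEq hz)
  exact smul_ne_zero hr.ne' (tangentVec_ne_zero c) this

/-! ### Average slopes and trapezoid errors on small intervals. -/

/-- The filter of intervals `(α, β)`, `α < β`, shrinking to `0`. -/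
def smallIntervals : Filter (ℝ × ℝ) := 𝓝[{x | x.1 < x.2}] (0, 0)

lemma eventually_smallIntervals {P : ℝ × ℝ → Prop} :
    (∀ᶠ x in smallIntervals, P x) ↔
      ∃ η : ℝ, 0 < η ∧ ∀ α β, -η < α → α < β → β < η → P (α, β) := by
  rw [smallIntervals, eventually_nhdsWithin_iff, Metric.eventually_nhds_iff]
  constructor
  · rintro ⟨η, hη, h⟩
    refine ⟨η, hη, fun α β h1 h2 h3 => h ?_ h2⟩
    rw [Prod.dist_eq, Real.dist_0_eq_abs, Real.dist_0_eq_abs]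
    exact max_lt (abs_lt.2 ⟨h1, by linarith⟩) (abs_lt.2 ⟨by linarith, h3⟩)
  · rintro ⟨η, hη, h⟩
    refine ⟨η, hη, fun x hx hlt => ?_⟩
    rw [Prod.dist_eq, Real.dist_0_eq_abs, Real.dist_0_eq_abs, max_lt_iff, abs_lt, abs_lt] at hx
    exact h x.1 x.2 hx.1.1 hlt hx.2.2

instance : smallIntervals.NeBot := by
  rw [Filter.neBot_iff]
  intro h
  have : ∀ᶠ x in smallIntervals, False := by rw [h]; exact Filter.eventually_bot
  obtain ⟨η, hη, h⟩ := eventually_smallIntervals.1 this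
  exact h (-(η / 2)) (η / 2) (by linarith) (by linarith) (by linarith)

/-- The average slope of `s` on an interval. -/
noncomputable def avgSlope (s : ℝ → ℝ) (x : ℝ × ℝ) : ℝ := (s x.2 - s x.1) / (x.2 - x.1)

/-- The normalized error of the trapezoid rule for `s = g'` on an interval. -/
noncomputable def trapError (g s : ℝ → ℝ) (x : ℝ × ℝ) : ℝ :=
  (g x.2 - g x.1 - (x.2 - x.1) * (s x.1 + s x.2) / 2) / (x.2 - x.1) ^ 2

/-- The trapezoid rule is exact for affine integrands, so only the deviation of `s` from an affine
function contributes. -/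
lemma abs_trapError_le {g s : ℝ → ℝ} {α β M t : ℝ} (hαβ : α < β) (ht : 0 ≤ t)
    (hg : ∀ x ∈ Icc α β, HasDerivAt g (s x) x)
    (hs : ∀ x ∈ Icc α β, |s x - s α - M * (x - α)| ≤ t * (β - α)) :
    |trapError g s (α, β)| ≤ 2 * t := by
  have hΔ : 0 < β - α := by linarith
  have hd : ∀ x ∈ Icc α β, HasDerivWithinAt (fun x => g x - s α * (x - α) - M * (x - α) ^ 2 / 2)
      (s x - s α - M * (x - α)) (Icc α β) x := by
    intro x hx
    have h1 : HasDerivAt (fun x => x - α) 1 x := (hasDerivAt_id x).sub_const α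
    have h2 := ((hg x hx).sub (h1.const_mul (s α))).sub (((h1.pow 2).const_mul M).div_const 2)
    have e : s x - s α * 1 - M * (((2 : ℕ) : ℝ) * (x - α) ^ (2 - 1) * 1) / 2
        = s x - s α - M * (x - α) := by
      push_cast; ring
    exact (h2.congr_deriv e).hasDerivWithinAt
  have h3 := (convex_Icc α β).norm_image_sub_le_of_norm_hasDerivWithin_le hd
    (fun x hx => by rw [Real.norm_eq_abs]; exact hs x hx)
    (left_mem_Icc.2 hαβ.le) (right_mem_Icc.2 hαβ.le)
  rw [Real.norm_eq_abs, Real.norm_eq_abs, abs_of_pos hΔ] at h3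
  have h4 := hs β (right_mem_Icc.2 hαβ.le)
  rw [trapError, abs_div, abs_of_pos (pow_pos hΔ 2), div_le_iff₀ (pow_pos hΔ 2)]
  have e : g β - g α - (β - α) * (s α + s β) / 2
      = (g β - s α * (β - α) - M * (β - α) ^ 2 / 2
        - (g α - s α * (α - α) - M * (α - α) ^ 2 / 2))
        - (β - α) / 2 * (s β - s α - M * (β - α)) := by ring
  simp only
  rw [e]
  refine (abs_sub _ _).trans ?_
  rw [abs_mul, abs_of_pos (half_pos hΔ)]
  have h5 := mul_le_mul_of_nonneg_left h4 (half_pos hΔ).le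
  have h6 : 0 ≤ t * (β - α) ^ 2 := by positivity
  nlinarith

lemma HasStrictDerivAt.eventually_smallIntervals {s : ℝ → ℝ} {p : ℝ}
    (hs : HasStrictDerivAt s p 0) {c : ℝ} (hc : 0 < c) :
    ∃ η : ℝ, 0 < η ∧ ∀ x y, |x| < η → |y| < η → |s x - s y - p * (x - y)| ≤ c * |x - y| := by
  have h := hs.isLittleO.def hc
  rw [Metric.eventually_nhds_iff] at h
  obtain ⟨η, hη, h⟩ := h
  refine ⟨η, hη, fun x y hx hy => ?_⟩
  have := @h (x, y) (by
    rw [Prod.dist_eq, Real.dist_0_eq_abs, Real.dist_0_eq_abs]; exact max_lt hx hy)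
  simp only [ContinuousLinearMap.toSpanSingleton_apply, smul_eq_mul, Real.norm_eq_abs] at this
  rwa [mul_comm p]

lemma HasStrictDerivAt.tendsto_avgSlope {s : ℝ → ℝ} {p : ℝ} (hs : HasStrictDerivAt s p 0) :
    Filter.Tendsto (avgSlope s) smallIntervals (𝓝 p) := by
  rw [Metric.tendsto_nhds]
  intro c hc
  obtain ⟨η, hη, h⟩ := hs.eventually_smallIntervals (half_pos hc)
  refine _root_.eventually_smallIntervals.2 ⟨η, hη, fun α β h1 h2 h3 => ?_⟩
  have h4 := h β α (abs_lt.2 ⟨by linarith, h3⟩) (abs_lt.2 ⟨h1, by linarith⟩)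
  have hΔ : 0 < β - α := by linarith
  rw [Real.dist_eq, avgSlope]
  have e : (s β - s α) / (β - α) - p = (s β - s α - p * (β - α)) / (β - α) := by
    field_simp
  simp only
  rw [e, abs_div, div_lt_iff₀ (abs_pos.2 hΔ.ne')]
  refine h4.trans_lt ?_
  have := abs_pos.2 hΔ.ne'
  nlinarith

lemma HasStrictDerivAt.tendsto_trapError {g s : ℝ → ℝ} {p : ℝ} (hs : HasStrictDerivAt s p 0)
    (hg : ∀ x, HasDerivAt g (s x) x) :
    Filter.Tendsto (trapError g s) smallIntervals (𝓝 0) := by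
  rw [Metric.tendsto_nhds]
  intro c hc
  obtain ⟨η, hη, h⟩ := hs.eventually_smallIntervals (show 0 < c / 4 by linarith)
  refine _root_.eventually_smallIntervals.2 ⟨η, hη, fun α β h1 h2 h3 => ?_⟩
  rw [Real.dist_0_eq_abs]
  refine (abs_trapError_le (M := p) (t := c / 4) h2 (by linarith) (fun x _ => hg x)
    fun x hx => ?_).trans_lt (by linarith)
  refine (h x α (abs_lt.2 ⟨by linarith [hx.1], by linarith [hx.2]⟩)
    (abs_lt.2 ⟨h1, by linarith⟩)).trans ?_
  rw [abs_of_nonneg (by linarith [hx.1])]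
  have := hx.2
  nlinarith

lemma avgSlope_pos {s : ℝ → ℝ} (hs : StrictMono s) {x : ℝ × ℝ} (hx : x.1 < x.2) :
    0 < avgSlope s x := div_pos (sub_pos.2 (hs hx)) (sub_pos.2 hx)

/-- The mean of `s` is a value of `s` inside the interval, so it differs from the mean of the end
values by at most half the increment. -/
lemma abs_trapError_le_avgSlope {g s : ℝ → ℝ} (hs : Monotone s)
    (hg : ∀ x, HasDerivAt g (s x) x) {x : ℝ × ℝ} (hx : x.1 < x.2) :
    |trapError g s x| ≤ avgSlope s x / 2 := by
  obtain ⟨c, hc, he⟩ := exists_hasDerivAt_eq_slope g s hx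
    (fun y _ => (hg y).continuousAt.continuousWithinAt) (fun y _ => hg y)
  have hΔ : 0 < x.2 - x.1 := by linarith
  rw [eq_div_iff hΔ.ne'] at he
  have h1 := hs hc.1.le
  have h2 := hs hc.2.le
  have e1 : trapError g s x = (s c - (s x.1 + s x.2) / 2) / (x.2 - x.1) := by
    rw [trapError, ← he]; field_simp
  rw [e1, avgSlope, abs_div, abs_of_pos hΔ, div_div, mul_comm (x.2 - x.1) 2, ← div_div]
  refine div_le_div_of_nonneg_right ?_ hΔ.le
  rw [abs_le]; constructor <;> linarith

/-- The largest limiting average slope is attained along a family of intervals for which the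
trapezoid error vanishes in the limit. -/
lemma exists_ultrafilter_max_avgSlope {g s : ℝ → ℝ} (hs : StrictMono s)
    (hg : ∀ x, HasDerivAt g (s x) x) {C : ℝ} (hC : ∀ᶠ x in smallIntervals, avgSlope s x ≤ C) :
    ∃ (U : Ultrafilter (ℝ × ℝ)) (M : ℝ), ↑U ≤ smallIntervals ∧
      Filter.Tendsto (avgSlope s) U (𝓝 M) ∧ Filter.Tendsto (trapError g s) U (𝓝 0) ∧
      ∀ V : Ultrafilter (ℝ × ℝ), ↑V ≤ smallIntervals → ∀ L, Filter.Tendsto (avgSlope s) V (𝓝 L) →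
        L ≤ M := by
  have hb : smallIntervals.IsBoundedUnder (· ≤ ·) (avgSlope s) := ⟨C, by simpa using hC⟩
  have hpos : ∀ᶠ x in smallIntervals, 0 < avgSlope s x :=
    eventually_smallIntervals.2 ⟨1, one_pos, fun α β _ h _ => avgSlope_pos hs h⟩
  have hcb : smallIntervals.IsCoboundedUnder (· ≤ ·) (avgSlope s) :=
    Filter.IsBoundedUnder.isCoboundedUnder_flip ⟨0, by
      simpa using hpos.mono fun x h => h.le⟩
  set M := Filter.limsup (avgSlope s) smallIntervals
  have hup : ∀ t > 0, ∀ᶠ x in smallIntervals, avgSlope s x < M + t := fun t ht =>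
    Filter.eventually_lt_of_limsup_lt (by linarith) hb
  have hcl : MapClusterPt M smallIntervals (avgSlope s) := by
    rw [mapClusterPt_iff_frequently]
    intro S hS
    obtain ⟨t, ht, hball⟩ := Metric.mem_nhds_iff.1 hS
    have h1 : ∃ᶠ x in smallIntervals, M - t < avgSlope s x :=
      Filter.frequently_lt_of_lt_limsup hcb (by linarith)
    refine (h1.and_eventually (hup t ht)).mono fun x hx => hball ?_
    rw [Metric.mem_ball, Real.dist_eq, abs_lt]
    constructor <;> linarith [hx.1, hx.2]
  obtain ⟨U, hU, hUM⟩ := mapClusterPt_iff_ultrafilter.1 hcl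
  refine ⟨U, M, hU, hUM, ?_, fun V hV L hL => ?_⟩
  · rw [Metric.tendsto_nhds]
    intro c hc
    have ht : 0 < c / 5 := by linarith
    obtain ⟨η, hη, h⟩ := eventually_smallIntervals.1 (hup _ ht)
    have h1 : ∀ᶠ x in (U : Filter (ℝ × ℝ)), -η < x.1 ∧ x.1 < x.2 ∧ x.2 < η :=
      hU (eventually_smallIntervals.2 ⟨η, hη, fun α β h1 h2 h3 => ⟨h1, h2, h3⟩⟩)
    filter_upwards [h1, hUM.eventually (eventually_gt_nhds (show M - c / 5 < M by linarith))]
      with x hx hxM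
    rw [Real.dist_0_eq_abs]
    refine (abs_trapError_le (M := M) (t := 2 * (c / 5)) hx.2.1 (by linarith) (fun x _ => hg x)
      fun y hy => ?_).trans_lt (by linarith)
    -- All subintervals have slope at most `M + c / 5`, while the whole interval has slope above `M
    -- - c / 5`. Hence `s` is within `2 * (c / 5)` times the length of an affine function, and the
    -- trapezoid error is small.
    have hle : ∀ a b, x.1 ≤ a → a ≤ b → b ≤ x.2 → s b - s a ≤ (M + c / 5) * (b - a) := by
      intro a b ha hab hb
      rcases hab.eq_or_lt with rfl | hab
      · simp
      have := h a b (by linarith [hx.1]) hab (by linarith [hx.2.2])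
      rw [avgSlope, div_lt_iff₀ (by linarith)] at this
      exact this.le
    have i1 := hle x.1 y le_rfl hy.1 hy.2
    have i2 := hle y x.2 hy.1 hy.2 le_rfl
    rw [avgSlope, lt_div_iff₀ (by linarith [hx.2.1])] at hxM
    rw [abs_le]
    have := hy.1
    have := hy.2
    constructor <;> nlinarith
  · refine le_of_forall_pos_le_add fun t ht => ?_
    exact le_of_tendsto hL (Filter.Eventually.mono (hV (hup t ht)) fun x h => h.le)

/-- Two increasing functions `s₁ = g₁'`, `s₂ = g₂'` are linked with parameters `p₁, p₂` if the
limiting average slopes on small intervals of the first, and on suitable partner intervals of the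
second, add up to `p₁ + p₂`, and their product is smaller than `p₁ p₂` by an amount given by the
trapezoid error. -/
def SlopesLinked (p₁ p₂ : ℝ) (g₁ s₁ s₂ : ℝ → ℝ) : Prop :=
  ∀ U : Ultrafilter (ℝ × ℝ), ↑U ≤ smallIntervals →
    ∃ (V : Ultrafilter (ℝ × ℝ)) (L k : ℝ), ↑V ≤ smallIntervals ∧
      Filter.Tendsto (avgSlope s₁) U (𝓝 L) ∧
      Filter.Tendsto (fun x => trapError g₁ s₁ x / avgSlope s₁ x) U (𝓝 k) ∧
      Filter.Tendsto (avgSlope s₂) V (𝓝 (p₁ + p₂ - L)) ∧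
      L * (p₁ + p₂ - L) = (1 - 4 * k ^ 2) * (p₁ * p₂)

/-- At the largest limiting slope `M` the trapezoid error vanishes, and with `k = 0` the link says
`(M - p₁) * (M - p₂) = 0`. -/
lemma SlopesLinked.le_max {p₁ p₂ : ℝ} {g₁ s₁ s₂ : ℝ → ℝ} (h : SlopesLinked p₁ p₂ g₁ s₁ s₂)
    (hp₁ : 0 < p₁) (hs : StrictMono s₁) (hg : ∀ x, HasDerivAt g₁ (s₁ x) x)
    (hC : ∀ᶠ x in smallIntervals, avgSlope s₁ x ≤ p₁ + p₂ + 1)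
    {U : Ultrafilter (ℝ × ℝ)} (hU : ↑U ≤ smallIntervals) {L : ℝ}
    (hL : Filter.Tendsto (avgSlope s₁) U (𝓝 L)) : L ≤ max p₁ p₂ := by
  obtain ⟨W, M, hW, hM, hT, hmax⟩ := exists_ultrafilter_max_avgSlope hs hg hC
  refine (hmax U hU L hL).trans ?_
  by_contra hlt
  rw [not_le, max_lt_iff] at hlt
  obtain ⟨V, L', k, -, hL', hk, -, he⟩ := h W hW
  obtain rfl := tendsto_nhds_unique hM hL'
  have h0 := hT.div hM (by linarith : M ≠ 0)
  rw [zero_div] at h0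
  obtain rfl := tendsto_nhds_unique h0 hk
  nlinarith [mul_pos (sub_pos.2 hlt.1) (sub_pos.2 hlt.2)]

/-- The average slopes of a function linked to another one converge. -/
lemma SlopesLinked.tendsto {p₁ p₂ : ℝ} {g₁ s₁ g₂ s₂ : ℝ → ℝ}
    (h₁ : SlopesLinked p₁ p₂ g₁ s₁ s₂) (h₂ : SlopesLinked p₁ p₂ g₂ s₂ s₁)
    (hp₁ : 0 < p₁) (hp₂ : 0 < p₂) (hs₁ : StrictMono s₁) (hs₂ : StrictMono s₂)
    (hc₁ : Continuous s₁) (hg₁ : ∀ x, HasDerivAt g₁ (s₁ x) x) (hg₂ : ∀ x, HasDerivAt g₂ (s₂ x) x)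
    (hC₁ : ∀ᶠ x in smallIntervals, avgSlope s₁ x ≤ p₁ + p₂ + 1)
    (hC₂ : ∀ᶠ x in smallIntervals, avgSlope s₂ x ≤ p₁ + p₂ + 1) :
    Filter.Tendsto (avgSlope s₁) smallIntervals (𝓝 p₁) ∨
      Filter.Tendsto (avgSlope s₁) smallIntervals (𝓝 p₂) := by
  have key : ∀ U : Ultrafilter (ℝ × ℝ), ↑U ≤ smallIntervals →
      Filter.Tendsto (avgSlope s₁) U (𝓝 p₁) ∨ Filter.Tendsto (avgSlope s₁) U (𝓝 p₂) := by
    intro U hU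
    obtain ⟨V, L, k, hV, hL, -, hL2, he⟩ := h₁ U hU
    have i1 := h₁.le_max hp₁ hs₁ hg₁ hC₁ hU hL
    have i2 := h₂.le_max hp₁ hs₂ hg₂ hC₂ hV hL2
    -- Neither `L` nor `p₁ + p₂ - L` exceeds the maximum, so `L` lies between `p₁` and `p₂`. On the
    -- other hand the link makes this product equal to `4 * k ^ 2 * (p₁ * p₂)`, which is
    -- nonnegative.
    have h3 : (L - p₁) * (L - p₂) ≤ 0 := by
      rcases le_total p₁ p₂ with h | h
      · rw [max_eq_right h] at i1 i2
        exact mul_nonpos_of_nonneg_of_nonpos (by linarith) (by linarith)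
      · rw [max_eq_left h] at i1 i2
        exact mul_nonpos_of_nonpos_of_nonneg (by linarith) (by linarith)
    have h4 : 0 ≤ 4 * k ^ 2 * (p₁ * p₂) := by positivity
    have h5 : (L - p₁) * (L - p₂) = 0 := by nlinarith
    rcases mul_eq_zero.1 h5 with h | h
    · left; rwa [← sub_eq_zero.1 h]
    · right; rwa [← sub_eq_zero.1 h]
  have hnear : ∀ d > 0, ∀ᶠ x in smallIntervals,
      |avgSlope s₁ x - p₁| < d ∨ |avgSlope s₁ x - p₂| < d := by
    intro d hd
    by_contra hcon
    have hne := Filter.frequently_iff_neBot.1 (Filter.not_eventually.1 hcon)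
    set U := Ultrafilter.of (smallIntervals ⊓
      Filter.principal {x | ¬(|avgSlope s₁ x - p₁| < d ∨ |avgSlope s₁ x - p₂| < d)})
    have hU' := Ultrafilter.of_le (smallIntervals ⊓
      Filter.principal {x | ¬(|avgSlope s₁ x - p₁| < d ∨ |avgSlope s₁ x - p₂| < d)})
    have hU : ↑U ≤ smallIntervals := hU'.trans inf_le_left
    have hUn : ∀ᶠ x in (U : Filter (ℝ × ℝ)),
      ¬(|avgSlope s₁ x - p₁| < d ∨ |avgSlope s₁ x - p₂| < d) :=
      Filter.le_principal_iff.1 (hU'.trans inf_le_right)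
    rcases key U hU with h | h
    · have := h.eventually (Metric.ball_mem_nhds p₁ hd)
      obtain ⟨x, hx, hx'⟩ := (this.and hUn).exists
      exact hx' (Or.inl hx)
    · have := h.eventually (Metric.ball_mem_nhds p₂ hd)
      obtain ⟨x, hx, hx'⟩ := (this.and hUn).exists
      exact hx' (Or.inr hx)
  by_cases hp : p₁ = p₂
  · left
    rw [Metric.tendsto_nhds]
    intro d hd
    filter_upwards [hnear d hd] with x hx
    rw [← hp, or_self] at hx
    exact hx
  have hd : 0 < |p₁ - p₂| / 3 := div_pos (abs_pos.2 (sub_ne_zero.2 hp)) (by norm_num)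
  obtain ⟨η, hη, h⟩ := eventually_smallIntervals.1 (hnear _ hd)
  set d := |p₁ - p₂| / 3 with hddef
  -- The average slope is continuous on this connected set of intervals and stays near `p₁` or `p₂`,
  -- so it cannot switch between them.
  set W : Set (ℝ × ℝ) := {x | -η < x.1 ∧ x.1 < x.2 ∧ x.2 < η} with hWdef
  have hWc : Convex ℝ W := by
    intro x hx y hy a b ha hb hab
    simp only [hWdef, mem_ofPred_eq, Prod.fst_add, Prod.snd_add, Prod.smul_fst, Prod.smul_snd,
      smul_eq_mul] at hx hy ⊢
    have e : η = a * η + b * η := by rw [← add_mul, hab, one_mul]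
    rcases ha.eq_or_lt with rfl | ha
    · rw [zero_add] at hab
      subst hab
      simpa using hy
    · have i1 := mul_lt_mul_of_pos_left hx.1 ha
      have i2 := mul_lt_mul_of_pos_left hx.2.1 ha
      have i3 := mul_lt_mul_of_pos_left hx.2.2 ha
      have j1 := mul_le_mul_of_nonneg_left hy.1.le hb
      have j2 := mul_le_mul_of_nonneg_left hy.2.1.le hb
      have j3 := mul_le_mul_of_nonneg_left hy.2.2.le hb
      refine ⟨by linarith, by linarith, by linarith⟩
  have hcont : ContinuousOn (avgSlope s₁) W := by
    unfold avgSlope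
    refine ContinuousOn.div (by fun_prop) (by fun_prop) fun x hx => ?_
    have := hx.2.1
    exact (sub_pos.2 this).ne'
  have hWU : ∀ U : Ultrafilter (ℝ × ℝ), ↑U ≤ smallIntervals →
      ∀ᶠ x in (U : Filter (ℝ × ℝ)), x ∈ W := fun U hU =>
    hU (eventually_smallIntervals.2 ⟨η, hη, fun α β h1 h2 h3 => ⟨h1, h2, h3⟩⟩)
  have hfar : ∀ q q' : ℝ, |q - q'| = 3 * d → avgSlope s₁ '' W ⊆ Metric.ball q d →
      ∀ U : Ultrafilter (ℝ × ℝ), ↑U ≤ smallIntervals →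
        ¬Filter.Tendsto (avgSlope s₁) U (𝓝 q') := by
    intro q q' hq hsub U hU hlim
    have h1 := hlim.eventually (Metric.ball_mem_nhds q' hd)
    obtain ⟨x, hx, hxW⟩ := (h1.and (hWU U hU)).exists
    have h2 := hsub (mem_image_of_mem _ hxW)
    rw [Metric.mem_ball, Real.dist_eq] at h2
    rw [Real.dist_eq] at hx
    have h3 := abs_sub_le q (avgSlope s₁ x) q'
    rw [abs_sub_comm q (avgSlope s₁ x)] at h3
    linarith
  rcases (hWc.isPreconnected.image _ hcont).subset_or_subset (u := Metric.ball p₁ d)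
    (v := Metric.ball p₂ d) Metric.isOpen_ball Metric.isOpen_ball
    (Metric.ball_disjoint_ball (by rw [Real.dist_eq]; linarith))
    (by
      rintro - ⟨x, hx, rfl⟩
      exact h x.1 x.2 hx.1 hx.2.1 hx.2.2) with hsub | hsub
  · left
    rw [Filter.tendsto_iff_ultrafilter]
    intro U hU
    exact (key U hU).resolve_right (hfar p₁ p₂ (by rw [hddef]; ring) hsub U hU)
  · right
    rw [Filter.tendsto_iff_ultrafilter]
    intro U hU
    exact (key U hU).resolve_left (hfar p₂ p₁ (by rw [hddef, abs_sub_comm]; ring) hsub U hU)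

lemma hasStrictDerivAt_of_tendsto_avgSlope {s : ℝ → ℝ} {p : ℝ}
    (h : Filter.Tendsto (avgSlope s) smallIntervals (𝓝 p)) : HasStrictDerivAt s p 0 := by
  refine HasStrictFDerivAt.of_isLittleO (Asymptotics.isLittleO_iff.2 fun c hc => ?_)
  obtain ⟨η, hη, h⟩ := eventually_smallIntervals.1 (Metric.tendsto_nhds.1 h c hc)
  rw [Metric.eventually_nhds_iff]
  refine ⟨η, hη, fun x hx => ?_⟩
  rw [Prod.dist_eq, Real.dist_0_eq_abs, Real.dist_0_eq_abs, max_lt_iff, abs_lt, abs_lt] at hx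
  simp only [ContinuousLinearMap.toSpanSingleton_apply, smul_eq_mul, Real.norm_eq_abs]
  have key : ∀ α β, -η < α → α < β → β < η → |s β - s α - (β - α) * p| ≤ c * |β - α| := by
    intro α β h1 h2 h3
    have h4 := h α β h1 h2 h3
    have hΔ : 0 < β - α := by linarith
    rw [Real.dist_eq, avgSlope] at h4
    have e : s β - s α - (β - α) * p = ((s β - s α) / (β - α) - p) * (β - α) := by
      field_simp
    rw [e, abs_mul]
    exact mul_le_mul_of_nonneg_right h4.le (abs_nonneg _)
  rcases lt_trichotomy x.1 x.2 with h1 | h1 | h1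
  · have := key x.1 x.2 hx.1.1 h1 hx.2.2
    rw [abs_sub_comm x.1, ← abs_neg]
    convert this using 2; ring
  · simp [h1]
  · exact key x.2 x.1 hx.2.1 h1 hx.1.2

/-! ### Support points parametrized by the slope of the normal. -/

/-- The normal vector with slope `τ` in the frame at `θ`. -/
noncomputable def slopeVec (θ τ : ℝ) : Plane := unitVec θ + τ • tangentVec θ

/-- The support point of `B` with normal direction `slopeVec θ τ`. -/
noncomputable def slopePt (B : Set Plane) (θ τ : ℝ) : Plane := supportPt B (θ + Real.arctan τ)

/-- The tangential coordinate of `slopePt`. -/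
noncomputable def slopeX (B : Set Plane) (θ τ : ℝ) : ℝ := dot (tangentVec θ) (slopePt B θ τ)

/-- The support function in the direction `slopeVec θ τ`. -/
noncomputable def slopeG (B : Set Plane) (θ τ : ℝ) : ℝ := dot (slopeVec θ τ) (slopePt B θ τ)

lemma dot_slopeVec (θ τ : ℝ) (y : Plane) :
    dot (slopeVec θ τ) y = dot (unitVec θ) y + τ * dot (tangentVec θ) y := by
  simp [slopeVec, dot]; ring

@[simp] lemma smul_dot (r : ℝ) (x y : Plane) : dot (r • x) y = r * dot x y := by
  simp [dot]; ring

lemma one_add_sq_pos (τ : ℝ) : 0 < 1 + τ ^ 2 := by positivity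

lemma sqrt_smul_unitVec (θ τ : ℝ) :
    √(1 + τ ^ 2) • unitVec (θ + Real.arctan τ) = slopeVec θ τ := by
  have h := (Real.sqrt_pos.2 (one_add_sq_pos τ)).ne'
  apply plane_ext <;>
    simp [slopeVec, Real.cos_add, Real.sin_add, Real.cos_arctan, Real.sin_arctan] <;> field_simp
  · ring

lemma sqrt_smul_tangentVec (θ τ : ℝ) :
    √(1 + τ ^ 2) • tangentVec (θ + Real.arctan τ) = tangentVec θ - τ • unitVec θ := by
  have h := (Real.sqrt_pos.2 (one_add_sq_pos τ)).ne'
  apply plane_ext <;>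
    simp [tangentVec, unitVec, Real.cos_add, Real.sin_add, Real.cos_arctan, Real.sin_arctan] <;>
    field_simp
  · ring

lemma slopePt_zero (B : Set Plane) (θ : ℝ) : slopePt B θ 0 = supportPt B θ := by
  simp [slopePt]

lemma supportPt_eq_slopePt (B : Set Plane) {θ ψ : ℝ} (h : |ψ - θ| < Real.pi / 2) :
    supportPt B ψ = slopePt B θ (Real.tan (ψ - θ)) := by
  rw [abs_lt] at h
  rw [slopePt, Real.arctan_tan (by linarith [h.1]) (by linarith [h.2])]
  congr 1; ring

section slope
variable {B : Set Plane} (hB : IsStrictBody B)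
include hB

lemma slopePt_mem (θ τ : ℝ) : slopePt B θ τ ∈ B := supportPt_mem hB _

lemma dot_le_slopePt (θ τ : ℝ) {w : Plane} (hw : w ∈ B) :
    dot (slopeVec θ τ) w ≤ slopeG B θ τ := by
  rw [slopeG, ← sqrt_smul_unitVec, smul_dot, smul_dot]
  exact mul_le_mul_of_nonneg_left (dot_le_supportPt hB _ hw) (Real.sqrt_nonneg _)

lemma continuous_slopePt (θ : ℝ) : Continuous (slopePt B θ) :=
  (continuous_supportPt hB).comp (continuous_const.add Real.continuous_arctan)

lemma continuous_slopeX (θ : ℝ) : Continuous (slopeX B θ) := by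
  have := continuous_slopePt hB θ
  unfold slopeX; fun_prop

/-- In the slope parameter the support function is convex with subgradient `slopeX`. Monotonicity of
`slopeX` and differentiability of `slopeG` follow from this inequality and its mirror image. -/
lemma slopeG_add_le (θ α β : ℝ) : slopeG B θ α + (β - α) * slopeX B θ α ≤ slopeG B θ β := by
  have := dot_le_slopePt hB θ β (slopePt_mem hB θ α)
  rw [dot_slopeVec] at this
  rw [slopeG, dot_slopeVec]
  unfold slopeX
  linarith

lemma monotone_slopeX (θ : ℝ) : Monotone (slopeX B θ) := by
  intro α β h
  rcases h.eq_or_lt with rfl | h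
  · exact le_rfl
  have h1 := slopeG_add_le hB θ α β
  have h2 := slopeG_add_le hB θ β α
  nlinarith

lemma slopePt_eq_of_slopeX_eq {θ α β : ℝ} (h : slopeX B θ α = slopeX B θ β) :
    slopePt B θ α = slopePt B θ β := by
  have h1 := slopeG_add_le hB θ α β
  have h2 := slopeG_add_le hB θ β α
  rw [← h] at h2
  have h3 : slopeG B θ α + (β - α) * slopeX B θ α = slopeG B θ β := by linarith
  rw [slopeG, slopeG, dot_slopeVec, dot_slopeVec] at h3
  have e1 : dot (tangentVec θ) (slopePt B θ α) = slopeX B θ α := rfl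
  have e2 : dot (tangentVec θ) (slopePt B θ β) = slopeX B θ β := rfl
  rw [e1, e2, ← h] at h3
  rw [frame_decomp θ (slopePt B θ α), frame_decomp θ (slopePt B θ β), e1, e2, ← h]
  congr 2
  linarith

lemma strictMono_slopeX (hs : IsSmoothBody B) (θ : ℝ) : StrictMono (slopeX B θ) := by
  refine (monotone_slopeX hB θ).strictMono_of_injective fun α β h => ?_
  by_contra hne
  have key : ∀ α β : ℝ, α < β → slopeX B θ α = slopeX B θ β → False := by
    intro α β hlt h
    have h1 := Real.arctan_strictMono hlt
    refine hs.supportPt_ne (a := θ + Real.arctan α) (b := θ + Real.arctan β) (by linarith) ?_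
      (slopePt_eq_of_slopeX_eq hB h)
    linarith [Real.arctan_lt_pi_div_two β, Real.neg_pi_div_two_lt_arctan α, Real.pi_pos]
  rcases lt_or_gt_of_ne hne with h' | h'
  · exact key _ _ h' h
  · exact key _ _ h' h.symm

/-- The two subgradient inequalities bound the remainder by `(x - τ)` times the increment of
`slopeX`, which is small by continuity. -/
lemma hasDerivAt_slopeG (θ τ : ℝ) : HasDerivAt (slopeG B θ) (slopeX B θ τ) τ := by
  rw [hasDerivAt_iff_isLittleO]
  have hc : Filter.Tendsto (fun x => slopeX B θ x - slopeX B θ τ) (𝓝 τ) (𝓝 0) := by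
    have := ((continuous_slopeX hB θ).tendsto τ).sub_const (slopeX B θ τ)
    rwa [sub_self] at this
  have h1 : (fun x => (x - τ) * (slopeX B θ x - slopeX B θ τ)) =o[𝓝 τ] fun x => x - τ := by
    have := (Asymptotics.isBigO_refl (fun x : ℝ => x - τ) (𝓝 τ)).mul_isLittleO
      ((Asymptotics.isLittleO_one_iff ℝ).2 hc)
    simpa using this
  refine Asymptotics.IsBigO.trans_isLittleO (Asymptotics.IsBigO.of_bound 1
    (Filter.Eventually.of_forall fun x => ?_)) h1
  have i1 := slopeG_add_le hB θ τ x
  have i2 := slopeG_add_le hB θ x τ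
  rw [one_mul, Real.norm_eq_abs, Real.norm_eq_abs, smul_eq_mul]
  exact abs_le_abs_of_nonneg (by linarith) (by linarith)

lemma slopePt_secant_bounds {θ α β : ℝ} :
    α * (slopeX B θ β - slopeX B θ α) ≤ dot (unitVec θ) (slopePt B θ α - slopePt B θ β) ∧
    dot (unitVec θ) (slopePt B θ α - slopePt B θ β) ≤ β * (slopeX B θ β - slopeX B θ α) := by
  have h1 := slopeG_add_le hB θ α β
  have h2 := slopeG_add_le hB θ β α
  simp only [slopeG, dot_slopeVec] at h1 h2
  have e1 : dot (tangentVec θ) (slopePt B θ α) = slopeX B θ α := rfl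
  have e2 : dot (tangentVec θ) (slopePt B θ β) = slopeX B θ β := rfl
  rw [e1, e2] at h1 h2
  rw [dot_sub]
  constructor <;> linarith

lemma chordTop_slopePt (hs : IsSmoothBody B) {θ α β : ℝ} (h : α < β) :
    chordTop B (slopePt B θ β - slopePt B θ α) = slopePt B θ β := by
  have h1 := Real.arctan_strictMono h
  refine chordTop_supportPt hB (by linarith) ?_ ?_
  · linarith [Real.arctan_lt_pi_div_two β, Real.neg_pi_div_two_lt_arctan α]
  · refine (hs.supportPt_ne (by linarith) ?_).symm
    linarith [Real.arctan_lt_pi_div_two β, Real.neg_pi_div_two_lt_arctan α, Real.pi_pos]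

end slope

/-- Geometrically, the trapezoid error compares the mean of the end slopes with the slope of the
normal of the secant. -/
lemma trapError_slope (B : Set Plane) (θ α β : ℝ) :
    trapError (slopeG B θ) (slopeX B θ) (α, β) =
      ((α + β) / 2 * (slopeX B θ β - slopeX B θ α)
        - dot (unitVec θ) (slopePt B θ α - slopePt B θ β)) / (β - α) ^ 2 := by
  rw [trapError]
  congr 1
  simp only [slopeG, dot_slopeVec, slopeX, dot_sub]
  ring

/-! ### Short, nearly tangential chords. -/

/-- The filter of small vectors that are nearly parallel to `tangentVec θ`. -/
noncomputable def smallTangent (θ : ℝ) : Filter Plane :=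
  Filter.map (fun x : ℝ × ℝ => x.1 • (tangentVec θ - x.2 • unitVec θ)) (𝓝[>] 0 ×ˢ 𝓝 0)

lemma eventually_smallTangent {θ : ℝ} {P : Plane → Prop} :
    (∀ᶠ v in smallTangent θ, P v) ↔ ∃ η : ℝ, 0 < η ∧ ∀ v, 0 < dot (tangentVec θ) v →
      dot (tangentVec θ) v < η → |dot (unitVec θ) v| < η * dot (tangentVec θ) v → P v := by
  have hb : (𝓝[>] (0 : ℝ) ×ˢ 𝓝 (0 : ℝ)).HasBasis (fun η : ℝ => 0 < η)
      fun η => Ioo 0 η ×ˢ Metric.ball 0 η := by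
    refine ((nhdsGT_basis (0 : ℝ)).prod_same_index Metric.nhds_basis_ball ?_)
    intro i j hi hj
    exact ⟨min i j, lt_min hi hj, Ioo_subset_Ioo_right (min_le_left _ _),
      Metric.ball_subset_ball (min_le_right _ _)⟩
  rw [smallTangent, Filter.eventually_map, hb.eventually_iff]
  constructor
  · rintro ⟨η, hη, h⟩
    refine ⟨η, hη, fun v h1 h2 h3 => ?_⟩
    have := @h (dot (tangentVec θ) v, -dot (unitVec θ) v / dot (tangentVec θ) v) ⟨⟨h1, h2⟩, by
      rw [mem_ball_zero_iff, Real.norm_eq_abs, abs_div, abs_of_pos h1, div_lt_iff₀ h1, abs_neg]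
      exact h3⟩
    convert this using 1
    conv_lhs => rw [frame_decomp θ v]
    rw [smul_sub, smul_smul, mul_div_cancel₀ _ h1.ne', neg_smul]
    abel
  · rintro ⟨η, hη, h⟩
    refine ⟨η, hη, fun x hx => ?_⟩
    obtain ⟨⟨h1, h2⟩, h3⟩ := hx
    rw [mem_ball_zero_iff, Real.norm_eq_abs] at h3
    have e1 : dot (tangentVec θ) (x.1 • (tangentVec θ - x.2 • unitVec θ)) = x.1 := by
      simp [dot_tangentVec_tangentVec, dot_tangentVec_unitVec]
    have e2 : dot (unitVec θ) (x.1 • (tangentVec θ - x.2 • unitVec θ)) = -(x.1 * x.2) := by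
      simp [dot_unitVec_tangentVec, dot_unitVec_unitVec]
    refine h _ (by rwa [e1]) (by rwa [e1]) ?_
    rw [e1, e2, abs_neg, abs_mul, abs_of_pos h1, mul_comm]
    exact mul_lt_mul_of_pos_right h3 h1

lemma eventually_eventually_smallTangent {θ : ℝ} {P : Plane → Prop}
    (h : ∀ᶠ v in smallTangent θ, P v) : ∀ᶠ v in smallTangent θ, ∀ᶠ w in 𝓝 v, P w := by
  obtain ⟨η, hη, h⟩ := eventually_smallTangent.1 h
  refine eventually_smallTangent.2 ⟨η, hη, fun v h1 h2 h3 => ?_⟩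
  have c1 : Continuous fun w => dot (tangentVec θ) w := by fun_prop
  have c2 : Continuous fun w => |dot (unitVec θ) w| := by fun_prop
  filter_upwards [c1.continuousAt.eventually (lt_mem_nhds h1),
    c1.continuousAt.eventually (gt_mem_nhds h2),
    (c2.tendsto v).eventually_lt ((c1.const_mul η).tendsto v) h3] with w a b c
  exact h w a b c

lemma eventually_smallTangent_of_polar {θ : ℝ} {P : Plane → Prop}
    (h : ∀ᶠ x : ℝ × ℝ in 𝓝[>] 0 ×ˢ 𝓝 θ, P (x.1 • tangentVec x.2)) :
    ∀ᶠ v in smallTangent θ, P v := by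
  rw [smallTangent, Filter.eventually_map]
  have ht : Filter.Tendsto (fun x : ℝ × ℝ => (x.1 * √(1 + x.2 ^ 2), θ + Real.arctan x.2))
      (𝓝[>] 0 ×ˢ 𝓝 0) (𝓝[>] 0 ×ˢ 𝓝 θ) := by
    refine Filter.Tendsto.prodMk ?_ ?_
    · rw [tendsto_nhdsWithin_iff]
      constructor
      · have hc : Continuous fun x : ℝ × ℝ => x.1 * √(1 + x.2 ^ 2) := by fun_prop
        have := (hc.tendsto (0, 0)).mono_left (show 𝓝[>] (0 : ℝ) ×ˢ 𝓝 (0 : ℝ) ≤ 𝓝 (0, 0) by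
          rw [nhds_prod_eq]; exact Filter.prod_mono nhdsWithin_le_nhds le_rfl)
        simpa using this
      · have h1 : ∀ᶠ x : ℝ × ℝ in 𝓝[>] (0 : ℝ) ×ˢ 𝓝 (0 : ℝ), 0 < x.1 :=
          Filter.tendsto_fst.eventually (self_mem_nhdsWithin)
        filter_upwards [h1] with x hx
        exact mul_pos hx (Real.sqrt_pos.2 (one_add_sq_pos _))
    · have hc : Continuous fun x : ℝ => θ + Real.arctan x :=
        continuous_const.add Real.continuous_arctan
      have := (hc.tendsto 0).comp (Filter.tendsto_snd (f := 𝓝[>] (0 : ℝ)) (g := 𝓝 (0 : ℝ)))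
      rw [Real.arctan_zero, add_zero] at this
      exact this
  filter_upwards [ht.eventually h] with x hx
  rwa [mul_smul, sqrt_smul_tangentVec] at hx

lemma tendsto_smallTangent_zero (θ : ℝ) : Filter.Tendsto id (smallTangent θ) (𝓝 0) := by
  intro S hS
  exact eventually_smallTangent_of_polar ((tendsto_smul_tangentVec θ).eventually hS)

lemma tendsto_chordTop_smallTangent {B : Set Plane} (hB : IsStrictBody B) (θ : ℝ) :
    Filter.Tendsto (chordTop B) (smallTangent θ) (𝓝 (supportPt B θ)) := by
  intro S hS
  exact eventually_smallTangent_of_polar ((tendsto_chordTop_zero hB θ).eventually hS)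

lemma eventually_mem_smallTangent {B : Set Plane} (hB : IsStrictBody B) (θ : ℝ) :
    ∀ᶠ v in smallTangent θ, v ≠ 0 ∧ v ∈ interior (B - B) := by
  have h1 : ∀ᶠ v in smallTangent θ, v ≠ 0 :=
    eventually_smallTangent.2 ⟨1, one_pos, fun v hv _ _ h0 => by simp [h0] at hv⟩
  have h2 : ∀ᶠ v in smallTangent θ, v ∈ interior (B - B) :=
    (tendsto_smallTangent_zero θ).eventually
      (isOpen_interior.mem_nhds (zero_mem_interior_sub_self hB))
  exact h1.and h2

/-- The slope of a secant is controlled by the slopes of the normals at its ends, so secants over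
small intervals are short and nearly tangential. -/
lemma tendsto_slopePt_sub {B : Set Plane} (hB : IsStrictBody B) (hs : IsSmoothBody B) (θ : ℝ) :
    Filter.Tendsto (fun x : ℝ × ℝ => slopePt B θ x.2 - slopePt B θ x.1) smallIntervals
      (smallTangent θ) := by
  intro S hS
  obtain ⟨η, hη, h⟩ := eventually_smallTangent.1 hS
  have hc : Continuous fun x : ℝ × ℝ => slopeX B θ x.2 - slopeX B θ x.1 := by
    have := continuous_slopeX hB θ
    fun_prop
  have h1 : ∀ᶠ x in smallIntervals, slopeX B θ x.2 - slopeX B θ x.1 < η :=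
    ((hc.tendsto (0, 0)).mono_left nhdsWithin_le_nhds).eventually
      (gt_mem_nhds (by simpa using hη))
  have h2 : ∀ᶠ x in smallIntervals, -η < x.1 ∧ x.1 < x.2 ∧ x.2 < η :=
    eventually_smallIntervals.2 ⟨η, hη, fun α β h1 h2 h3 => ⟨h1, h2, h3⟩⟩
  rw [Filter.mem_map]
  filter_upwards [h1, h2] with x hx1 hx2
  have e : dot (tangentVec θ) (slopePt B θ x.2 - slopePt B θ x.1)
      = slopeX B θ x.2 - slopeX B θ x.1 := by rw [dot_sub]; rfl
  have hpos : 0 < slopeX B θ x.2 - slopeX B θ x.1 :=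
    sub_pos.2 (strictMono_slopeX hB hs θ hx2.2.1)
  refine h _ (by rwa [e]) (by rwa [e]) ?_
  have e2 : dot (unitVec θ) (slopePt B θ x.2 - slopePt B θ x.1)
      = -dot (unitVec θ) (slopePt B θ x.1 - slopePt B θ x.2) := by
    rw [← dot_neg, neg_sub]
  simp only
  rw [e, e2, abs_neg, abs_lt]
  obtain ⟨i1, i2⟩ := slopePt_secant_bounds hB (θ := θ) (α := x.1) (β := x.2)
  constructor
  · nlinarith [hx2.1]
  · nlinarith [hx2.2.2]

/-- The slopes of the normals at the end points of the extremal chords of a smooth body. -/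
lemma exists_chordSlopes {B : Set Plane} (hB : IsStrictBody B) (hs : IsSmoothBody B) (θ : ℝ) :
    ∃ J : Plane → ℝ × ℝ, Filter.Tendsto J (smallTangent θ) smallIntervals ∧
      ∀ᶠ v in smallTangent θ, chordTop B v = slopePt B θ (J v).2 ∧
        chordTop B v - v = slopePt B θ (J v).1 := by
  classical
  let Q : Plane → ℝ × ℝ → Prop := fun v x =>
    chordTop B v = slopePt B θ x.2 ∧ chordTop B v - v = slopePt B θ x.1
  have hinj : Function.Injective (slopePt B θ) := fun α β h =>
    (strictMono_slopeX hB hs θ).injective (by unfold slopeX; rw [h])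
  have huniq : ∀ v x y, Q v x → Q v y → x = y := fun v x y hx hy =>
    Prod.ext (hinj (hx.2.symm.trans hy.2)) (hinj (hx.1.symm.trans hy.1))
  have hnear : ∀ η > 0, ∀ᶠ z in 𝓝 (supportPt B θ), z ∈ frontier B →
      ∃ τ, |τ| < η ∧ z = slopePt B θ τ := by
    intro η hη
    have ha : 0 < Real.arctan η := Real.arctan_pos.2 hη
    filter_upwards [eventually_exists_supportPt_near hB hs θ ha] with z hz hzf
    obtain ⟨ψ, h1, rfl⟩ := hz hzf
    have h2 : |ψ - θ| < Real.pi / 2 := h1.trans (Real.arctan_lt_pi_div_two η)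
    refine ⟨Real.tan (ψ - θ), ?_, supportPt_eq_slopePt B h2⟩
    rw [abs_lt] at h1 h2 ⊢
    have e := Real.tan_arctan η
    have hlt := Real.arctan_lt_pi_div_two η
    constructor
    · rw [← e, ← Real.tan_neg]
      exact Real.tan_lt_tan_of_lt_of_lt_pi_div_two (by linarith) h2.2 h1.1
    · conv_rhs => rw [← e]
      exact Real.tan_lt_tan_of_lt_of_lt_pi_div_two (by linarith) hlt h1.2
  have hex : ∀ η > 0, ∀ᶠ v in smallTangent θ, ∃ x : ℝ × ℝ, -η < x.1 ∧ x.1 < x.2 ∧ x.2 < η ∧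
      Q v x := by
    intro η hη
    have ht := tendsto_chordTop_smallTangent hB θ
    have ht' : Filter.Tendsto (fun v => chordTop B v - v) (smallTangent θ)
        (𝓝 (supportPt B θ)) := by
      have := ht.sub (tendsto_smallTangent_zero θ)
      simpa using this
    have hpos : ∀ᶠ v in smallTangent θ, 0 < dot (tangentVec θ) v :=
      eventually_smallTangent.2 ⟨1, one_pos, fun v h _ _ => h⟩
    filter_upwards [ht.eventually (hnear η hη), ht'.eventually (hnear η hη), hpos,
      eventually_mem_smallTangent hB θ] with v h1 h2 h3 h4
    have hspec := chordTop_spec hB (interior_subset h4.2)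
    obtain ⟨β, hβ, e1⟩ := h1 (hspec.mem_frontier hB h4.1).1
    obtain ⟨α, hα, e2⟩ := h2 (hspec.mem_frontier hB h4.1).2
    rw [abs_lt] at hα hβ
    refine ⟨(α, β), hα.1, ?_, hβ.2, e1, e2⟩
    rw [← (strictMono_slopeX hB hs θ).lt_iff_lt, ← sub_pos]
    unfold slopeX
    rw [← e1, ← e2, ← dot_sub, sub_sub_cancel]
    exact h3
  refine ⟨fun v => if h : ∃ x, Q v x then h.choose else 0, ?_, ?_⟩
  · intro S hS
    obtain ⟨η, hη, h⟩ := eventually_smallIntervals.1 hS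
    rw [Filter.mem_map]
    filter_upwards [hex η hη] with v hv
    obtain ⟨x, h1, h2, h3, h4⟩ := hv
    have h5 : ∃ x, Q v x := ⟨x, h4⟩
    have h6 : h5.choose = x := huniq v _ _ h5.choose_spec h4
    simp only [mem_preimage, dif_pos h5, h6]
    exact h x.1 x.2 h1 h2 h3
  · filter_upwards [hex 1 one_pos] with v hv
    obtain ⟨x, -, -, -, h4⟩ := hv
    have h5 : ∃ x, Q v x := ⟨x, h4⟩
    rw [dif_pos h5]
    exact h5.choose_spec

lemma chordGap_eq_iff {K H : Set Plane} {v : Plane} : chordGap K v = chordGap H v ↔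
    chordTop K v + chordTop (-K) v = chordTop H v + chordTop (-H) v := by
  rw [chordGap, chordGap, sub_left_inj]

lemma exists_smallTangent_smul {θ : ℝ} {P : Plane → Prop} (h : ∀ᶠ v in smallTangent θ, P v) :
    ∃ δ : ℝ, 0 < δ ∧ P (δ • tangentVec θ) := by
  obtain ⟨η, hη, h⟩ := eventually_smallTangent.1 h
  have e1 : dot (tangentVec θ) ((η / 2) • tangentVec θ) = η / 2 := by
    simp [dot_tangentVec_tangentVec]
  have e2 : dot (unitVec θ) ((η / 2) • tangentVec θ) = 0 := by simp [dot_unitVec_tangentVec]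
  refine ⟨η / 2, by linarith, h _ (by rw [e1]; linarith) (by rw [e1]; linarith) ?_⟩
  rw [e1, e2, abs_zero]; positivity

/-! ### Smoothness of the second body. -/

/-- The ends of a chord parallel to the support line have normals of slopes `α ≤ 0 ≤ β`. The depth
of the chord is at most `β` times its length, and `β` tends to 0 for a smooth body. -/
lemma IsSmoothBody.eventually_height {K : Set Plane} (hK : IsStrictBody K) (hs : IsSmoothBody K)
    (θ : ℝ) {c : ℝ} (hc : 0 < c) : ∀ᶠ v in smallTangent θ, dot (unitVec θ) v = 0 →
      -(c * dot (tangentVec θ) v) ≤ dot (unitVec θ) (chordTop K v - supportPt K θ) := by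
  obtain ⟨J, hJ, hJ'⟩ := exists_chordSlopes hK hs θ
  have hJc : ∀ᶠ v in smallTangent θ, (J v).2 < c :=
    hJ.eventually (p := fun x => x.2 < c)
      (eventually_smallIntervals.2 ⟨c, hc, fun _ _ _ _ h => h⟩)
  have hJlt : ∀ᶠ v in smallTangent θ, (J v).1 < (J v).2 :=
    hJ.eventually (p := fun x => x.1 < x.2)
      (eventually_smallIntervals.2 ⟨c, hc, fun _ _ _ h _ => h⟩)
  have hpos : ∀ᶠ v in smallTangent θ, 0 < dot (tangentVec θ) v :=
    eventually_smallTangent.2 ⟨1, one_pos, fun v h _ _ => h⟩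
  filter_upwards [hJ', hJc, hJlt, hpos] with v h1 h2 h3 h4 h5
  set α := (J v).1
  set β := (J v).2
  have hv : slopePt K θ β - slopePt K θ α = v := by rw [← h1.1, ← h1.2]; abel
  have hδ : slopeX K θ β - slopeX K θ α = dot (tangentVec θ) v := by
    rw [← hv, dot_sub]; rfl
  obtain ⟨i1, i2⟩ := slopePt_secant_bounds hK (θ := θ) (α := α) (β := β)
  have hε : dot (unitVec θ) (slopePt K θ α - slopePt K θ β) = 0 := by
    rw [← neg_sub (slopePt K θ β), hv, dot_neg, h5, neg_zero]
  rw [hε, hδ] at i1 i2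
  have hα : α ≤ 0 := by
    by_contra hcon
    exact absurd i1 (not_le.2 (mul_pos (not_le.1 hcon) h4))
  have hβ : 0 ≤ β := by
    by_contra hcon
    exact absurd i2 (not_le.2 (mul_neg_of_neg_of_pos (not_le.1 hcon) h4))
  have h6 := slopeG_add_le hK θ 0 β
  have h7 := monotone_slopeX hK θ hα
  have e0 : slopeG K θ 0 = dot (unitVec θ) (supportPt K θ) := by
    rw [slopeG, dot_slopeVec, slopePt_zero, zero_mul, add_zero]
  have eβ : slopeG K θ β = dot (unitVec θ) (slopePt K θ β) + β * slopeX K θ β := by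
    rw [slopeG, dot_slopeVec]; rfl
  rw [e0, eβ, sub_zero] at h6
  rw [h1.1, dot_sub]
  have h8 : β * (slopeX K θ β - slopeX K θ 0) ≤ c * dot (tangentVec θ) v := by
    rw [← hδ]
    exact mul_le_mul h2.le (by linarith) (by linarith [monotone_slopeX hK θ hβ]) hc.le
  linarith

/-- The covariogram data of a smooth body force the other body to be smooth. -/
lemma isSmoothBody_of_gap {K H : Set Plane} (hK : IsStrictBody K) (hH : IsStrictBody H)
    (hD : K - K = H - H) (hs : IsSmoothBody K)
    (hgap : ∀ θ, ∀ᶠ v in smallTangent θ, chordGap K v = chordGap H v) : IsSmoothBody H := by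
  refine isSmoothBody_of_ne hH fun a b hab hba he => ?_
  set θ := (a + b) / 2 with hθ
  set ω := (b - a) / 2 with hω
  have hω0 : 0 < ω := by rw [hω]; linarith
  have hωπ : ω < Real.pi / 2 := by rw [hω]; linarith
  set τ := Real.tan ω with hτ
  have hτ0 : 0 < τ := Real.tan_pos_of_pos_of_lt_pi_div_two hω0 hωπ
  set y := supportPt H a with hy
  have hyθ : supportPt H θ = y :=
    supportPt_eq_of_between hH ⟨by rw [hθ]; linarith, by rw [hθ]; linarith⟩ hba hab he
  have e1 : slopePt H θ τ = y := by
    rw [hτ, slopePt, Real.arctan_tan (by linarith) hωπ, show θ + ω = b by rw [hθ, hω]; ring, he]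
  have e2 : slopePt H θ (-τ) = y := by
    rw [hτ, slopePt, Real.arctan_neg, Real.arctan_tan (by linarith) hωπ,
      show θ + -ω = a by rw [hθ, hω]; ring]
  -- A corner at `y` confines `H` to a cone, so a chord of length `δ` parallel to the middle support
  -- line lies at depth at least `τ * δ / 2`.
  have hcone : ∀ z ∈ H, dot (unitVec θ) (z - y) + τ * dot (tangentVec θ) (z - y) ≤ 0 ∧
      dot (unitVec θ) (z - y) - τ * dot (tangentVec θ) (z - y) ≤ 0 := by
    intro z hz
    have h1 := dot_le_slopePt hH θ τ hz
    have h2 := dot_le_slopePt hH θ (-τ) hz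
    rw [slopeG, e1, dot_slopeVec, dot_slopeVec] at h1
    rw [slopeG, e2, dot_slopeVec, dot_slopeVec] at h2
    rw [dot_sub, dot_sub]
    constructor <;> linarith
  -- The chords of `K` and `-K` together descend by at most `τ * δ / 4`, less than the corner forces
  -- on the chord of `H` alone.
  have hc : 0 < τ / 8 := by linarith
  obtain ⟨δ, hδ, ⟨⟨⟨h1, h2⟩, h3⟩, h4⟩⟩ := exists_smallTangent_smul
    (((hs.eventually_height hK θ hc).and ((hs.neg hK).eventually_height hK.neg θ hc)).and
      (hgap θ) |>.and (eventually_mem_smallTangent hH θ))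
  set v := δ • tangentVec θ with hv
  have eu : dot (unitVec θ) v = 0 := by simp [hv, dot_unitVec_tangentVec]
  have et : dot (tangentVec θ) v = δ := by simp [hv, dot_tangentVec_tangentVec]
  have k1 := h1 eu
  have k2 := h2 eu
  rw [et] at k1 k2
  have hsp := chordTop_spec hH (interior_subset h4.2)
  have hsp' := chordTop_spec hH.neg (v := v) (by rw [neg_sub_neg_body]; exact interior_subset h4.2)
  obtain ⟨c1, c2⟩ := hcone _ hsp.1
  obtain ⟨c3, c4⟩ := hcone _ hsp.2.1
  have c5 := dot_le_supportPt hH.neg θ hsp'.1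
  simp only [dot_sub, eu, et] at c1 c2 c3 c4 k1 k2
  have e3 := congrArg (dot (unitVec θ)) (chordGap_eq_iff.1 h3)
  have e4 := congrArg (dot (unitVec θ)) (supportPt_add_neg_eq hK hH hD θ)
  simp only [dot_add] at e3 e4
  rw [hyθ] at e4
  nlinarith

/-! ### Differentiating the extremal chords. -/

/-- The boundary of a smooth body is tangent to its supporting lines. -/
lemma IsSmoothBody.eventually_abs_dot_le {B : Set Plane} (hB : IsStrictBody B)
    (hs : IsSmoothBody B) (θ : ℝ) {c : ℝ} (hc : 0 < c) :
    ∀ᶠ z in 𝓝 (supportPt B θ), z ∈ frontier B →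
      |dot (unitVec θ) (z - supportPt B θ)| ≤ c * ‖z - supportPt B θ‖ := by
  have ha : 0 < Real.arctan c := Real.arctan_pos.2 hc
  filter_upwards [eventually_exists_supportPt_near hB hs θ ha] with z hz hzf
  obtain ⟨ψ, h1, rfl⟩ := hz hzf
  have h2 : |ψ - θ| < Real.pi / 2 := h1.trans (Real.arctan_lt_pi_div_two c)
  have hτ : |Real.tan (ψ - θ)| ≤ c := by
    rw [abs_lt] at h1 h2
    have e := Real.tan_arctan c
    have hlt := Real.arctan_lt_pi_div_two c
    rw [abs_le]
    constructor
    · rw [← e, ← Real.tan_neg]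
      exact (Real.tan_lt_tan_of_lt_of_lt_pi_div_two (by linarith) h2.2 h1.1).le
    · conv_rhs => rw [← e]
      exact (Real.tan_lt_tan_of_lt_of_lt_pi_div_two (by linarith) hlt h1.2).le
  rw [supportPt_eq_slopePt B h2, ← slopePt_zero B θ]
  set τ := Real.tan (ψ - θ)
  obtain ⟨i1, i2⟩ := slopePt_secant_bounds hB (θ := θ) (α := 0) (β := τ)
  rw [zero_mul] at i1
  have e : dot (unitVec θ) (slopePt B θ τ - slopePt B θ 0)
      = -dot (unitVec θ) (slopePt B θ 0 - slopePt B θ τ) := by rw [← dot_neg, neg_sub]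
  rw [e, abs_neg, abs_of_nonneg i1]
  have h3 := abs_dot_le (tangentVec θ) (slopePt B θ τ - slopePt B θ 0)
  rw [norm_tangentVec, one_mul, dot_sub] at h3
  calc _ ≤ τ * (slopeX B θ τ - slopeX B θ 0) := i2
    _ ≤ |τ| * |slopeX B θ τ - slopeX B θ 0| := by rw [← abs_mul]; exact le_abs_self _
    _ ≤ _ := mul_le_mul hτ h3 (abs_nonneg _) hc.le

lemma norm_le_of_slopes {θ α β : ℝ} (h : α < β) (y : Plane) :
    ‖y‖ ≤ (1 + (1 + |α|) / (β - α)) * (|dot (slopeVec θ α) y| + |dot (slopeVec θ β) y|) := by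
  have hΔ : 0 < β - α := by linarith
  have h1 : ‖y‖ ≤ |dot (unitVec θ) y| + |dot (tangentVec θ) y| := by
    conv_lhs => rw [frame_decomp θ y]
    refine (norm_add_le _ _).trans ?_
    rw [norm_smul, norm_smul, norm_unitVec, norm_tangentVec, mul_one, mul_one]
    rfl
  set A := dot (slopeVec θ α) y with hA
  set C := dot (slopeVec θ β) y with hC
  have h2 : |dot (tangentVec θ) y| ≤ (|A| + |C|) / (β - α) := by
    have : dot (tangentVec θ) y = (C - A) / (β - α) := by
      rw [eq_div_iff hΔ.ne', hA, hC, dot_slopeVec, dot_slopeVec]; ring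
    rw [this, abs_div, abs_of_pos hΔ]
    exact div_le_div_of_nonneg_right ((abs_sub _ _).trans (by linarith)) hΔ.le
  have h3 : |dot (unitVec θ) y| ≤ |A| + |α| * |dot (tangentVec θ) y| := by
    have : dot (unitVec θ) y = A - α * dot (tangentVec θ) y := by
      rw [hA, dot_slopeVec]; ring
    rw [this, ← abs_mul]
    exact abs_sub _ _
  have h4 := mul_le_mul_of_nonneg_left h2 (abs_nonneg α)
  have e : (1 + (1 + |α|) / (β - α)) * (|A| + |C|)
      = |A| + |C| + (|A| + |C|) / (β - α) + |α| * ((|A| + |C|) / (β - α)) := by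
    field_simp; ring
  rw [e]
  linarith [abs_nonneg C]

/-- The derivative of the starting point of an extremal chord. -/
noncomputable def chordDeriv (θ : ℝ) (x : ℝ × ℝ) : Plane →L[ℝ] Plane :=
  (-(x.2 - x.1)⁻¹ • dotL (slopeVec θ x.2)).smulRight (tangentVec θ - x.1 • unitVec θ)

lemma chordDeriv_apply (θ : ℝ) (x : ℝ × ℝ) (w : Plane) : chordDeriv θ x w =
    (-(x.2 - x.1)⁻¹ * dot (slopeVec θ x.2) w) • (tangentVec θ - x.1 • unitVec θ) := rfl

lemma hasFDerivAt_chordTop_sub {B : Set Plane} (hB : IsStrictBody B) (hs : IsSmoothBody B)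
    {θ : ℝ} {x : ℝ × ℝ} (hx : x.1 < x.2) {v : Plane} (hv0 : v ≠ 0) (hv : v ∈ interior (B - B))
    (htop : chordTop B v = slopePt B θ x.2) (hstart : chordTop B v - v = slopePt B θ x.1) :
    HasFDerivAt (fun w => chordTop B w - w) (chordDeriv θ x) v := by
  obtain ⟨α, β⟩ := x
  simp only at hx htop hstart
  set L := chordDeriv θ (α, β) with hL
  have hΔ : 0 < β - α := by linarith
  set C := 1 + (1 + |α|) / (β - α) with hCdef
  have hC : 0 < C := by positivity
  have tangent : ∀ τ : ℝ, ∀ c > 0, ∀ᶠ z in 𝓝 (slopePt B θ τ), z ∈ frontier B →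
      |dot (slopeVec θ τ) (z - slopePt B θ τ)| ≤ c * ‖z - slopePt B θ τ‖ := by
    intro τ c hc
    have hq := Real.sqrt_pos.2 (one_add_sq_pos τ)
    have := hs.eventually_abs_dot_le hB (θ + Real.arctan τ) (div_pos hc hq)
    filter_upwards [this] with z hz hzf
    rw [← sqrt_smul_unitVec, smul_dot, abs_mul, abs_of_pos hq]
    have := mul_le_mul_of_nonneg_left (hz hzf) hq.le
    rwa [← mul_assoc, mul_div_cancel₀ _ hq.ne'] at this
  have hct := tendsto_chordTop hB hv0 hv
  have hct' : Filter.Tendsto (fun w => chordTop B w - w) (𝓝 v) (𝓝 (slopePt B θ α)) := by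
    rw [← hstart]
    exact hct.sub Filter.tendsto_id
  rw [htop] at hct
  rw [hasFDerivAt_iff_isLittleO, Asymptotics.isLittleO_iff]
  intro c hc
  -- The first bound lets the error `‖E‖` be absorbed into the left side; the second yields the
  -- final constant `c`.
  set ε := min (1 / (4 * C)) (c / (2 * C * (2 * ‖L‖ + 1))) with hε
  have hLn := norm_nonneg L
  have hε0 : 0 < ε := lt_min (by positivity) (by positivity)
  have hε1 : C * ε * 4 ≤ 1 := by
    have := mul_le_mul_of_nonneg_left (min_le_left (1 / (4 * C)) (c / (2 * C * (2 * ‖L‖ + 1))))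
      (show 0 ≤ 4 * C by positivity)
    rw [mul_one_div_cancel (by positivity)] at this
    linarith
  have hε2 : 2 * C * (2 * ‖L‖ + 1) * ε ≤ c := by
    have := mul_le_mul_of_nonneg_left (min_le_right (1 / (4 * C)) (c / (2 * C * (2 * ‖L‖ + 1))))
      (show 0 ≤ 2 * C * (2 * ‖L‖ + 1) by positivity)
    rwa [mul_div_cancel₀ _ (by positivity)] at this
  have hint : ∀ᶠ w in 𝓝 v, w ∈ interior (B - B) := isOpen_interior.mem_nhds hv
  have hne : ∀ᶠ w in 𝓝 v, w ≠ 0 := isOpen_ne.mem_nhds hv0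
  filter_upwards [hct.eventually (tangent β ε hε0), hct'.eventually (tangent α ε hε0), hint, hne]
    with w h1 h2 h3 h4
  have hfr := (chordTop_spec hB (interior_subset h3)).mem_frontier hB h4
  have h1 := h1 hfr.1
  have h2 := h2 hfr.2
  rw [hstart]
  set X := chordTop B w - w - slopePt B θ α with hX
  have hXw : chordTop B w - slopePt B θ β = X + (w - v) := by
    rw [hX, ← htop, ← hstart]; abel
  rw [hXw] at h1
  -- `E` is the deviation from the linear prediction. Both ends of the chord move almost
  -- tangentially, so `E` pairs to something small with both normals, and two independent pairings
  -- control its norm.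
  set E := X - L (w - v) with hE
  have hEα : dot (slopeVec θ α) E = dot (slopeVec θ α) X := by
    have : dot (slopeVec θ α) (tangentVec θ - α • unitVec θ) = 0 := by
      simp [dot_slopeVec, dot_unitVec_tangentVec, dot_unitVec_unitVec, dot_tangentVec_tangentVec,
        dot_tangentVec_unitVec]
    rw [hE, dot_sub, hL, chordDeriv_apply, dot_smul, this, mul_zero, sub_zero]
  have hEβ : dot (slopeVec θ β) E = dot (slopeVec θ β) (X + (w - v)) := by
    have : dot (slopeVec θ β) (tangentVec θ - α • unitVec θ) = β - α := by
      simp [dot_slopeVec, dot_unitVec_tangentVec, dot_unitVec_unitVec, dot_tangentVec_tangentVec,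
        dot_tangentVec_unitVec]
    rw [hE, dot_sub, hL, chordDeriv_apply, dot_smul, this, dot_add]
    simp only
    field_simp
    ring
  have h5 := norm_le_of_slopes (θ := θ) hx E
  rw [hEα, hEβ, ← hCdef] at h5
  have h6 : ‖X‖ ≤ ‖E‖ + ‖L‖ * ‖w - v‖ := by
    have : X = E + L (w - v) := by rw [hE]; abel
    calc ‖X‖ ≤ ‖E‖ + ‖L (w - v)‖ := by rw [this]; exact norm_add_le _ _
      _ ≤ _ := by gcongr; exact L.le_opNorm _
  have h7 : ‖X + (w - v)‖ ≤ ‖X‖ + ‖w - v‖ := norm_add_le _ _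
  have h8 : ‖E‖ ≤ C * ε * (2 * ‖E‖ + (2 * ‖L‖ + 1) * ‖w - v‖) := by
    refine h5.trans ?_
    rw [mul_assoc]
    refine mul_le_mul_of_nonneg_left ?_ hC.le
    have h9 := mul_le_mul_of_nonneg_left h6 hε0.le
    have h10 := mul_le_mul_of_nonneg_left h7 hε0.le
    linarith
  have h9 : C * ε * (2 * ‖E‖) ≤ ‖E‖ / 2 := by nlinarith [norm_nonneg E]
  have h10 := mul_le_mul_of_nonneg_right hε2 (norm_nonneg (w - v))
  linarith

/-- The slopes of the normals at the end points of the chords with a common direction vector of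
two bodies and of their reflections are related if the chord gaps agree near that vector. -/
lemma chordSlopes_identity {K H : Set Plane} (hK : IsStrictBody K) (hH : IsStrictBody H)
    (hD : K - K = H - H) (hsK : IsSmoothBody K) (hsH : IsSmoothBody H) {θ : ℝ} {v : Plane}
    (hv0 : v ≠ 0) (hv : v ∈ interior (K - K)) (hgap : ∀ᶠ w in 𝓝 v, chordGap K w = chordGap H w)
    {a b c d : ℝ × ℝ} (ha : a.1 < a.2) (hb : b.1 < b.2) (hc : c.1 < c.2) (hd : d.1 < d.2)
    (ha1 : chordTop K v = slopePt K θ a.2) (ha2 : chordTop K v - v = slopePt K θ a.1)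
    (hb1 : chordTop (-K) v = slopePt (-K) θ b.2) (hb2 : chordTop (-K) v - v = slopePt (-K) θ b.1)
    (hc1 : chordTop H v = slopePt H θ c.2) (hc2 : chordTop H v - v = slopePt H θ c.1)
    (hd1 : chordTop (-H) v = slopePt (-H) θ d.2)
    (hd2 : chordTop (-H) v - v = slopePt (-H) θ d.1) :
    (1 / (a.2 - a.1) + 1 / (b.2 - b.1) = 1 / (c.2 - c.1) + 1 / (d.2 - d.1)) ∧
    (a.1 / (a.2 - a.1) + b.1 / (b.2 - b.1) = c.1 / (c.2 - c.1) + d.1 / (d.2 - d.1)) ∧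
    (a.2 / (a.2 - a.1) + b.2 / (b.2 - b.1) = c.2 / (c.2 - c.1) + d.2 / (d.2 - d.1)) ∧
    (a.1 * a.2 / (a.2 - a.1) + b.1 * b.2 / (b.2 - b.1)
      = c.1 * c.2 / (c.2 - c.1) + d.1 * d.2 / (d.2 - d.1)) := by
  have hvH : v ∈ interior (H - H) := hD ▸ hv
  have h1 := hasFDerivAt_chordTop_sub hK hsK ha hv0 hv ha1 ha2
  have h2 := hasFDerivAt_chordTop_sub hK.neg (hsK.neg hK) hb hv0
    (by rwa [neg_sub_neg_body]) hb1 hb2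
  have h3 := hasFDerivAt_chordTop_sub hH hsH hc hv0 hvH hc1 hc2
  have h4 := hasFDerivAt_chordTop_sub hH.neg (hsH.neg hH) hd hv0
    (by rwa [neg_sub_neg_body]) hd1 hd2
  have h5 := (h1.add h2).unique ((h3.add h4).congr_of_eventuallyEq (by
    filter_upwards [hgap] with w hw
    have := chordGap_eq_iff.1 hw
    simp only [Pi.add_apply]
    rw [show chordTop K w - w + (chordTop (-K) w - w)
      = (chordTop K w + chordTop (-K) w) - w - w by abel, this]
    abel))
  have e1 : ∀ τ, dot (slopeVec θ τ) (unitVec θ) = 1 := fun τ => by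
    simp [dot_slopeVec, dot_unitVec_unitVec, dot_tangentVec_unitVec]
  have e2 : ∀ τ, dot (slopeVec θ τ) (tangentVec θ) = τ := fun τ => by
    simp [dot_slopeVec, dot_unitVec_tangentVec, dot_tangentVec_tangentVec]
  have e3 : ∀ τ : ℝ, dot (unitVec θ) (tangentVec θ - τ • unitVec θ) = -τ := fun τ => by
    simp [dot_unitVec_tangentVec, dot_unitVec_unitVec]
  have e4 : ∀ τ : ℝ, dot (tangentVec θ) (tangentVec θ - τ • unitVec θ) = 1 := fun τ => by
    simp [dot_tangentVec_tangentVec, dot_tangentVec_unitVec]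
  have key : ∀ w n, dot n (chordDeriv θ a w) + dot n (chordDeriv θ b w)
      = dot n (chordDeriv θ c w) + dot n (chordDeriv θ d w) := by
    intro w n
    have := congrArg (fun F : Plane →L[ℝ] Plane => dot n (F w)) h5
    simpa only [_root_.add_apply, dot_add] using this
  -- The four matrix entries of the derivative identity in the frame at `θ`.
  have k1 := key (unitVec θ) (tangentVec θ)
  have k2 := key (unitVec θ) (unitVec θ)
  have k3 := key (tangentVec θ) (tangentVec θ)
  have k4 := key (tangentVec θ) (unitVec θ)
  simp only [chordDeriv_apply, dot_smul, e1, e2, e3, e4] at k1 k2 k3 k4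
  simp only [div_eq_mul_inv]
  refine ⟨by linarith, by linarith, by linarith, by linarith⟩

/-! ### Radii of curvature of the second body. -/

/-- The relative offset of the average of the slopes at the end points of a chord. -/
noncomputable def slopeOffset (B : Set Plane) (θ : ℝ) (x : ℝ × ℝ) : ℝ :=
  trapError (slopeG B θ) (slopeX B θ) x / avgSlope (slopeX B θ) x

lemma avgSlope_of_chord {B : Set Plane} {θ : ℝ} {x : ℝ × ℝ} {v : Plane}
    (hv : slopePt B θ x.2 - slopePt B θ x.1 = v) :
    avgSlope (slopeX B θ) x = dot (tangentVec θ) v / (x.2 - x.1) := by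
  rw [avgSlope, ← hv, dot_sub]; rfl

/-- The slope of the chord's normal is minus the slope of the chord, so the numerator is the
distance from that normal to the mean of the end normals. -/
lemma slopeOffset_of_chord {B : Set Plane} {θ : ℝ} {x : ℝ × ℝ} {v : Plane} (hx : x.1 < x.2)
    (hv : slopePt B θ x.2 - slopePt B θ x.1 = v) (hpos : 0 < dot (tangentVec θ) v) :
    slopeOffset B θ x =
      ((x.1 + x.2) / 2 + dot (unitVec θ) v / dot (tangentVec θ) v) / (x.2 - x.1) := by
  have hΔ : 0 < x.2 - x.1 := by linarith
  have e : trapError (slopeG B θ) (slopeX B θ) x = _ := trapError_slope B θ x.1 x.2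
  have e1 : slopeX B θ x.2 - slopeX B θ x.1 = dot (tangentVec θ) v := by rw [← hv, dot_sub]; rfl
  have e2 : dot (unitVec θ) (slopePt B θ x.1 - slopePt B θ x.2) = -dot (unitVec θ) v := by
    rw [← hv, ← dot_neg, neg_sub]
  rw [slopeOffset, avgSlope_of_chord hv, e, e1, e2]
  field_simp
  ring

/-- In this form the quantity is linear in the four expressions of `chordSlopes_identity`, with
coefficients depending only on the common chord vector. -/
lemma quarter_sub_sq_div {α β δ s y κ : ℝ} (h : α < β) (hδ : 0 < δ) (hy : y = δ / (β - α))
    (hκ : κ = ((α + β) / 2 + s) / (β - α)) :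
    (1 / 4 - κ ^ 2) / y =
      -(s * (α / (β - α) + β / (β - α)) + s ^ 2 * (1 / (β - α)) + α * β / (β - α)) / δ := by
  have hΔ : β - α ≠ 0 := by linarith
  rw [hy, hκ]
  field_simp
  ring

/-- Small chords of `H` have partner chords of `-H`, `K` and `-K` with the same direction vector,
and their average slopes and offsets are related. -/
lemma exists_partner_chords {K H : Set Plane} (hK : IsStrictBody K) (hH : IsStrictBody H)
    (hD : K - K = H - H) (hsK : IsSmoothBody K) (hsH : IsSmoothBody H) {θ : ℝ}
    (hgap : ∀ᶠ v in smallTangent θ, chordGap K v = chordGap H v) :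
    ∃ a b d : ℝ × ℝ → ℝ × ℝ, Filter.Tendsto a smallIntervals smallIntervals ∧
      Filter.Tendsto b smallIntervals smallIntervals ∧
      Filter.Tendsto d smallIntervals smallIntervals ∧
      ∀ᶠ x in smallIntervals,
        avgSlope (slopeX H θ) x + avgSlope (slopeX (-H) θ) (d x)
          = avgSlope (slopeX K θ) (a x) + avgSlope (slopeX (-K) θ) (b x) ∧
        slopeOffset H θ x + slopeOffset (-H) θ (d x)
          = slopeOffset K θ (a x) + slopeOffset (-K) θ (b x) ∧
        (1 / 4 - slopeOffset H θ x ^ 2) / avgSlope (slopeX H θ) x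
          + (1 / 4 - slopeOffset (-H) θ (d x) ^ 2) / avgSlope (slopeX (-H) θ) (d x)
          = (1 / 4 - slopeOffset K θ (a x) ^ 2) / avgSlope (slopeX K θ) (a x)
          + (1 / 4 - slopeOffset (-K) θ (b x) ^ 2) / avgSlope (slopeX (-K) θ) (b x) := by
  obtain ⟨A, hA, hA'⟩ := exists_chordSlopes hK hsK θ
  obtain ⟨B, hB, hB'⟩ := exists_chordSlopes hK.neg (hsK.neg hK) θ
  obtain ⟨D, hD', hD''⟩ := exists_chordSlopes hH.neg (hsH.neg hH) θ
  have hV := tendsto_slopePt_sub hH hsH θ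
  set V : ℝ × ℝ → Plane := fun x => slopePt H θ x.2 - slopePt H θ x.1 with hVdef
  refine ⟨A ∘ V, B ∘ V, D ∘ V, hA.comp hV, hB.comp hV, hD'.comp hV, ?_⟩
  have hlt : ∀ᶠ x : ℝ × ℝ in smallIntervals, x.1 < x.2 :=
    eventually_smallIntervals.2 ⟨1, one_pos, fun _ _ _ h _ => h⟩
  have hpos : ∀ᶠ v in smallTangent θ, 0 < dot (tangentVec θ) v :=
    eventually_smallTangent.2 ⟨1, one_pos, fun v h _ _ => h⟩
  filter_upwards [hV.eventually hA', hV.eventually hB', hV.eventually hD'', hlt,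
    hV.eventually (hA.eventually hlt), hV.eventually (hB.eventually hlt),
    hV.eventually (hD'.eventually hlt), hV.eventually hpos,
    hV.eventually (eventually_mem_smallTangent hK θ),
    hV.eventually (eventually_eventually_smallTangent hgap)]
    with x hA' hB' hD'' hx ha hb hd hp hv hg
  simp only [Function.comp_apply]
  set v := V x with hv'
  have hH1 : chordTop H v = slopePt H θ x.2 := chordTop_slopePt hH hsH hx
  have hH2 : chordTop H v - v = slopePt H θ x.1 := by
    rw [hH1, hv', hVdef]; exact sub_sub_cancel _ _
  obtain ⟨i1, i2, i3, i4⟩ := chordSlopes_identity hK hH hD hsK hsH hv.1 hv.2 hg ha hb hx hd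
    hA'.1 hA'.2 hB'.1 hB'.2 hH1 hH2 hD''.1 hD''.2
  have ca : slopePt K θ (A v).2 - slopePt K θ (A v).1 = v := by rw [← hA'.1, ← hA'.2]; abel
  have cb : slopePt (-K) θ (B v).2 - slopePt (-K) θ (B v).1 = v := by
    rw [← hB'.1, ← hB'.2]; abel
  have cd : slopePt (-H) θ (D v).2 - slopePt (-H) θ (D v).1 = v := by
    rw [← hD''.1, ← hD''.2]; abel
  have ya := avgSlope_of_chord ca
  have yb := avgSlope_of_chord cb
  have yd := avgSlope_of_chord cd
  have yx := avgSlope_of_chord (B := H) (θ := θ) (x := x) (v := v) rfl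
  have ka := slopeOffset_of_chord ha ca hp
  have kb := slopeOffset_of_chord hb cb hp
  have kd := slopeOffset_of_chord hd cd hp
  have kx := slopeOffset_of_chord (B := H) (θ := θ) (x := x) (v := v) hx rfl hp
  refine ⟨?_, ?_, ?_⟩
  · rw [ya, yb, yd, yx, div_eq_mul_one_div, div_eq_mul_one_div (dot (tangentVec θ) v) (_ - _),
      div_eq_mul_one_div (dot (tangentVec θ) v) ((A v).2 - _),
      div_eq_mul_one_div (dot (tangentVec θ) v) ((B v).2 - _), ← mul_add, ← mul_add, i1]
  · rw [ka, kb, kd, kx]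
    have e : ∀ α β s : ℝ, ((α + β) / 2 + s) / (β - α)
        = (α / (β - α) + β / (β - α)) / 2 + s * (1 / (β - α)) := by intros; ring
    rw [e, e, e, e]
    linear_combination (-(dot (unitVec θ) v / dot (tangentVec θ) v)) * i1 - i2 / 2 - i3 / 2
  · rw [quarter_sub_sq_div ha hp ya ka, quarter_sub_sq_div hb hp yb kb,
      quarter_sub_sq_div hd hp yd kd, quarter_sub_sq_div hx hp yx kx]
    set s := dot (unitVec θ) v / dot (tangentVec θ) v
    linear_combination (s ^ 2 * i1 + s * i2 + s * i3 + i4) / dot (tangentVec θ) v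

lemma abs_slopeOffset_le {B : Set Plane} (hB : IsStrictBody B) (hs : IsSmoothBody B) (θ : ℝ)
    {x : ℝ × ℝ} (hx : x.1 < x.2) : |slopeOffset B θ x| ≤ 1 / 2 := by
  have h1 := avgSlope_pos (strictMono_slopeX hB hs θ) hx
  have h2 := abs_trapError_le_avgSlope (monotone_slopeX hB θ) (hasDerivAt_slopeG hB θ) hx
  rw [slopeOffset, abs_div, abs_of_pos h1, div_le_iff₀ h1]
  linarith

lemma tendsto_slopeOffset {B : Set Plane} (hB : IsStrictBody B) {θ r : ℝ} (hr : 0 < r)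
    (h : HasStrictDerivAt (slopeX B θ) r 0) :
    Filter.Tendsto (slopeOffset B θ) smallIntervals (𝓝 0) := by
  have := (h.tendsto_trapError (hasDerivAt_slopeG hB θ)).div h.tendsto_avgSlope hr.ne'
  rwa [zero_div] at this

/-- For `K` and `-K` the offsets tend to 0 and the slopes to `p₁`, `p₂`. The three partner
identities become `L + L' = p₁ + p₂`, `k + k' = 0` and, with denominators cleared, a relation giving
the product `L * L'`. -/
lemma slopesLinked_of_gap {K H : Set Plane} (hK : IsStrictBody K) (hH : IsStrictBody H)
    (hD : K - K = H - H) (hsK : IsSmoothBody K) (hsH : IsSmoothBody H) {θ p₁ p₂ : ℝ}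
    (hp₁ : 0 < p₁) (hp₂ : 0 < p₂)
    (hgap : ∀ᶠ v in smallTangent θ, chordGap K v = chordGap H v)
    (h₁ : HasStrictDerivAt (slopeX K θ) p₁ 0) (h₂ : HasStrictDerivAt (slopeX (-K) θ) p₂ 0) :
    SlopesLinked p₁ p₂ (slopeG H θ) (slopeX H θ) (slopeX (-H) θ) ∧
      ∀ᶠ x in smallIntervals, avgSlope (slopeX H θ) x ≤ p₁ + p₂ + 1 := by
  obtain ⟨a, b, d, ha, hb, hd, hid⟩ := exists_partner_chords hK hH hD hsK hsH hgap
  have hlt : ∀ᶠ x : ℝ × ℝ in smallIntervals, x.1 < x.2 :=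
    eventually_smallIntervals.2 ⟨1, one_pos, fun _ _ _ h _ => h⟩
  have ya := h₁.tendsto_avgSlope.comp ha
  have yb := h₂.tendsto_avgSlope.comp hb
  have ka := (tendsto_slopeOffset hK hp₁ h₁).comp ha
  have kb := (tendsto_slopeOffset hK.neg hp₂ h₂).comp hb
  have mH := strictMono_slopeX hH hsH θ
  have mH' := strictMono_slopeX hH.neg (hsH.neg hH) θ
  have hC : ∀ᶠ x in smallIntervals, avgSlope (slopeX H θ) x ≤ p₁ + p₂ + 1 := by
    filter_upwards [hid, hd.eventually hlt, (ya.add yb).eventually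
      (gt_mem_nhds (show p₁ + p₂ < p₁ + p₂ + 1 by linarith))] with x h1 h2 h3
    have h4 := avgSlope_pos mH' h2
    simp only [Function.comp_apply] at h3
    linarith [h1.1]
  refine ⟨fun U hU => ?_, hC⟩
  have hlim : ∀ {f : ℝ × ℝ → ℝ} {l u : ℝ}, (∀ᶠ x in smallIntervals, l ≤ f x ∧ f x ≤ u) →
      ∃ L, Filter.Tendsto f U (𝓝 L) := by
    intro f l u hf
    obtain ⟨L, -, hL⟩ := (isCompact_Icc (a := l) (b := u)).ultrafilter_le_nhds (U.map f)
      (Filter.le_principal_iff.2 (hU hf))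
    exact ⟨L, hL⟩
  obtain ⟨L, hL⟩ := hlim (l := 0) (u := p₁ + p₂ + 1) (f := avgSlope (slopeX H θ)) (by
    filter_upwards [hC, hlt] with x h1 h2
    exact ⟨(avgSlope_pos mH h2).le, h1⟩)
  obtain ⟨k, hk⟩ := hlim (l := -(1 / 2)) (u := 1 / 2) (f := slopeOffset H θ) (by
    filter_upwards [hlt] with x h2
    exact abs_le.1 (abs_slopeOffset_le hH hsH θ h2))
  have yd : Filter.Tendsto (fun x => avgSlope (slopeX (-H) θ) (d x)) U (𝓝 (p₁ + p₂ - L)) := by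
    refine (((ya.add yb).mono_left hU).sub hL).congr' ?_
    filter_upwards [hU hid] with x hx
    simp only [Function.comp_apply]
    linarith [hx.1]
  have kd : Filter.Tendsto (fun x => slopeOffset (-H) θ (d x)) U (𝓝 (-k)) := by
    have : Filter.Tendsto (fun x => slopeOffset (-H) θ (d x)) U (𝓝 (0 + 0 - k)) := by
      refine (((ka.add kb).mono_left hU).sub hk).congr' ?_
      filter_upwards [hU hid] with x hx
      simp only [Function.comp_apply]
      linarith [hx.2.1]
    simpa using this
  refine ⟨U.map d, L, k, ?_, hL, hk, yd, ?_⟩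
  · exact (Filter.map_mono hU).trans hd
  have hZ := ((tendsto_const_nhds (x := (1 / 4 : ℝ))).sub (ka.pow 2)).div ya hp₁.ne'
  have hZ' := ((tendsto_const_nhds (x := (1 / 4 : ℝ))).sub (kb.pow 2)).div yb hp₂.ne'
  have hl := ((hZ.add hZ').mono_left hU).mul (hL.mul yd)
  have hr := (((tendsto_const_nhds (x := (1 / 4 : ℝ))).sub (hk.pow 2)).mul yd).add
    (((tendsto_const_nhds (x := (1 / 4 : ℝ))).sub (kd.pow 2)).mul hL)
  -- The identity is multiplied by both slopes before passing to the limit, since `L` or `p₁ + p₂ -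
  -- L` might vanish.
  have he := tendsto_nhds_unique hl (hr.congr' (by
    filter_upwards [hU hid, hU hlt, hU (hd.eventually hlt)] with x h1 h2 h3
    have i1 := (avgSlope_pos mH h2).ne'
    have i2 := (avgSlope_pos mH' h3).ne'
    simp only [Function.comp_apply, Pi.div_apply]
    rw [← h1.2.2]
    field_simp))
  have hp₁' := hp₁.ne'
  have hp₂' := hp₂.ne'
  have hP : p₁ + p₂ ≠ 0 := by positivity
  field_simp at he
  have h5 : (p₁ + p₂) * (L * (p₁ + p₂ - L)) = (p₁ + p₂) * ((1 - 4 * k ^ 2) * (p₁ * p₂)) := by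
    linear_combination he
  exact mul_left_cancel₀ hP h5

lemma hasStrictDerivAt_slopeX {B : Set Plane} {θ r : ℝ}
    (h : HasStrictDerivAt (supportPt B) (r • tangentVec θ) θ) :
    HasStrictDerivAt (slopeX B θ) r 0 := by
  have h1 : HasStrictDerivAt (fun τ => θ + Real.arctan τ) 1 0 := by
    have := (Real.hasStrictDerivAt_arctan 0).const_add θ
    simpa using this
  have h2 : HasStrictDerivAt (supportPt B) (r • tangentVec θ) (θ + Real.arctan 0) := by
    simpa using h
  have h3 := (dotL (tangentVec θ)).hasStrictFDerivAt.comp_hasStrictDerivAt 0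
    (h2.scomp (0 : ℝ) h1)
  have e : dotL (tangentVec θ) ((1 : ℝ) • r • tangentVec θ) = r := by
    simp [dot_tangentVec_tangentVec]
  rw [e] at h3
  exact h3

lemma hasStrictDerivAt_supportPt_of_slopeX {B : Set Plane} (hB : IsStrictBody B) {θ r : ℝ}
    (h : HasStrictDerivAt (slopeX B θ) r 0) :
    HasStrictDerivAt (supportPt B) (r • tangentVec θ) θ := by
  have hG : HasStrictDerivAt (slopeG B θ) (slopeX B θ 0) 0 :=
    hasStrictDerivAt_of_hasDerivAt_of_continuousAt
      (Filter.Eventually.of_forall fun τ => hasDerivAt_slopeG hB θ τ)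
      (continuous_slopeX hB θ).continuousAt
  have h1 : HasStrictDerivAt (slopePt B θ) (r • tangentVec θ) 0 := by
    have h2 : HasStrictDerivAt (fun τ => slopeG B θ τ - τ * slopeX B θ τ) 0 0 := by
      have := hG.sub ((hasStrictDerivAt_id (0 : ℝ)).mul h)
      simp only [id, one_mul, zero_mul, add_zero, sub_self] at this
      exact this
    have h3 := (h2.smul_const (unitVec θ)).add (h.smul_const (tangentVec θ))
    rw [zero_smul, zero_add] at h3
    refine h3.congr_of_eventuallyEq (Filter.Eventually.of_forall fun τ => ?_)
    simp only [Pi.add_apply]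
    rw [slopeG, dot_slopeVec, slopeX, add_sub_cancel_right]
    exact (frame_decomp θ _).symm
  have h2 : HasStrictDerivAt (fun ψ => Real.tan (ψ - θ)) 1 θ := by
    have h3 : HasStrictDerivAt Real.tan 1 (θ - θ) := by
      have := Real.hasStrictDerivAt_tan (x := 0) (by simp)
      simpa using this
    have h4 : HasStrictDerivAt (fun ψ : ℝ => ψ - θ) 1 θ := (hasStrictDerivAt_id θ).sub_const θ
    have h5 := HasStrictDerivAt.comp (h := fun ψ : ℝ => ψ - θ) θ h3 h4
    rwa [mul_one] at h5
  have h3 : HasStrictDerivAt (slopePt B θ) (r • tangentVec θ) (Real.tan (θ - θ)) := by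
    simpa using h1
  have h4 := h3.scomp θ h2
  rw [one_smul] at h4
  refine h4.congr_of_eventuallyEq ?_
  filter_upwards [Metric.ball_mem_nhds θ (half_pos Real.pi_pos)] with ψ hψ
  exact (supportPt_eq_slopePt B (by rwa [Metric.mem_ball, Real.dist_eq] at hψ)).symm

lemma hasStrictDerivAt_supportPt_neg {B : Set Plane} (hB : IsStrictBody B) {θ r : ℝ}
    (h : HasStrictDerivAt (supportPt B) (r • tangentVec (θ + Real.pi)) (θ + Real.pi)) :
    HasStrictDerivAt (supportPt (-B)) (r • tangentVec θ) θ := by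
  have h1 := (h.scomp θ ((hasStrictDerivAt_id θ).add_const Real.pi)).neg
  rw [one_smul, tangentVec_add_pi, smul_neg, neg_neg] at h1
  exact h1.congr_of_eventuallyEq (Filter.Eventually.of_forall fun ψ => (supportPt_neg hB ψ).symm)

/-- The radius of curvature of `H` at a direction is one of the radii of curvature of `K` at this
direction and its opposite. -/
lemma hasStrictDerivAt_of_gap {K H : Set Plane} (hK : IsStrictBody K) (hH : IsStrictBody H)
    (hD : K - K = H - H) (hsK : IsSmoothBody K)
    (hgap : ∀ θ, ∀ᶠ v in smallTangent θ, chordGap K v = chordGap H v) {r : ℝ → ℝ}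
    (hr : ∀ θ, 0 < r θ) (hder : ∀ θ, HasStrictDerivAt (supportPt K) (r θ • tangentVec θ) θ)
    (θ : ℝ) : HasStrictDerivAt (supportPt H) (r θ • tangentVec θ) θ ∨
      HasStrictDerivAt (supportPt H) (r (θ + Real.pi) • tangentVec θ) θ := by
  have hsH := isSmoothBody_of_gap hK hH hD hsK hgap
  have h₁ := hasStrictDerivAt_slopeX (hder θ)
  have h₂ := hasStrictDerivAt_slopeX (hasStrictDerivAt_supportPt_neg hK (hder (θ + Real.pi)))
  obtain ⟨l₁, c₁⟩ := slopesLinked_of_gap hK hH hD hsK hsH (hr _) (hr _) (hgap θ) h₁ h₂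
  obtain ⟨l₂, c₂⟩ := slopesLinked_of_gap hK hH.neg (by rwa [neg_sub_neg_body]) hsK (hsH.neg hH)
    (hr _) (hr _) (by simpa only [chordGap_neg_body] using hgap θ) h₁ h₂
  rw [neg_neg] at l₂
  refine (l₁.tendsto l₂ (hr _) (hr _) (strictMono_slopeX hH hsH θ)
    (strictMono_slopeX hH.neg (hsH.neg hH) θ) (continuous_slopeX hH θ) (hasDerivAt_slopeG hH θ)
    (hasDerivAt_slopeG hH.neg θ) c₁ c₂).imp (fun h => ?_) fun h => ?_
  · exact hasStrictDerivAt_supportPt_of_slopeX hH (hasStrictDerivAt_of_tendsto_avgSlope h)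
  · exact hasStrictDerivAt_supportPt_of_slopeX hH (hasStrictDerivAt_of_tendsto_avgSlope h)

/-! ### Curves on the boundary, translations and chord comparison. -/

/-- Strict differentiability at `x` makes `f` minus its linear part Lipschitz near `x` with a small
constant, which bounds the change of the derivative. -/
lemma continuous_of_hasStrictDerivAt {E : Type*} [NormedAddCommGroup E] [NormedSpace ℝ E]
    {f f' : ℝ → E} (h : ∀ x, HasStrictDerivAt f (f' x) x) : Continuous f' := by
  rw [continuous_iff_continuousAt]
  intro x
  rw [ContinuousAt, Metric.tendsto_nhds]
  intro c hc
  have h1 := (h x).isLittleO.def (half_pos hc)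
  obtain ⟨η, hη, h1⟩ := Metric.eventually_nhds_iff.1 h1
  filter_upwards [Metric.ball_mem_nhds x hη] with y hy
  have hd : HasDerivAt (fun z => f z - z • f' x) (f' y - f' x) y := by
    have := (h y).hasDerivAt.sub ((hasDerivAt_id y).smul_const (f' x))
    rwa [one_smul] at this
  rw [dist_eq_norm]
  refine (hd.le_of_lip' (half_pos hc).le ?_).trans_lt (half_lt_self hc)
  filter_upwards [Metric.isOpen_ball.mem_nhds hy] with z hz
  have := @h1 (z, y) (by rw [Prod.dist_eq]; exact max_lt hz hy)
  simp only [ContinuousLinearMap.toSpanSingleton_apply] at this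
  rwa [show f z - z • f' x - (f y - y • f' x) = f z - f y - (z - y) • f' x by
    rw [sub_smul]; abel]

/-- A curve on the boundary of a strictly convex body `C` which has tangent direction
`tangentVec θ` at a point passes through the support point of `C` at `θ`. -/
lemma eq_supportPt_of_curve {C : Set Plane} (hC : IsStrictBody C) {f : ℝ → Plane} {x r θ : ℝ}
    (hr : r ≠ 0) (hf : HasDerivAt f (r • tangentVec θ) x) (hfr : f x ∈ frontier C)
    (hmem : ∀ᶠ y in 𝓝 x, f y ∈ C) (hz : ∃ z ∈ C, dot (unitVec θ) z < dot (unitVec θ) (f x)) :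
    f x = supportPt C θ := by
  obtain ⟨φ, -, hφ⟩ := exists_eq_supportPt hC hfr 0
  have hmax : IsLocalMax (fun y => dot (unitVec φ) (f y)) x := by
    filter_upwards [hmem] with y hy
    rw [hφ]
    exact dot_le_supportPt hC φ hy
  have hd : HasDerivAt (fun y => dot (unitVec φ) (f y)) (dot (unitVec φ) (r • tangentVec θ)) x :=
    (dotL (unitVec φ)).hasFDerivAt.comp_hasDerivAt x hf
  have h0 := hmax.hasDerivAt_eq_zero hd
  -- The normal at `f x` is orthogonal to the curve, so it is `unitVec θ` or its opposite; the point
  -- `z` excludes the opposite.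
  rw [dot_smul, dot_unitVec_tangentVec, mul_eq_zero, or_iff_right hr] at h0
  have hu : unitVec φ = Real.cos (φ - θ) • unitVec θ := by
    rw [frame_decomp θ (unitVec φ), dot_unitVec_unitVec, dot_tangentVec_unitVec, h0, zero_smul,
      add_zero, ← Real.cos_neg, neg_sub]
  rcases Real.sin_eq_zero_iff_cos_eq.1 h0 with h1 | h1
  · rw [h1, one_smul] at hu
    rw [hφ, supportPt_congr hu]
  · exfalso
    obtain ⟨z, hz, hlt⟩ := hz
    have := dot_le_supportPt hC φ hz
    rw [← hφ, hu, h1] at this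
    simp only [smul_dot] at this
    linarith

/-- A chord whose vector is on the boundary of the difference body has opposite normals at its ends,
but these normals are less than π apart. -/
lemma supportPt_sub_mem_interior {B : Set Plane} (hB : IsStrictBody B) (hs : IsSmoothBody B)
    {a b : ℝ} (hab : a < b) (hba : b < a + Real.pi) :
    supportPt B b - supportPt B a ∈ interior (B - B) := by
  by_contra hv
  set v := supportPt B b - supportPt B a with hvdef
  have hDc : Convex ℝ (B - B) := hB.convex.sub hB.convex
  obtain ⟨f, hf⟩ := geometric_hahn_banach_open_point hDc.interior isOpen_interior hv
  obtain ⟨n, hn⟩ := clm_eq_dot f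
  obtain ⟨θ, -, hnθ⟩ := exists_polar n 0
  have h0 := zero_mem_interior_sub_self hB
  have e' : ∀ y, dot n y = ‖n‖ * dot (unitVec θ) y := by
    intro y; conv_lhs => rw [hnθ]
    rw [smul_dot]
  have hle : ∀ w ∈ B - B, dot (unitVec θ) w ≤ dot (unitVec θ) v := by
    intro w hw
    have hcl : w ∈ closure (interior (B - B)) := by
      rw [hDc.closure_interior_eq_closure_of_nonempty_interior ⟨0, h0⟩]
      exact subset_closure hw
    exact closure_minimal (fun a ha => by
      have := hf a ha; rw [hn, hn, e', e'] at this
      exact (lt_of_mul_lt_mul_left this (norm_nonneg _)).le)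
      (isClosed_le (by fun_prop) continuous_const :
        IsClosed {w | dot (unitVec θ) w ≤ dot (unitVec θ) v}) hcl
  have hb : supportPt B b = supportPt B θ := by
    refine eq_supportPt hB (supportPt_mem hB b) ?_
    have := hle (supportPt B θ - supportPt B a) ⟨_, supportPt_mem hB θ, _, supportPt_mem hB a, rfl⟩
    rw [hvdef, dot_sub, dot_sub] at this
    linarith
  have ha : supportPt B a = supportPt B (θ + Real.pi) := by
    refine eq_supportPt hB (supportPt_mem hB a) ?_
    have := hle (supportPt B b - supportPt B (θ + Real.pi))
      ⟨_, supportPt_mem hB b, _, supportPt_mem hB _, rfl⟩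
    rw [hvdef, dot_sub, dot_sub] at this
    rw [unitVec_add_pi, neg_dot, neg_dot]
    linarith
  have h1 := hs _ _ hb
  have h2 := hs _ _ ha
  rw [unitVec_add_pi, ← h1] at h2
  have h3 := dot_unitVec_tangentVec b a
  have h4 := dot_unitVec_tangentVec a a
  rw [h2, neg_dot, h3, sub_self, Real.sin_zero, neg_eq_zero] at h4
  exact absurd h4 (Real.sin_pos_of_pos_of_lt_pi (by linarith) (by linarith)).ne'

lemma subset_of_dot_le_supportPt {A B : Set Plane} (hB : IsStrictBody B)
    (h : ∀ θ, ∀ w ∈ A, dot (unitVec θ) w ≤ dot (unitVec θ) (supportPt B θ)) : A ⊆ B := by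
  intro w hw
  by_contra hwB
  obtain ⟨f, u, hf, hu⟩ := geometric_hahn_banach_closed_point hB.convex hB.isClosed hwB
  obtain ⟨n, hn⟩ := clm_eq_dot f
  obtain ⟨θ, -, hnθ⟩ := exists_polar n 0
  have h1 := (hf _ (supportPt_mem hB θ)).trans hu
  rw [hn, hn, hnθ, smul_dot, smul_dot] at h1
  exact absurd (lt_of_mul_lt_mul_left h1 (norm_nonneg _)) (not_lt.2 (h θ w hw))

lemma eq_of_supportPt_eq {A B : Set Plane} (hA : IsStrictBody A) (hB : IsStrictBody B)
    (h : ∀ θ, supportPt A θ = supportPt B θ) : A = B :=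
  Subset.antisymm
    (subset_of_dot_le_supportPt hB fun θ _ hw => h θ ▸ dot_le_supportPt hA θ hw)
    (subset_of_dot_le_supportPt hA fun θ _ hw => (h θ).symm ▸ dot_le_supportPt hB θ hw)

section translate
variable {B : Set Plane} (hB : IsStrictBody B) (w : Plane)
include hB

lemma IsStrictBody.vadd : IsStrictBody (w +ᵥ B) where
  isCompact := hB.isCompact.vadd w
  strictConvex := hB.strictConvex.vadd w
  nonempty_interior := by
    rw [interior_vadd]
    exact hB.nonempty_interior.vadd_set

lemma supportPt_vadd (θ : ℝ) : supportPt (w +ᵥ B) θ = w + supportPt B θ := by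
  symm
  apply eq_supportPt (hB.vadd w) (vadd_mem_vadd_set (supportPt_mem hB θ))
  obtain ⟨y, hy, e⟩ := supportPt_mem (hB.vadd w) θ
  rw [← e]
  simp only [vadd_eq_add, dot_add]
  linarith [dot_le_supportPt hB θ hy]

lemma chordTop_vadd {v : Plane} (hv0 : v ≠ 0) (hv : v ∈ B - B) :
    chordTop (w +ᵥ B) v = w + chordTop B v := by
  obtain ⟨h1, h2, h3⟩ := chordTop_spec hB hv
  refine IsChordTop.eq_chordTop (hB.vadd w) ⟨vadd_mem_vadd_set h1, ?_, fun y hy hy' => ?_⟩ hv0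
  · rw [add_sub_assoc]
    exact vadd_mem_vadd_set h2
  · rw [mem_vadd_iff_sub_mem] at hy hy'
    have := h3 (y - w) hy (by rwa [sub_right_comm])
    rw [sub_wedge] at this
    rw [add_wedge]
    linarith

omit hB in
lemma neg_vadd_set : -(w +ᵥ B) = (-w) +ᵥ (-B) := by
  ext y
  rw [mem_vadd_iff_sub_mem, Set.mem_neg, Set.mem_neg, mem_vadd_iff_sub_mem]
  rw [show -(y - -w) = -y - w by abel]

omit hB in
lemma vadd_sub_vadd_set : (w +ᵥ B) - (w +ᵥ B) = B - B := by
  ext v; constructor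
  · rintro ⟨_, ⟨x, hx, rfl⟩, _, ⟨y, hy, rfl⟩, rfl⟩
    exact ⟨x, hx, y, hy, by simp⟩
  · rintro ⟨x, hx, y, hy, rfl⟩
    exact ⟨_, vadd_mem_vadd_set hx, _, vadd_mem_vadd_set hy, by simp⟩

lemma chordGap_vadd {v : Plane} (hv0 : v ≠ 0) (hv : v ∈ B - B) :
    chordGap (w +ᵥ B) v = chordGap B v := by
  rw [chordGap, chordGap, neg_vadd_set, chordTop_vadd hB w hv0 hv,
    chordTop_vadd hB.neg (-w) hv0 (by rwa [neg_sub_neg_body])]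
  abel

end translate

/-- If two functions `P`, `Q` with derivatives `f t`, `g t` differ by a constant on an interval,
then so does from `P` any function whose derivative is pointwise one of these. -/
lemma sub_const_of_deriv_mem {P Q R : ℝ → Plane} {f g h : ℝ → ℝ} {t : ℝ → Plane}
    (ht : ∀ x, t x ≠ 0) (hP : ∀ x, HasDerivAt P (f x • t x) x)
    (hQ : ∀ x, HasDerivAt Q (g x • t x) x) (hR : ∀ x, HasDerivAt R (h x • t x) x)
    (hmem : ∀ x, h x = f x ∨ h x = g x) {a b : ℝ} {c : Plane}
    (hc : ∀ x ∈ Icc a b, P x - Q x = c) : ∀ x ∈ Icc a b, R x - P x = R a - P a := by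
  refine constant_of_has_deriv_right_zero
    (fun x _ => ((hR x).continuousAt.sub (hP x).continuousAt).continuousWithinAt) fun x hx => ?_
  have h1 : HasDerivWithinAt (fun y => P y - Q y) (f x • t x - g x • t x) (Ici x) x :=
    ((hP x).sub (hQ x)).hasDerivWithinAt
  have h2 : HasDerivWithinAt (fun y => P y - Q y) 0 (Ici x) x := by
    refine (hasDerivWithinAt_const x (Ici x) c).congr_of_eventuallyEq ?_ (hc x ⟨hx.1, hx.2.le⟩)
    have : Icc x b ∈ 𝓝[≥] x := Icc_mem_nhdsGE hx.2
    filter_upwards [this] with y hy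
    exact hc y ⟨hx.1.trans hy.1, hy.2⟩
  have h3 := (uniqueDiffOn_Ici x x self_mem_Ici).eq_deriv _ h1 h2
  rw [← sub_smul, smul_eq_zero, or_iff_left (ht x), sub_eq_zero] at h3
  have h4 : h x = f x := by
    rcases hmem x with h | h
    · exact h
    · rw [h, h3]
  have h5 := ((hR x).sub (hP x)).hasDerivWithinAt (s := Ici x)
  rwa [h4, sub_self] at h5

lemma exists_secant_pos {B : Set Plane} (hB : IsStrictBody B) (hs : IsSmoothBody B) {a b : ℝ}
    (hab : a < b) (hba : b < a + Real.pi) :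
    ∃ δ : ℝ, 0 < δ ∧ ∃ ψ ∈ Icc a b, supportPt B b - supportPt B a = δ • tangentVec ψ := by
  obtain ⟨δ, hδ, ψ, hψ, h⟩ := exists_secant hB hab.le hba
  refine ⟨δ, lt_of_le_of_ne hδ fun h0 => ?_, ψ, hψ, h⟩
  rw [← h0, zero_smul, sub_eq_zero] at h
  exact hs.supportPt_ne hab (by linarith [Real.pi_pos]) h.symm

lemma dot_secant_pos {B : Set Plane} (hB : IsStrictBody B) {a b : ℝ}
    (h : supportPt B a ≠ supportPt B b) :
    0 < dot (unitVec b) (supportPt B b - supportPt B a) := by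
  refine lt_of_le_of_ne (dot_secant_nonneg hB a b) fun h0 => h ?_
  refine eq_supportPt hB (supportPt_mem hB a) ?_
  rw [dot_sub] at h0
  linarith

lemma dot_tangentVec_secant_pos {B : Set Plane} (hB : IsStrictBody B) (hs : IsSmoothBody B)
    {a b θ : ℝ} (hab : a < b) (hθa : θ - a < Real.pi / 2) (hθb : b - θ < Real.pi / 2) :
    0 < dot (tangentVec θ) (supportPt B b - supportPt B a) := by
  obtain ⟨δ, hδ, ψ, hψ, h⟩ := exists_secant_pos hB hs hab (by linarith)
  rw [h, dot_smul, dot_tangentVec_tangentVec]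
  refine mul_pos hδ (Real.cos_pos_of_mem_Ioo ⟨?_, ?_⟩)
  · linarith [hψ.2]
  · linarith [hψ.1]

/-- If a chord of `B` is a translate of a vector `v` pointing outwards at `β`, and an extremal such
chord lies above `supportPt B β`, then the chord of `B` at `supportPt B β` is at least as long
as `v`. -/
lemma supportPt_sub_mem {B : Set Plane} (hB : IsStrictBody B) {β δ ψ : ℝ} {v q q' : Plane}
    (hδ : 0 < δ) (hv : v = δ • tangentVec ψ) (hout : 0 < dot (unitVec β) v)
    (hq : q ∈ B) (hqv : q - v ∈ B) (hq' : q' ∈ B) (hqv' : q' - v ∈ B)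
    (h1 : wedge (supportPt B β) v ≤ wedge q v) (h2 : wedge q' v ≤ wedge (supportPt B β) v) :
    supportPt B β - v ∈ B := by
  set z := supportPt B β
  have hS : Convex ℝ {w | w ∈ B ∧ w - v ∈ B} := by
    intro x hx y hy a b ha hb hab
    refine ⟨hB.convex hx.1 hy.1 ha hb hab, ?_⟩
    have := hB.convex hx.2 hy.2 ha hb hab
    convert this using 1
    have : v = a • v + b • v := by rw [← add_smul, hab, one_smul]
    conv_lhs => rw [this]
    module
  -- The chords with vector `v` form a convex family, so one of them lies on the line through `z`
  -- parallel to `v`.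
  obtain ⟨m, ⟨hm, hmv⟩, hmz⟩ := hS.isPreconnected.intermediate_value (f := fun w => wedge w v)
    ⟨hq', hqv'⟩ ⟨hq, hqv⟩ (by fun_prop : Continuous fun w => wedge w v).continuousOn ⟨h2, h1⟩
  have hmz : wedge m v = wedge z v := hmz
  have h3 : dot (unitVec ψ) (m - z) = 0 := by
    rw [hv, wedge_smul, wedge_smul, wedge_tangentVec, wedge_tangentVec] at hmz
    rw [dot_sub, mul_left_cancel₀ hδ.ne' hmz, sub_self]
  set μ := dot (tangentVec ψ) (m - z)
  have h4 : m - z = (μ / δ) • v := by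
    conv_lhs => rw [frame_decomp ψ (m - z)]
    rw [h3, zero_smul, zero_add, hv, smul_smul, div_mul_cancel₀ _ hδ.ne']
  -- Since `v` points outwards at `β`, the end `m` cannot lie beyond `z`. Hence `z - v` is between
  -- `m - v` and `z`.
  have h5 : μ / δ ≤ 0 := by
    have h6 : dot (unitVec β) (m - z) ≤ 0 := by
      rw [dot_sub]; linarith [dot_le_supportPt hB β hm]
    rw [h4, dot_smul] at h6
    by_contra hcon
    exact absurd h6 (not_le.2 (mul_pos (not_le.1 hcon) hout))
  set s := μ / δ
  have hpos : 0 < 1 - s := by linarith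
  have h6 := hB.convex (supportPt_mem hB β) hmv (a := 1 - 1 / (1 - s)) (b := 1 / (1 - s))
    (by rw [sub_nonneg, div_le_one hpos]; linarith) (by positivity) (by ring)
  convert h6 using 1
  have e : m - v = z + (s - 1) • v := by rw [sub_smul, one_smul, ← h4]; abel
  rw [e, smul_add, smul_smul, ← add_assoc, ← add_smul, sub_add_cancel, one_smul,
    show 1 / (1 - s) * (s - 1) = -1 by field_simp; ring, neg_one_smul]
  rfl

/-! ### Passing an angle where equality is known. -/

/-- Propagation of equality of support points of two bodies past an angle `β`. -/
lemma exists_supportPt_eq_of_gap {K H : Set Plane} (hK : IsStrictBody K) (hH : IsStrictBody H)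
    (hD : K - K = H - H) (hs : IsSmoothBody K)
    (hder : ∀ θ, ∃ r : ℝ, r ≠ 0 ∧ HasDerivAt (supportPt (-K)) (r • tangentVec θ) θ) {α γ β : ℝ}
    (hαγ : α < γ) (hγβ : γ ≤ β) (hβ : β < γ + Real.pi)
    (heq : ∀ θ ∈ Icc α β, supportPt H θ = supportPt K θ)
    (hgap : ∀ᶠ a in 𝓝[<] γ, chordGap K (supportPt K β - supportPt K a)
      = chordGap H (supportPt K β - supportPt K a))
    (hlim : Filter.Tendsto (fun a => chordTop (-K) (supportPt K β - supportPt K a)) (𝓝[<] γ)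
      (𝓝 (supportPt (-K) β)))
    (hwedge : ∀ᶠ a in 𝓝[<] γ,
      0 < wedge (supportPt K β + supportPt (-K) β) (supportPt K β - supportPt K a))
    (hviol : ∃ᶠ a in 𝓝[<] γ, supportPt (-K) β - (supportPt K β - supportPt K a) ∉ -K) :
    ∃ b, β < b ∧ ∀ θ ∈ Ioo β b, supportPt (-H) θ = supportPt (-K) θ := by
  have hpi := Real.pi_pos
  have hKn := hK.neg
  have hsn := hs.neg hK
  set P := supportPt K with hP
  set Q := supportPt (-K) with hQ
  set v : ℝ → Plane := fun a => P β - P a with hvdef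
  set q : ℝ → Plane := fun a => chordTop (-K) (v a) with hqdef
  have hD' : (-K) - (-K) = K - K := neg_sub_neg_body K
  have hvgood : ∀ a, β - Real.pi < a → a < β → v a ≠ 0 ∧ v a ∈ interior (K - K) ∧
      chordTop K (v a) = P β := by
    intro a h1 h2
    have hne : P a ≠ P β := hs.supportPt_ne h2 (by linarith)
    exact ⟨sub_ne_zero.2 hne.symm, supportPt_sub_mem_interior hK hs h2 (by linarith),
      chordTop_supportPt hK h2 (by linarith) hne.symm⟩
  have hqfr : ∀ a, β - Real.pi < a → a < β → q a ∈ -K ∧ q a - v a ∈ -K ∧ q a ∈ frontier (-K) := by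
    intro a h1 h2
    obtain ⟨h3, h4, -⟩ := hvgood a h1 h2
    have := chordTop_spec hKn (v := v a) (by rw [hD']; exact interior_subset h4)
    exact ⟨this.1, this.2.1, (this.mem_frontier hKn h3).1⟩
  have hnear : ∀ᶠ a in 𝓝[<] γ, q a ∈ frontier (-K) → ∃ φ, |φ - β| < Real.pi / 4 ∧ q a = Q φ :=
    hlim.eventually (eventually_exists_supportPt_near hKn hsn β (by linarith))
  have hl : ∀ᶠ a in 𝓝[<] γ, max α (β - Real.pi) < a :=
    Filter.Eventually.filter_mono nhdsWithin_le_nhds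
      (lt_mem_nhds (max_lt hαγ (by linarith)))
  obtain ⟨l, hlγ, hgood⟩ := (mem_nhdsLT_iff_exists_Ioo_subset).1
    (hgap.and (hwedge.and (hnear.and hl)))
  -- The chord from `P a` to `P β` is extremal for both `K` and `H`, so equality of gaps makes the
  -- extremal chords of `-K` and `-H` coincide as well.
  have hqH : ∀ a ∈ Ioo l γ, q a ∈ frontier (-H) := by
    intro a ha
    obtain ⟨g1, -, -, g4⟩ := hgood ha
    rw [max_lt_iff] at g4
    have haβ : a < β := ha.2.trans_le hγβ
    obtain ⟨h1, h2, h3⟩ := hvgood a g4.2 haβ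
    have e1 := heq a ⟨g4.1.le, haβ.le⟩
    have e2 := heq β ⟨(hαγ.trans_le hγβ).le, le_rfl⟩
    have h4 : chordTop H (v a) = P β := by
      have := chordTop_supportPt hH haβ (by linarith) (by
        rw [e1, e2]; exact sub_ne_zero.1 h1)
      rwa [e1, e2] at this
    have h5 : q a = chordTop (-H) (v a) := by
      have := chordGap_eq_iff.1 g1
      rw [h3, h4] at this
      exact add_left_cancel this
    rw [h5]
    exact ((chordTop_spec hH.neg (v := v a) (by
      rw [neg_sub_neg_body, ← hD]; exact interior_subset h2)).mem_frontier hH.neg h1).1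
  obtain ⟨a₀, hviol, ha₀⟩ := (hviol.and_eventually (Ioo_mem_nhdsLT hlγ)).exists
  obtain ⟨-, g2, g3, g4⟩ := hgood ha₀
  rw [max_lt_iff] at g4
  have ha₀β : a₀ < β := ha₀.2.trans_le hγβ
  obtain ⟨hv0, hvi, htop⟩ := hvgood a₀ g4.2 ha₀β
  obtain ⟨hq1, hq2, hq3⟩ := hqfr a₀ g4.2 ha₀β
  obtain ⟨b, hb, hqb⟩ := g3 hq3
  obtain ⟨δ, hδ, ψ, hψ, hvψ⟩ := exists_secant_pos hK hs ha₀β (by linarith [g4.2])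
  have hvψ : v a₀ = δ • tangentVec ψ := hvψ
  -- If the extremal chord of `-K` were at least as high as `Q β`, then `Q β - v a₀` would belong to
  -- `-K` by `supportPt_sub_mem`.
  have hhigh : wedge (q a₀) (v a₀) < wedge (Q β) (v a₀) := by
    by_contra hcon
    refine hviol (supportPt_sub_mem hKn hδ hvψ
      (dot_secant_pos hK (hs.supportPt_ne ha₀β (by linarith [g4.2])))
      hq1 hq2 (q' := -P a₀) ?_ ?_ (not_lt.1 hcon) ?_)
    · simpa using supportPt_mem hK a₀
    · have : -P a₀ - v a₀ = -P β := by simp only [hvdef]; abel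
      rw [this]; simpa using supportPt_mem hK β
    · have e : wedge (P β) (v a₀) = wedge (P a₀) (v a₀) := by
        rw [← sub_eq_zero, ← sub_wedge]; exact wedge_self _
      rw [add_wedge] at g2
      rw [neg_wedge]
      have g2' : 0 < wedge (P β) (v a₀) + wedge (Q β) (v a₀) := g2
      linarith
  rw [abs_lt] at hb
  -- If `b ≤ β`, the lower position of `q a₀` forces the chord direction `ψ` beyond `b`; then `v a₀`
  -- points inwards at `b`, although both `q a₀` and `q a₀ - v a₀` lie in `-K`.
  have hβb : β < b := by
    by_contra hcon
    rw [not_lt] at hcon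
    obtain ⟨ε, hε, φ, hφ, hsec⟩ := exists_secant hKn hcon (by linarith [hb.1])
    have h1 : 0 < wedge (Q β - Q b) (v a₀) := by
      rw [sub_wedge, ← hqb]; linarith
    rw [hsec, hvψ, wedge_smul, smul_wedge, wedge_tangentVec, dot_unitVec_tangentVec] at h1
    have h2 : 0 < Real.sin (ψ - φ) :=
      pos_of_mul_pos_right (pos_of_mul_pos_right h1 hδ.le) hε
    have h3 : φ < ψ := by
      by_contra h
      refine absurd h2 (not_lt.2 (Real.sin_nonpos_of_nonpos_of_neg_pi_le (by linarith) ?_))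
      linarith [hψ.1, hφ.2, g4.2]
    have h4 : 0 ≤ dot (unitVec b) (v a₀) := by
      have := dot_le_supportPt hKn b hq2
      rw [← hQ, ← hqb, dot_sub] at this
      linarith
    rw [hvψ, dot_smul, dot_unitVec_tangentVec] at h4
    have h5 : Real.sin (b - ψ) < 0 := Real.sin_neg_of_neg_of_neg_pi_lt
      (by linarith [hφ.1]) (by linarith [hψ.2, hb.1])
    exact absurd h4 (not_le.2 (mul_neg_of_pos_of_neg hδ h5))
  -- As `a` runs from `a₀` to `γ`, the end `q a` moves continuously from `Q b` towards `Q β`, so it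
  -- meets every `Q θ` in between.
  have hcover : ∀ θ ∈ Ioo β b, Q θ ∈ frontier (-H) := by
    intro θ hθ
    set f : ℝ → ℝ := fun a => dot (tangentVec θ) (q a - Q θ) with hf
    have hfc : ContinuousOn f (Ioo l γ) := by
      intro a ha
      obtain ⟨-, -, -, k4⟩ := hgood ha
      obtain ⟨h1, h2, -⟩ := hvgood a (max_lt_iff.1 k4).2 (ha.2.trans_le hγβ)
      have h3 : ContinuousAt (chordTop (-K)) (v a) :=
        tendsto_chordTop hKn h1 (by rwa [hD'])
      have h4 : Continuous v := by
        have := continuous_supportPt hK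
        simp only [hvdef]; fun_prop
      have h5 : ContinuousAt q a := ContinuousAt.comp (f := v) h3 h4.continuousAt
      have h6 : Continuous fun y => dot (tangentVec θ) (y - Q θ) := by fun_prop
      exact (ContinuousAt.comp (f := q) h6.continuousAt h5).continuousWithinAt
    have hf0 : 0 < f a₀ := by
      simp only [hf, hqb]
      exact dot_tangentVec_secant_pos hKn hsn hθ.2 (by linarith) (by linarith [hθ.1])
    have hfl : ∀ᶠ a in 𝓝[<] γ, f a < 0 := by
      have h6 : Continuous fun y => dot (tangentVec θ) (y - Q θ) := by fun_prop
      refine ((h6.tendsto (Q β)).comp hlim).eventually (gt_mem_nhds ?_)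
      have := dot_tangentVec_secant_pos hKn hsn (θ := θ) hθ.1 (by linarith [hθ.2])
        (by linarith)
      rw [dot_sub] at this ⊢
      linarith
    obtain ⟨a₁, h1, h2⟩ := (hfl.and (Ioo_mem_nhdsLT ha₀.2)).exists
    have hsub : Icc a₀ a₁ ⊆ Ioo l γ := fun x hx => ⟨ha₀.1.trans_le hx.1, hx.2.trans_lt h2.2⟩
    obtain ⟨a, ha, hfa⟩ := intermediate_value_Icc' h2.1.le (hfc.mono hsub) ⟨h1.le, hf0.le⟩
    obtain ⟨-, -, k3, k4⟩ := hgood (hsub ha)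
    obtain ⟨φ, hφ, hqφ⟩ := k3 (hqfr a (max_lt_iff.1 k4).2 ((hsub ha).2.trans_le hγβ)).2.2
    rw [abs_lt] at hφ
    simp only [hf, hqφ] at hfa
    have : φ = θ := by
      rcases lt_trichotomy φ θ with h | h | h
      · have := dot_tangentVec_secant_pos hKn hsn h (θ := θ) (by linarith [hθ.2]) (by linarith)
        rw [dot_sub] at this hfa
        linarith
      · exact h
      · have := dot_tangentVec_secant_pos hKn hsn h (θ := θ) (by linarith)
          (by linarith [hθ.1])
        linarith
    rw [← this, ← hqφ]
    exact hqH a (hsub ha)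
  refine ⟨b, hβb, fun θ hθ => ?_⟩
  obtain ⟨r, hr, hd⟩ := hder θ
  symm
  refine eq_supportPt_of_curve hH.neg hr hd (hcover θ hθ) ?_ ?_
  · filter_upwards [Ioo_mem_nhds hθ.1 hθ.2] with y hy
    exact hH.neg.isClosed.frontier_subset (hcover y hy)
  · obtain ⟨x, hx1, hx2⟩ := exists_between hθ.2
    refine ⟨Q x, hH.neg.isClosed.frontier_subset (hcover x ⟨hθ.1.trans hx1, hx2⟩), ?_⟩
    have := dot_secant_pos hKn (hsn.supportPt_ne hx1 (by linarith [hθ.1])).symm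
    rw [dot_sub] at this
    linarith

/-! ### Boundary arcs and local symmetries. -/

lemma isArc_image {f : ℝ → Plane} (hf : Continuous f) {a b : ℝ} (hab : a < b)
    (hinj : InjOn f (Icc a b)) : IsArc (f '' Icc a b) (f a) (f b) := by
  have hmem : ∀ t : unitInterval, a + t * (b - a) ∈ Icc a b := fun t => by
    have h1 := t.2.1
    have h2 := t.2.2
    constructor <;> nlinarith
  refine ⟨⟨⟨fun t => f (a + t * (b - a)), by fun_prop⟩, by simp, by simp⟩, fun s t h => ?_, ?_⟩
  · have := hinj (hmem s) (hmem t) h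
    have h1 : (b - a) ≠ 0 := by linarith
    exact Subtype.ext (mul_right_cancel₀ h1 (add_left_cancel this))
  · apply Subset.antisymm
    · rintro - ⟨t, rfl⟩
      exact mem_image_of_mem f (hmem t)
    · rintro - ⟨x, hx, rfl⟩
      have h1 : 0 < b - a := by linarith
      refine ⟨⟨(x - a) / (b - a), div_nonneg (by linarith [hx.1]) h1.le,
        (div_le_one h1).2 (by linarith [hx.2])⟩, ?_⟩
      change f (a + (x - a) / (b - a) * (b - a)) = f x
      rw [div_mul_cancel₀ _ h1.ne', add_sub_cancel]

lemma IsArc.isPreconnected {A : Set Plane} {a b : Plane} (h : IsArc A a b) : IsPreconnected A := by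
  obtain ⟨γ, -, rfl⟩ := h
  exact isPreconnected_range γ.continuous

lemma IsSmoothBody.injOn {B : Set Plane} (hs : IsSmoothBody B) {a b : ℝ}
    (h : b < a + 2 * Real.pi) : InjOn (supportPt B) (Icc a b) := by
  intro x hx y hy he
  rcases lt_trichotomy x y with h1 | h1 | h1
  · exact absurd he (hs.supportPt_ne h1 (by linarith [hx.1, hy.2]))
  · exact h1
  · exact absurd he.symm (hs.supportPt_ne h1 (by linarith [hx.2, hy.1]))

/-- A connected subset of the boundary contains one of the two boundary arcs between any two of
its points. -/
lemma arc_subset_of_isPreconnected {B S : Set Plane} (hB : IsStrictBody B) (hs : IsSmoothBody B)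
    (hS : IsPreconnected S) (hSB : S ⊆ frontier B) {x y : ℝ}
    (hx : supportPt B x ∈ S) (hy : supportPt B y ∈ S) :
    (∀ θ ∈ Icc x y, supportPt B θ ∈ S) ∨ ∀ θ ∈ Icc y (x + 2 * Real.pi), supportPt B θ ∈ S := by
  by_contra! hcon
  obtain ⟨⟨a, ha, haS⟩, b, hb, hbS⟩ := hcon
  have hx' : supportPt B (x + 2 * Real.pi) ∈ S := by rwa [supportPt_add_two_pi]
  have hxa : x < a := lt_of_le_of_ne ha.1 fun h => haS (h ▸ hx)
  have hay : a < y := lt_of_le_of_ne ha.2 fun h => haS (h.symm ▸ hy)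
  have hyb : y < b := lt_of_le_of_ne hb.1 fun h => hbS (h ▸ hy)
  have hbx : b < x + 2 * Real.pi := lt_of_le_of_ne hb.2 fun h => hbS (h.symm ▸ hx')
  have hc := continuous_supportPt hB
  -- Two omitted points, one on each arc, split the boundary into two closed arcs that both meet
  -- `S`; by connectedness `S` would contain an omitted point.
  obtain ⟨z, hzS, ⟨θ, hθ, rfl⟩, φ, hφ, he⟩ := isPreconnected_closed_iff.1 hS
    (supportPt B '' Icc a b) (supportPt B '' Icc b (a + 2 * Real.pi))
    (isCompact_Icc.image hc).isClosed (isCompact_Icc.image hc).isClosed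
    (fun z hz => by
      obtain ⟨θ, hθ, rfl⟩ := exists_eq_supportPt hB (hSB hz) a
      rcases le_total θ b with h | h
      · exact .inl ⟨θ, ⟨hθ.1, h⟩, rfl⟩
      · exact .inr ⟨θ, ⟨h, hθ.2.le⟩, rfl⟩)
    ⟨_, hy, y, ⟨hay.le, hyb.le⟩, rfl⟩
    ⟨_, hx', _, ⟨hbx.le, by linarith⟩, rfl⟩
  rcases (hθ.2.trans hφ.1).eq_or_lt with h | h
  · have : θ = b := le_antisymm hθ.2 (h ▸ hφ.1)
    exact hbS (this ▸ hzS)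
  · rcases lt_or_ge φ (θ + 2 * Real.pi) with h1 | h1
    · exact hs.supportPt_ne h h1 he.symm
    · have : θ = a := le_antisymm (by linarith [hφ.2]) hθ.1
      exact haS (this ▸ hzS)

section symmetry
variable {K : Set Plane} (hK : IsStrictBody K) (hs : IsSmoothBody K)
  (hder : ∀ θ, ∃ r : ℝ, r ≠ 0 ∧ HasDerivAt (supportPt K) (r • tangentVec θ) θ)
include hK hs

omit hs in
lemma supportPt_sub_neg_eq_iff {θ : ℝ} {c : Plane} :
    supportPt K θ - supportPt (-K) θ = c ↔ supportPt K (θ + Real.pi) = c - supportPt K θ := by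
  rw [supportPt_neg hK, sub_neg_eq_add, eq_sub_iff_add_eq, add_comm]

include hder

/-- If a piece of the boundary of `K` can be translated along the boundary, then trivially. -/
lemma eq_zero_of_add_mem_frontier {a b : ℝ} (hab : a < b) {w : Plane}
    (h : ∀ θ ∈ Icc a b, supportPt K θ + w ∈ frontier K) : w = 0 := by
  obtain ⟨x, hax, hxb⟩ := exists_between hab
  obtain ⟨r, hr, hd⟩ := hder x
  obtain ⟨y, hxy, hy⟩ := exists_between
    (show x < min b (x + 2 * Real.pi) from lt_min hxb (by linarith [Real.pi_pos]))
  have hcl := hK.isClosed.frontier_subset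
  have := eq_supportPt_of_curve hK hr (hd.add_const w) (h x ⟨hax.le, hxb.le⟩) (by
    filter_upwards [Icc_mem_nhds hax hxb] with θ hθ
    exact hcl (h θ hθ))
    ⟨_, hcl (h y ⟨(hax.trans hxy).le, (lt_min_iff.1 hy).1.le⟩), by
      have := dot_secant_pos hK (hs.supportPt_ne hxy (lt_min_iff.1 hy).2).symm
      rw [dot_sub] at this
      rw [dot_add, dot_add]
      linarith⟩
  simpa using this

/-- If the reflection of a piece of the boundary of `K` lies in the boundary, then it consists of
the opposite support points. -/
lemma sub_eq_of_sub_mem_frontier {a b : ℝ} {c : Plane}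
    (h : ∀ θ ∈ Icc a b, c - supportPt K θ ∈ frontier K) :
    ∀ θ ∈ Ioo a b, supportPt K θ - supportPt (-K) θ = c := by
  intro x hx
  obtain ⟨r, hr, hd⟩ := hder x
  obtain ⟨y, hxy, hy⟩ := exists_between
    (show x < min b (x + 2 * Real.pi) from lt_min hx.2 (by linarith [Real.pi_pos]))
  have hcl := hK.isClosed.frontier_subset
  have hd' : HasDerivAt (fun θ => c - supportPt K θ) (r • tangentVec (x + Real.pi)) x := by
    rw [tangentVec_add_pi, smul_neg]
    exact hd.const_sub c
  have := eq_supportPt_of_curve hK hr hd' (h x ⟨hx.1.le, hx.2.le⟩) (by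
    filter_upwards [Icc_mem_nhds hx.1 hx.2] with θ hθ
    exact hcl (h θ hθ))
    ⟨_, hcl (h y ⟨(hx.1.trans hxy).le, (lt_min_iff.1 hy).1.le⟩), by
      have := dot_secant_pos hK (hs.supportPt_ne hxy (lt_min_iff.1 hy).2).symm
      rw [dot_sub] at this
      rw [unitVec_add_pi, neg_dot, neg_dot, dot_sub, dot_sub]
      linarith⟩
  exact (supportPt_sub_neg_eq_iff hK).2 this.symm

/-- Where `P - Q` is constant, opposite boundary arcs are reflections of each other. Maximality
holds because any larger symmetric pair has the same centre, and its first arc would continue the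
constancy past `a` or `b`. -/
lemma isLocalSymmetry_supportPt {a b : ℝ} (hab : a < b) (hba : b < a + Real.pi) {c : Plane}
    (hc : ∀ θ ∈ Icc a b, supportPt K θ - supportPt (-K) θ = c)
    (hleft : ∀ x < a, ∃ θ ∈ Icc x a, supportPt K θ - supportPt (-K) θ ≠ c)
    (hright : ∀ y > b, ∃ θ ∈ Icc b y, supportPt K θ - supportPt (-K) θ ≠ c) :
    IsLocalSymmetry K (supportPt K '' Icc a b)
      (supportPt K '' Icc (a + Real.pi) (b + Real.pi)) := by
  have hpi := Real.pi_pos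
  have hcont := continuous_supportPt hK
  have hc' : ∀ θ ∈ Icc a b, supportPt K (θ + Real.pi) = c - supportPt K θ := fun θ hθ =>
    (supportPt_sub_neg_eq_iff hK).1 (hc θ hθ)
  have hfr : ∀ s, supportPt K '' s ⊆ frontier K := by
    rintro s - ⟨x, -, rfl⟩; exact supportPt_mem_frontier hK x
  have hA₂ : supportPt K '' Icc (a + Real.pi) (b + Real.pi)
      = (fun x => c - x) '' (supportPt K '' Icc a b) := by
    rw [image_image, ← image_add_const_Icc, image_image]
    exact image_congr hc'
  have hrefl : ∀ c : Plane, (AffineEquiv.pointReflection ℝ ((1 / 2 : ℝ) • c) : Plane → Plane)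
      = fun x => c - x := by
    intro c; ext1 x
    rw [AffineEquiv.pointReflection_apply, vsub_eq_sub, vadd_eq_add]
    module
  refine ⟨⟨hfr _, hfr _, ⟨(1 / 2 : ℝ) • c, by rw [hrefl, hA₂]⟩, _, _, _, _,
    isArc_image hcont hab (hs.injOn (by linarith)),
    isArc_image hcont (by linarith) (hs.injOn (by linarith)), ?_⟩, ?_⟩
  · rw [Set.disjoint_left]
    rintro - ⟨⟨x, hx, rfl⟩, -⟩ ⟨⟨y, hy, he⟩, -⟩
    exact hs.supportPt_ne (show x < y by linarith [hx.2, hy.1])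
      (by linarith [hx.1, hy.2]) he.symm
  · rintro B B' ⟨hB, hB', ⟨c₁, hc₁⟩, p, q, p', q', harc, -, -⟩ hAB hAB'
    have e1 : c₁ = (1 / 2 : ℝ) • ((2 : ℝ) • c₁) := by rw [smul_smul]; norm_num
    rw [e1, hrefl] at hc₁
    have h2 : ∀ θ ∈ Icc a b, supportPt K θ + ((2 : ℝ) • c₁ - c) ∈ B := by
      intro θ hθ
      have h3 : c - supportPt K θ ∈ B' := by
        rw [← hc' θ hθ]
        exact hAB' ⟨_, ⟨by linarith [hθ.1], by linarith [hθ.2]⟩, rfl⟩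
      rw [hc₁] at h3
      obtain ⟨y, hy, hye⟩ := h3
      have : y = supportPt K θ + ((2 : ℝ) • c₁ - c) := by
        have hye : (2 : ℝ) • c₁ - y = c - supportPt K θ := hye
        rw [show y = (2 : ℝ) • c₁ - ((2 : ℝ) • c₁ - y) by abel, hye]; abel
      rwa [← this]
    -- Composing the two reflections translates a boundary arc along the boundary; the translation
    -- is trivial, so the centres agree.
    have h3 := eq_zero_of_add_mem_frontier hK hs hder hab fun θ hθ => hB (h2 θ hθ)
    rw [sub_eq_zero.1 h3] at hc₁
    have hBc : ∀ y ∈ B, c - y ∈ frontier K := fun y hy => hB' (hc₁ ▸ mem_image_of_mem _ hy)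
    have hext : ∀ x y, (∀ θ ∈ Icc x y, supportPt K θ ∈ B) →
        ∀ θ ∈ Ioo x y, supportPt K θ - supportPt (-K) θ = c := fun x y h =>
      sub_eq_of_sub_mem_frontier hK hs hder fun θ hθ => hBc _ (h θ hθ)
    have hBA : B ⊆ supportPt K '' Icc a b := by
      intro z hz
      obtain ⟨ξ, hξ, rfl⟩ := exists_eq_supportPt hK (hB hz) a
      rcases le_or_gt ξ b with h | h
      · exact ⟨ξ, ⟨hξ.1, h⟩, rfl⟩
      exfalso
      -- A point of `B` beyond `b` is joined to `b` inside `B` one way round or the other. This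
      -- extends the symmetry to the right of `b` or to the left of `a`.
      rcases arc_subset_of_isPreconnected hK hs harc.isPreconnected hB
        (hAB ⟨b, right_mem_Icc.2 hab.le, rfl⟩) hz with h1 | h1
      · obtain ⟨y, hy1, hy2⟩ := exists_between h
        obtain ⟨θ, hθ, hne⟩ := hright y hy1
        rcases hθ.1.eq_or_lt with h3 | h3
        · exact hne (h3 ▸ hc b (right_mem_Icc.2 hab.le))
        · exact hne (hext _ _ h1 θ ⟨h3, hθ.2.trans_lt hy2⟩)
      · have h2 : ∀ θ ∈ Icc (ξ - 2 * Real.pi) b, supportPt K θ ∈ B := fun θ hθ => by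
          rw [← supportPt_add_two_pi]
          exact h1 _ ⟨by linarith [hθ.1], by linarith [hθ.2]⟩
        obtain ⟨x, hx1, hx2⟩ := exists_between (show ξ - 2 * Real.pi < a by linarith [hξ.2])
        obtain ⟨θ, hθ, hne⟩ := hleft x hx2
        exact hne (hext _ _ h2 θ ⟨hx1.trans_le hθ.1, hθ.2.trans_lt hab⟩)
    have hAB'' := Subset.antisymm hAB hBA
    exact ⟨hAB'', by rw [hA₂, hc₁, hAB'']⟩

/-- On the symmetric interval `2 • P - c = P + Q` runs along the boundary of the difference body and
is the corresponding arc. The midpoint of its ends, `P a + P b - c`, equals `P a + Q b`, which is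
the gap at `P b - P a`. -/
lemma neg_chordGap_mem_symmetryMidpoints {a b : ℝ} (hab : a < b) (hba : b < a + Real.pi)
    {c : Plane} (hc : ∀ θ ∈ Icc a b, supportPt K θ - supportPt (-K) θ = c)
    (hleft : ∀ x < a, ∃ θ ∈ Icc x a, supportPt K θ - supportPt (-K) θ ≠ c)
    (hright : ∀ y > b, ∃ θ ∈ Icc b y, supportPt K θ - supportPt (-K) θ ≠ c) :
    chordTop (-K) (supportPt K b - supportPt K a) = supportPt (-K) b ∧
      -chordGap K (supportPt K b - supportPt K a) ∈ symmetryMidpoints K := by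
  have hsym := isLocalSymmetry_supportPt hK hs hder hab hba hc hleft hright
  have ha := hc a (left_mem_Icc.2 hab.le)
  have hb := hc b (right_mem_Icc.2 hab.le)
  have hne : supportPt K b ≠ supportPt K a :=
    (hs.supportPt_ne hab (by linarith [Real.pi_pos])).symm
  have hv : supportPt K b - supportPt K a = supportPt (-K) b - supportPt (-K) a := by
    rw [sub_eq_iff_eq_add] at ha hb
    rw [ha, hb]; abel
  have htop : chordTop (-K) (supportPt K b - supportPt K a) = supportPt (-K) b := by
    rw [hv]
    refine chordTop_supportPt hK.neg hab hba ?_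
    rw [← sub_ne_zero, ← hv, sub_ne_zero]; exact hne
  refine ⟨htop, (fun θ => (2 : ℝ) • supportPt K θ - c) '' Icc a b, (2 : ℝ) • supportPt K a - c,
    (2 : ℝ) • supportPt K b - c, ⟨?_, ?_, _, _, -c, hsym, ?_, ?_⟩, .inr ?_⟩
  · refine isArc_image (f := fun θ => (2 : ℝ) • supportPt K θ - c)
      (by have := continuous_supportPt hK; fun_prop) hab fun x hx y hy he => ?_
    refine hs.injOn (by linarith [Real.pi_pos]) hx hy ?_
    exact smul_right_injective Plane (two_ne_zero (α := ℝ)) (sub_left_injective he)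
  · rintro - ⟨θ, hθ, rfl⟩
    have e : (2 : ℝ) • supportPt K θ - c = supportPt K θ + supportPt (-K) θ := by
      rw [← hc θ hθ]; module
    change (2 : ℝ) • supportPt K θ - c ∈ frontier (K - K)
    rw [e]
    exact supportPt_add_mem_frontier hK θ
  · rw [← image_smul, ← image_vadd, image_image, image_image]
    refine image_congr fun θ _ => ?_
    simp only [vadd_eq_add]
    abel
  · rw [← image_smul, ← image_vadd, ← image_add_const_Icc, image_image, image_image, image_image,
      ← image_neg_eq_neg, image_image]
    refine image_congr fun θ hθ => ?_
    rw [(supportPt_sub_neg_eq_iff hK).1 (hc θ hθ)]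
    simp only [vadd_eq_add]
    module
  · rw [chordGap, chordTop_supportPt hK hab hba hne, htop, neg_inj, midpoint_eq_smul_add]
    rw [sub_eq_iff_eq_add] at hb
    rw [hb, invOf_eq_inv]
    module

end symmetry

/-! ### Propagation around the boundary. -/

lemma tendsto_supportPt_sub_smallTangent {B : Set Plane} (hB : IsStrictBody B)
    (hs : IsSmoothBody B) (β : ℝ) :
    Filter.Tendsto (fun a => supportPt B β - supportPt B a) (𝓝[<] β) (smallTangent β) := by
  have hπ : ∀ᶠ a in 𝓝[<] β, β - Real.pi / 2 < a ∧ a < β :=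
    (Filter.Eventually.filter_mono nhdsWithin_le_nhds
      (lt_mem_nhds (by linarith [Real.pi_pos]))).and self_mem_nhdsWithin
  have ht : Filter.Tendsto (fun a => (Real.tan (a - β), (0 : ℝ))) (𝓝[<] β) smallIntervals := by
    refine tendsto_nhdsWithin_iff.2 ⟨?_, ?_⟩
    · have h1 : ContinuousAt (fun a => Real.tan (a - β)) β := by
        refine ContinuousAt.comp (f := fun a : ℝ => a - β) (g := Real.tan) ?_ (by fun_prop)
        exact Real.continuousAt_tan.2 (by simp)
      have h2 := (h1.prodMk (continuousAt_const (y := (0 : ℝ)))).tendsto.mono_left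
        (nhdsWithin_le_nhds (s := Iio β))
      simpa using h2
    · filter_upwards [hπ] with a ha
      exact Real.tan_neg_of_neg_of_pi_div_two_lt (by linarith [ha.2]) (by linarith [ha.1])
  refine ((tendsto_slopePt_sub hB hs β).comp ht).congr' ?_
  filter_upwards [hπ] with a ha
  simp only [Function.comp_apply]
  rw [slopePt_zero, supportPt_eq_slopePt B (θ := β) (ψ := a)
    (abs_lt.2 ⟨by linarith [ha.1], by linarith [ha.2, Real.pi_pos]⟩)]

lemma eventually_wedge_pos {y : Plane} {β : ℝ} (hy : 0 < dot (unitVec β) y) :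
    ∀ᶠ v in smallTangent β, 0 < wedge y v := by
  set d := dot (unitVec β) y
  set m := |wedge y (unitVec β)|
  have hm : 0 ≤ m := abs_nonneg _
  refine eventually_smallTangent.2 ⟨d / (m + 1), by positivity, fun v h1 _ h3 => ?_⟩
  rw [frame_decomp β v, wedge_add, wedge_smul, wedge_smul, wedge_tangentVec]
  have h4 : |dot (unitVec β) v * wedge y (unitVec β)| ≤ |dot (unitVec β) v| * m :=
    (abs_mul _ _).le
  have h5 : |dot (unitVec β) v| * (m + 1) < d * dot (tangentVec β) v := by
    rw [div_mul_eq_mul_div, lt_div_iff₀ (by linarith)] at h3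
    exact h3
  have h6 := neg_abs_le (dot (unitVec β) v * wedge y (unitVec β))
  have h7 := abs_nonneg (dot (unitVec β) v)
  change 0 < _ + dot (tangentVec β) v * d
  nlinarith

lemma dot_supportPt_add_neg_pos {B : Set Plane} (hB : IsStrictBody B) (θ : ℝ) :
    0 < dot (unitVec θ) (supportPt B θ + supportPt (-B) θ) := by
  obtain ⟨o, ho⟩ := hB.nonempty_interior
  obtain ⟨w, hw, hlt⟩ := exists_dot_lt_of_mem_interior ho (unitVec_ne_zero θ)
  have h1 := dot_le_supportPt hB θ hw
  have h2 := dot_le_supportPt hB.neg θ (w := -o) (by simpa using interior_subset ho)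
  rw [dot_neg] at h2
  rw [dot_add]
  linarith

/-- The local hypotheses for the propagation of the equality of support points. -/
lemma gap_near_chord {K H : Set Plane} (hK : IsStrictBody K) (hs : IsSmoothBody K)
    (hgap : ∀ θ, ∀ᶠ v in smallTangent θ, chordGap K v = chordGap H v) {γ β : ℝ} (hγβ : γ ≤ β)
    (hβ : β < γ + Real.pi) {c : Plane}
    (hc : ∀ θ ∈ Icc γ β, supportPt K θ - supportPt (-K) θ = c)
    (hmid : γ < β → ∀ᶠ v in 𝓝 (supportPt K β - supportPt K γ), chordGap K v = chordGap H v) :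
    (∀ᶠ a in 𝓝[<] γ, chordGap K (supportPt K β - supportPt K a)
      = chordGap H (supportPt K β - supportPt K a)) ∧
    Filter.Tendsto (fun a => chordTop (-K) (supportPt K β - supportPt K a)) (𝓝[<] γ)
      (𝓝 (supportPt (-K) β)) ∧
    (∀ᶠ a in 𝓝[<] γ,
      0 < wedge (supportPt K β + supportPt (-K) β) (supportPt K β - supportPt K a)) := by
  -- For `γ = β` the chords shrink and short-vector data apply. For `γ < β` their vectors converge
  -- to that of the symmetric chord, where `hmid` and continuity apply.
  rcases hγβ.eq_or_lt with rfl | hlt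
  · have ht := tendsto_supportPt_sub_smallTangent hK hs γ
    exact ⟨ht.eventually (hgap γ), (tendsto_chordTop_smallTangent hK.neg γ).comp ht,
      ht.eventually (eventually_wedge_pos (dot_supportPt_add_neg_pos hK γ))⟩
  · have ht : Filter.Tendsto (fun a => supportPt K β - supportPt K a) (𝓝[<] γ)
        (𝓝 (supportPt K β - supportPt K γ)) :=
      (((continuous_supportPt hK).tendsto γ).const_sub _).mono_left nhdsWithin_le_nhds
    have hne : supportPt K β ≠ supportPt K γ :=
      (hs.supportPt_ne hlt (by linarith [Real.pi_pos])).symm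
    have hv0 := sub_ne_zero.2 hne
    have hvi := supportPt_sub_mem_interior hK hs hlt hβ
    have h1 := chordTop_supportPt hK hlt hβ hne
    have hv : supportPt K β - supportPt K γ = supportPt (-K) β - supportPt (-K) γ := by
      have ha := hc γ (left_mem_Icc.2 hlt.le)
      have hb := hc β (right_mem_Icc.2 hlt.le)
      rw [sub_eq_iff_eq_add] at ha hb
      rw [ha, hb]; abel
    have h2 : chordTop (-K) (supportPt K β - supportPt K γ) = supportPt (-K) β := by
      rw [hv]
      refine chordTop_supportPt hK.neg hlt hβ ?_
      rw [← sub_ne_zero, ← hv]; exact hv0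
    refine ⟨ht.eventually (hmid hlt), ?_, ?_⟩
    · have := tendsto_chordTop hK.neg hv0 (by rwa [neg_sub_neg_body])
      rw [h2] at this
      exact this.comp ht
    · have h3 := wedge_chordGap_pos hK hv0 hvi
      rw [chordGap, h1, h2, sub_wedge, wedge_self, sub_zero] at h3
      have hcont : Continuous fun v => wedge (supportPt K β + supportPt (-K) β) v := by fun_prop
      exact ((hcont.tendsto _).comp ht).eventually (lt_mem_nhds h3)

lemma GapData.eventually_smallTangent {K H : Set Plane} (h : GapData K H) (θ : ℝ) :
    ∀ᶠ v in smallTangent θ, chordGap K v = chordGap H v :=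
  eventually_smallTangent_of_polar (h.small θ)

lemma GapData.neg_right {K H : Set Plane} (h : GapData K H) : GapData K (-H) where
  body_left := h.body_left
  body_right := h.body_right.neg
  sub_eq := by rw [neg_sub_neg_body, h.sub_eq]
  small := by simpa only [chordGap_neg_body] using h.small
  midpoints := by simpa only [chordGap_neg_body] using h.midpoints

lemma GapData.vadd_right {K H : Set Plane} (h : GapData K H) (w : Plane) :
    GapData K (w +ᵥ H) where
  body_left := h.body_left
  body_right := h.body_right.vadd w
  sub_eq := by rw [vadd_sub_vadd_set, h.sub_eq]
  small θ := by
    have h1 : ∀ᶠ x : ℝ × ℝ in 𝓝[>] 0 ×ˢ 𝓝 θ, 0 < x.1 :=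
      Filter.tendsto_fst.eventually self_mem_nhdsWithin
    have h2 := (tendsto_smul_tangentVec θ).eventually
      (isOpen_interior.mem_nhds (zero_mem_interior_sub_self h.body_right))
    filter_upwards [h.small θ, h1, h2] with x hx hx1 hx2
    rw [chordGap_vadd h.body_right w (smul_ne_zero hx1.ne' (tangentVec_ne_zero _))
      (interior_subset hx2), hx]
  midpoints v hv0 hv hm := by
    filter_upwards [h.midpoints v hv0 hv hm, isOpen_ne.mem_nhds hv0,
      isOpen_interior.mem_nhds hv] with x hx hx1 hx2
    rw [chordGap_vadd h.body_right w hx1 (h.sub_eq ▸ interior_subset hx2), hx]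

section propagation
variable {K H : Set Plane} (h : GapData K H) (hs : IsSmoothBody K) {r s : ℝ → ℝ}
  (hr : ∀ θ, 0 < r θ) (hK : ∀ θ, HasStrictDerivAt (supportPt K) (r θ • tangentVec θ) θ)
  (hH : ∀ θ, HasStrictDerivAt (supportPt H) (s θ • tangentVec θ) θ)
  (hsr : ∀ θ, s θ = r θ ∨ s θ = r (θ + Real.pi))
include h hs hr hK hH hsr

/-- An inequality of opposite radii at `θ₁` keeps the symmetric interval ending at `β` to the right
of `θ₁`, inside the arc of known equality. There is thus room for shared chords starting to its
left. -/
lemma GapData.exists_supportPt_eq_extend {α θ₁ β : ℝ} (hα : α < θ₁) (hβ : θ₁ ≤ β)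
    (hβ' : β < θ₁ + Real.pi) (hne : r θ₁ ≠ r (θ₁ + Real.pi))
    (heq : ∀ θ ∈ Icc α β, supportPt H θ = supportPt K θ) :
    ∃ b, β < b ∧ ∀ θ ∈ Icc α b, supportPt H θ = supportPt K θ := by
  by_contra hno
  have hKb := h.body_left
  have hHb := h.body_right
  set P := supportPt K with hP
  set Q := supportPt (-K) with hQ
  have hPd : ∀ θ, HasDerivAt P (r θ • tangentVec θ) θ := fun θ => (hK θ).hasDerivAt
  have hQd : ∀ θ, HasDerivAt Q (r (θ + Real.pi) • tangentVec θ) θ := fun θ =>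
    (hasStrictDerivAt_supportPt_neg hKb (hK (θ + Real.pi))).hasDerivAt
  have hHd : ∀ θ, HasDerivAt (supportPt H) (s θ • tangentVec θ) θ := fun θ => (hH θ).hasDerivAt
  have hPc : Continuous P := continuous_supportPt hKb
  have hQc : Continuous Q := continuous_supportPt hKb.neg
  have hsum := supportPt_add_neg_eq hKb hHb h.sub_eq
  have hiff : ∀ θ, supportPt H θ = P θ ↔ supportPt (-H) θ = Q θ := by
    intro θ
    have := hsum θ
    constructor
    · intro e; rw [e] at this; exact add_left_cancel this
    · intro e; rw [e] at this; exact add_right_cancel this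
  set c := P β - Q β with hcdef
  -- If `P - Q` were constant beyond `β`, opposite radii would agree there and the equality would
  -- extend for free.
  have hright : ∀ y > β, ∃ θ ∈ Icc β y, P θ - Q θ ≠ c := by
    intro y hy
    by_contra! hcon
    have h1 := sub_const_of_deriv_mem tangentVec_ne_zero hPd hQd hHd hsr hcon
    refine hno ⟨y, hy, fun θ hθ => ?_⟩
    rcases le_total θ β with h2 | h2
    · exact heq θ ⟨hθ.1, h2⟩
    · have h3 := h1 θ ⟨h2, hθ.2⟩
      rw [heq β ⟨by linarith, le_rfl⟩, sub_self, sub_eq_zero] at h3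
      exact h3
  -- Its infimum `γ` is the start of the largest interval ending at `β` on which `P - Q` is
  -- constant, apart from the cut-off at `α`.
  set S : Set ℝ := {γ | γ ∈ Icc α β ∧ ∀ θ ∈ Icc γ β, P θ - Q θ = c} with hS
  have hβS : β ∈ S := ⟨⟨by linarith, le_rfl⟩, fun θ hθ => by
    rw [le_antisymm hθ.2 hθ.1]⟩
  have hSb : BddBelow S := ⟨α, fun γ hγ => hγ.1.1⟩
  set γ := sInf S with hγdef
  have hγβ : γ ≤ β := csInf_le hSb hβS
  have hαγ : α ≤ γ := le_csInf ⟨β, hβS⟩ fun x hx => hx.1.1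
  have hc : ∀ θ ∈ Icc γ β, P θ - Q θ = c := by
    have hopen : ∀ θ ∈ Ioc γ β, P θ - Q θ = c := fun θ hθ => by
      obtain ⟨x, hx, hxθ⟩ := exists_lt_of_csInf_lt ⟨β, hβS⟩ hθ.1
      exact hx.2 θ ⟨hxθ.le, hθ.2⟩
    rcases hγβ.eq_or_lt with e | hlt
    · intro θ hθ
      rw [e] at hθ
      rw [le_antisymm hθ.2 hθ.1]
    · have hcl : IsClosed {θ | P θ - Q θ = c} := isClosed_eq (by fun_prop) continuous_const
      have := closure_minimal (fun θ hθ => hopen θ hθ : Ioc γ β ⊆ {θ | P θ - Q θ = c}) hcl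
      rw [closure_Ioc hlt.ne] at this
      exact this
  have hθγ : θ₁ ≤ γ := by
    by_contra hlt
    rw [not_le] at hlt
    have h1 : HasDerivWithinAt (fun y => P y - Q y)
        (r θ₁ • tangentVec θ₁ - r (θ₁ + Real.pi) • tangentVec θ₁) (Iic θ₁) θ₁ :=
      ((hPd θ₁).sub (hQd θ₁)).hasDerivWithinAt
    have h2 : HasDerivWithinAt (fun y => P y - Q y) 0 (Iic θ₁) θ₁ := by
      refine (hasDerivWithinAt_const θ₁ (Iic θ₁) c).congr_of_eventuallyEq ?_ (hc θ₁ ⟨hlt.le, hβ⟩)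
      filter_upwards [Icc_mem_nhdsLE hlt] with y hy
      exact hc y ⟨hy.1, hy.2.trans hβ⟩
    have h3 := (uniqueDiffOn_Iic θ₁ θ₁ self_mem_Iic).eq_deriv _ h1 h2
    rw [← sub_smul, smul_eq_zero, or_iff_left (tangentVec_ne_zero _), sub_eq_zero] at h3
    exact hne h3
  have hαγ' : α < γ := hα.trans_le hθγ
  have hleft : ∀ x < γ, ∃ θ ∈ Icc x γ, P θ - Q θ ≠ c := by
    intro x hx
    by_contra! hcon
    have : max x α ∈ S := by
      refine ⟨⟨le_max_right _ _, max_le (hx.le.trans hγβ) (hαγ.trans hγβ)⟩, fun θ hθ => ?_⟩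
      rcases le_total θ γ with h1 | h1
      · exact hcon θ ⟨(le_max_left _ _).trans hθ.1, h1⟩
      · exact hc θ ⟨h1, hθ.2⟩
    exact absurd (csInf_le hSb this) (not_le.2 (max_lt hx hαγ'))
  have hder : ∀ θ, ∃ q : ℝ, q ≠ 0 ∧ HasDerivAt P (q • tangentVec θ) θ := fun θ =>
    ⟨_, (hr θ).ne', hPd θ⟩
  have hder' : ∀ θ, ∃ q : ℝ, q ≠ 0 ∧ HasDerivAt Q (q • tangentVec θ) θ := fun θ =>
    ⟨_, (hr _).ne', hQd θ⟩
  have hβγ : β < γ + Real.pi := by linarith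
  have hmid : γ < β → ∀ᶠ v in 𝓝 (P β - P γ), chordGap K v = chordGap H v := by
    intro hlt
    have h1 := (neg_chordGap_mem_symmetryMidpoints hKb hs hder hlt hβγ hc hleft hright).2
    exact h.midpoints _ (sub_ne_zero.2 (hs.supportPt_ne hlt (by linarith [Real.pi_pos])).symm)
      (supportPt_sub_mem_interior hKb hs hlt hβγ) h1
  -- If both memberships held near `γ`, maximality of the support points would give `P θ - c = Q θ`
  -- to the left of `γ`. The failing membership decides whether the argument is run for `K` or for
  -- `-K`.
  have hviol : ∃ᶠ a in 𝓝[<] γ, P a - c ∉ -K ∨ Q a + c ∉ K := by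
    intro hcon
    obtain ⟨l, hl, hgood⟩ := mem_nhdsLT_iff_exists_Ioo_subset.1 hcon
    obtain ⟨x, hx1, hx2⟩ := exists_between (show l < γ from hl)
    obtain ⟨θ, hθ, hne⟩ := hleft x hx2
    rcases hθ.2.eq_or_lt with e | hlt
    · exact hne (e ▸ hc γ ⟨le_rfl, hγβ⟩)
    have h1 := hgood ⟨hx1.trans_le hθ.1, hlt⟩
    simp only [mem_ofPred_eq, not_or, not_not] at h1
    have h2 := dot_le_supportPt hKb θ h1.2
    have h3 : P θ - c = Q θ := by
      refine eq_supportPt hKb.neg h1.1 ?_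
      rw [dot_add] at h2
      rw [dot_sub]
      linarith
    exact hne (by rw [← h3]; abel)
  have hfin : ∃ b, β < b ∧ ∀ θ ∈ Ioo β b, supportPt H θ = P θ := by
    rcases Filter.frequently_or_distrib.1 hviol with hv | hv
    · obtain ⟨g1, g2, g3⟩ := gap_near_chord hKb hs h.eventually_smallTangent hγβ hβγ hc hmid
      obtain ⟨b, hb, hb'⟩ := exists_supportPt_eq_of_gap hKb hHb h.sub_eq hs hder' hαγ' hγβ hβγ heq
        g1 g2 g3 (hv.mono fun a ha => by
          rwa [show supportPt (-K) β - (supportPt K β - supportPt K a) = P a - c by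
            rw [hcdef]; abel])
      exact ⟨b, hb, fun θ hθ => (hiff θ).2 (hb' θ hθ)⟩
    · have hKn := hKb.neg
      have hc' : ∀ θ ∈ Icc γ β, supportPt (-K) θ - supportPt (- -K) θ = -c := fun θ hθ => by
        rw [neg_neg, ← hc θ hθ]; abel
      obtain ⟨g1, g2, g3⟩ := gap_near_chord (H := -H) hKn (hs.neg hKb)
        (by simpa only [chordGap_neg_body] using h.eventually_smallTangent) hγβ hβγ hc'
        (fun hlt => by
          have e : Q β - Q γ = P β - P γ := by
            have h1 := hc γ ⟨le_rfl, hγβ⟩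
            rw [hcdef, sub_eq_sub_iff_sub_eq_sub] at h1
            rw [← neg_sub (Q γ), ← h1, neg_sub]
          simp only [chordGap_neg_body]
          rw [← hQ, e]
          exact hmid hlt)
      obtain ⟨b, hb, hb'⟩ := exists_supportPt_eq_of_gap hKn hHb.neg
        (by rw [neg_sub_neg_body, neg_sub_neg_body, h.sub_eq]) (hs.neg hKb)
        (by rw [neg_neg]; exact hder) hαγ' hγβ hβγ (fun θ hθ => (hiff θ).1 (heq θ hθ))
        g1 g2 g3 (hv.mono fun a ha => by
          rw [neg_neg, show supportPt K β - (supportPt (-K) β - supportPt (-K) a) = Q a + c by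
            rw [hcdef]; abel]
          exact ha)
      refine ⟨b, hb, fun θ hθ => ?_⟩
      have := hb' θ hθ
      rwa [neg_neg, neg_neg] at this
  obtain ⟨b, hb, hb'⟩ := hfin
  obtain ⟨y, hy1, hy2⟩ := exists_between hb
  refine hno ⟨y, hy1, fun θ hθ => ?_⟩
  rcases le_or_gt θ β with h1 | h1
  · exact heq θ ⟨hθ.1, h1⟩
  · exact hb' θ ⟨h1, hθ.2.trans_lt hy2⟩

/-- The arc of equality is extended to cover `[θ₁, θ₁ + π]`; the other half of the directions
follows from the common sum of opposite support points. -/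
lemma GapData.eq_of_supportPt_eq {α θ₁ β : ℝ} (hα : α < θ₁) (hβ : θ₁ ≤ β)
    (hne : r θ₁ ≠ r (θ₁ + Real.pi))
    (heq : ∀ θ ∈ Icc α β, supportPt H θ = supportPt K θ) : H = K := by
  have hpi := Real.pi_pos
  have hKb := h.body_left
  have hHb := h.body_right
  set T : Set ℝ := {x | x ∈ Icc θ₁ (θ₁ + Real.pi) ∧
    ∀ θ ∈ Icc α x, supportPt H θ = supportPt K θ} with hT
  have hθT : θ₁ ∈ T := ⟨⟨le_rfl, by linarith⟩, fun θ hθ => heq θ ⟨hθ.1, hθ.2.trans hβ⟩⟩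
  have hTb : BddAbove T := ⟨θ₁ + Real.pi, fun x hx => hx.1.2⟩
  set m := sSup T with hm
  have hθm : θ₁ ≤ m := le_csSup hTb hθT
  have hmπ : m ≤ θ₁ + Real.pi := csSup_le ⟨_, hθT⟩ fun x hx => hx.1.2
  have hmeq : ∀ θ ∈ Icc α m, supportPt H θ = supportPt K θ := by
    have hopen : ∀ θ ∈ Ico α m, supportPt H θ = supportPt K θ := fun θ hθ => by
      obtain ⟨x, hx, hxθ⟩ := exists_lt_of_lt_csSup ⟨_, hθT⟩ hθ.2
      exact hx.2 θ ⟨hθ.1, hxθ.le⟩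
    have hcl : IsClosed {θ | supportPt H θ = supportPt K θ} :=
      isClosed_eq (continuous_supportPt hHb) (continuous_supportPt hKb)
    have := closure_minimal
      (fun θ hθ => hopen θ hθ : Ico α m ⊆ {θ | supportPt H θ = supportPt K θ}) hcl
    rw [closure_Ico (by linarith : α < m).ne] at this
    exact this
  have hmax : m = θ₁ + Real.pi := by
    by_contra hcon
    have hlt : m < θ₁ + Real.pi := lt_of_le_of_ne hmπ hcon
    obtain ⟨b, hb, hb'⟩ :=
      h.exists_supportPt_eq_extend hs hr hK hH hsr hα hθm hlt hne hmeq
    have : min b (θ₁ + Real.pi) ∈ T :=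
      ⟨⟨le_min (hθm.trans hb.le) (by linarith), min_le_right _ _⟩,
        fun θ hθ => hb' θ ⟨hθ.1, hθ.2.trans (min_le_left _ _)⟩⟩
    exact absurd (le_csSup hTb this) (not_le.2 (lt_min hb hlt))
  refine _root_.eq_of_supportPt_eq hHb hKb fun θ => ?_
  have hper : Function.Periodic (fun θ => (supportPt H θ, supportPt K θ)) (2 * Real.pi) :=
    fun θ => Prod.ext (supportPt_add_two_pi θ) (supportPt_add_two_pi θ)
  obtain ⟨y, hy, hye⟩ := hper.exists_mem_Ico Real.two_pi_pos θ θ₁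
  rw [Prod.mk.injEq] at hye
  rw [hye.1, hye.2]
  rcases le_total y (θ₁ + Real.pi) with h1 | h1
  · exact hmeq y ⟨by linarith [hy.1], hmax ▸ h1⟩
  · have h2 := hmeq (y - Real.pi) ⟨by linarith, by linarith [hy.2]⟩
    have h3 := supportPt_add_neg_eq hKb hHb h.sub_eq (y - Real.pi)
    rw [h2, supportPt_neg hHb, supportPt_neg hKb, sub_add_cancel] at h3
    exact neg_injective (add_left_cancel h3)

/-- Continuity of the radii forces `s = r` on a whole interval around `θ₁`. The support points
differ there by a constant, and translating by it provides the starting arc. -/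
lemma GapData.exists_eq_vadd {θ₁ : ℝ} (hne : r θ₁ ≠ r (θ₁ + Real.pi)) (hθ₁ : s θ₁ = r θ₁) :
    ∃ w : Plane, H = w +ᵥ K := by
  have hcont : ∀ {B : Set Plane} {q : ℝ → ℝ},
      (∀ θ, HasStrictDerivAt (supportPt B) (q θ • tangentVec θ) θ) → Continuous q := by
    intro B q hq
    have h1 := continuous_of_hasStrictDerivAt hq
    have h2 : q = fun θ => dot (tangentVec θ) (q θ • tangentVec θ) := by
      ext θ; simp [dot_tangentVec_tangentVec]
    rw [h2]
    fun_prop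
  have hrc := hcont hK
  have hsc := hcont hH
  have hopen : IsOpen {θ | s θ ≠ r (θ + Real.pi)} := isOpen_ne_fun hsc (by fun_prop)
  obtain ⟨ε, hε, hball⟩ := Metric.isOpen_iff.1 hopen θ₁ (by rw [mem_ofPred_eq, hθ₁]; exact hne)
  set a := θ₁ - ε / 2 with ha
  set b := θ₁ + ε / 2 with hb
  have hsr' : ∀ θ ∈ Icc a b, s θ = r θ := fun θ hθ =>
    (hsr θ).resolve_right (hball (by
      rw [Metric.mem_ball, Real.dist_eq, abs_lt]
      constructor <;> linarith [hθ.1, hθ.2]))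
  have hconst : ∀ θ ∈ Icc a b, supportPt H θ - supportPt K θ
      = supportPt H a - supportPt K a := by
    refine constant_of_has_deriv_right_zero (fun θ _ => ((continuous_supportPt h.body_right).sub
      (continuous_supportPt h.body_left)).continuousWithinAt) fun θ hθ => ?_
    have := ((hH θ).hasDerivAt.sub (hK θ).hasDerivAt).hasDerivWithinAt (s := Ici θ)
    rwa [hsr' θ ⟨hθ.1, hθ.2.le⟩, sub_self] at this
  set w := supportPt H a - supportPt K a
  have h' := h.vadd_right (-w)
  have hsupp : ∀ θ, supportPt (-w +ᵥ H) θ = -w + supportPt H θ := supportPt_vadd h.body_right _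
  have hH' : ∀ θ, HasStrictDerivAt (supportPt (-w +ᵥ H)) (s θ • tangentVec θ) θ := fun θ =>
    ((hH θ).const_add (-w)).congr_of_eventuallyEq
      (Filter.Eventually.of_forall fun x => (hsupp x).symm)
  have e := h'.eq_of_supportPt_eq hs hr hK hH' hsr (α := a) (β := b) (by linarith) (by linarith)
    hne fun θ hθ => by
      rw [hsupp, ← hconst θ hθ]; abel
  exact ⟨w, by rw [← e, vadd_vadd, add_neg_cancel, zero_vadd]⟩

/-- A body with the same covariogram data as a smooth body `K` is a translate of `K` or of `-K`. -/
lemma GapData.eq_vadd_or_neg_eq_vadd :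
    (∃ w : Plane, H = w +ᵥ K) ∨ ∃ w : Plane, -H = w +ᵥ K := by
  by_cases hall : ∀ θ, r θ = r (θ + Real.pi)
  · left
    have hd : ∀ θ, HasDerivAt (fun x => supportPt H x - supportPt K x) 0 θ := by
      intro θ
      have := (hH θ).hasDerivAt.sub (hK θ).hasDerivAt
      have e : s θ = r θ := by
        rcases hsr θ with e | e
        · exact e
        · rw [e, ← hall]
      rwa [e, sub_self] at this
    refine ⟨supportPt H 0 - supportPt K 0, _root_.eq_of_supportPt_eq h.body_right
      (h.body_left.vadd _) fun θ => ?_⟩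
    have := is_const_of_deriv_eq_zero (fun θ => (hd θ).differentiableAt)
      (fun θ => (hd θ).deriv) θ 0
    rw [supportPt_vadd h.body_left, ← this]
    abel
  · rw [not_forall] at hall
    obtain ⟨θ₁, hne⟩ := hall
    rcases hsr θ₁ with e | e
    · exact .inl (h.exists_eq_vadd hs hr hK hH hsr hne e)
    · right
      -- The radii of `-H` are `r θ + r (θ + π) - s θ`, so replacing `H` by `-H` exchanges the two
      -- alternatives.
      have hsum := supportPt_add_neg_eq h.body_left h.body_right h.sub_eq
      have hH' : ∀ θ, HasStrictDerivAt (supportPt (-H))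
          ((r θ + r (θ + Real.pi) - s θ) • tangentVec θ) θ := by
        intro θ
        have h1 := ((hK θ).add (hasStrictDerivAt_supportPt_neg h.body_left
          (hK (θ + Real.pi)))).sub (hH θ)
        rw [← add_smul, ← sub_smul] at h1
        refine h1.congr_of_eventuallyEq (Filter.Eventually.of_forall fun x => ?_)
        simp only [Pi.sub_apply, Pi.add_apply]
        rw [← hsum x]; abel
      refine h.neg_right.exists_eq_vadd hs hr hK hH' (fun θ => ?_) hne (by rw [e]; ring)
      rcases hsr θ with e | e <;> rw [e]
      · right; ring
      · left; ring

end propagation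

/-! ### Conclusion. -/

theorem theorem1p1 (K H : ConvexBody Plane)
    (hKint : (interior (K : Set Plane)).Nonempty)
    (hHint : (interior (H : Set Plane)).Nonempty)
    (hK : IsC2Plus (K : Set Plane))
    (hKH : CovariogramsCoincideNear K H
          (symmetryMidpoints K ∪ frontier (differenceBody (K : Set Plane))) ∨
        CovariogramsCoincideNear K H (symmetryMidpoints K ∪ {0})) :
    (∃ w : Plane, (H : Set Plane) = w +ᵥ (K : Set Plane)) ∨
      ∃ c : Plane, (H : Set Plane) = AffineEquiv.pointReflection ℝ c '' (K : Set Plane) := by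
  have hKb := isStrictBody_of_isC2Plus K.isCompact K.convex hKint hK
  have h := gapData_of_coincide hKb H.isCompact H.convex hHint hKH
  choose r hr hd using hasStrictDerivAt_supportPt hKb hK
  have hs := isSmoothBody_of_deriv hKb fun θ => ⟨r θ, hr θ, hd θ⟩
  have hH : ∀ θ, ∃ s : ℝ, (s = r θ ∨ s = r (θ + Real.pi)) ∧
      HasStrictDerivAt (supportPt (H : Set Plane)) (s • tangentVec θ) θ := fun θ =>
    (hasStrictDerivAt_of_gap hKb h.body_right h.sub_eq hs h.eventually_smallTangent hr hd θ).elim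
      (fun e => ⟨_, .inl rfl, e⟩) fun e => ⟨_, .inr rfl, e⟩
  choose s hsr hHd using hH
  refine (h.eq_vadd_or_neg_eq_vadd hs hr hd hHd hsr).imp_right ?_
  rintro ⟨w, hw⟩
  -- `-H = w +ᵥ K` means `H` is the image of `K` under `x ↦ -w - x`, the reflection in the point `-w
  -- / 2`.
  refine ⟨(1 / 2 : ℝ) • -w, ?_⟩
  rw [← neg_neg (H : Set Plane), hw, ← image_neg_eq_neg, ← image_vadd, image_image]
  refine image_congr fun x _ => ?_
  rw [AffineEquiv.pointReflection_apply, vsub_eq_sub, vadd_eq_add, vadd_eq_add]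
  module
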